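/- Let $0\le l<k\le n$ be integers and $\gamma\ge 1$ a real number, with $\gamma>1$ if $k=n$. Let $\Omega\subset\mathbb{R}^n$ be a bounded $C^4$ domain with unit inner normal $\nu$ on $\partial\Omega$, and let $\beta_0>0$. Write $\sigma_j(A)$ for the $j$-th elementary symmetric function of the eigenvalues of a real symmetric matrix $A$ (with $\sigma_0=1$). Suppose that - $f:\overline\Omega\times\mathbb{R}\to[0,\infty)$ satisfies $f^{1/(k-l)}\in C^{1,1}(\overline\Omega\times\mathbb{R})$ (that is, it is $C^1$ with locally Lipschitz differential); - $G=G(x,z,p)\in C^2(\partial\Omega\times\mathbb{R}\times\mathbb{R}^n)$ satisfies $G_{pp}=0$ and $G_p(x,z,p)\cdot\nu(x)\ge\beta_0$ for all $(x,z,p)\in\partial\Omega\times\mathbb{R}\times\mathbb{R}^n$; - $u\in C^4(\overline\Omega)$ is $k$-admissible, that is, $\sigma_i(\gamma\Delta u\,I-D^2u)>0$ in $\Omega$ for $1\le i\le k$, and $$\frac{\sigma_k}{\sigma_l}(\gamma\Delta u\,I-D^2u)=f(x,u)\ \text{ in }\Omega,\qquad G(x,u,Du)=0\ \text{ on }\partial\Omega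 .$$ Let $M$, $K_f$, $K_G$ be such that $\sup_{\overline\Omega}|u|\le M$ and $\sup_{\overline\Omega}|Du|\le M$, that the $C^{1,1}$ norm of $f^{1/(k-l)}$ over $\overline\Omega\times[-M,M]$ is at most $K_f$, and that the $C^2$ norm of $G$ over $\{x\in\partial\Omega,\ |z|\le M,\ |p|\le M\}$ is at most $K_G$. Then $$\sup_{\overline\Omega}|D^2u|\le C,$$ where $C>0$ depends only on $\Omega$, $n$, $k$, $l$, $\gamma$, $\beta_0$, $M$, $K_f$ and $K_G$. In particular $C$ does not depend on $\inf f$. -/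

import Mathlib

open Set Filter Topology

noncomputable section

namespace HessianQuotient

/-- `ρ` is a `C^m` local defining function of `Ω` at the point `x`: near `x` the set `Ω` is
`{ρ > 0}`, and the differential of `ρ` at `x` is non-zero. -/
structure IsLocalDefiningFunction {n : ℕ} (m : ℕ) (Ω : Set (EuclideanSpace ℝ (Fin n)))
    (x : EuclideanSpace ℝ (Fin n)) (ρ : EuclideanSpace ℝ (Fin n) → ℝ) : Prop where
  contDiffAt : ContDiffAt ℝ m ρ x
  fderiv_ne_zero : fderiv ℝ ρ x ≠ 0
  mem_iff : ∀ᶠ y in 𝓝 x, (y ∈ Ω ↔ 0 < ρ y)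

/-- A bounded `C^m` domain: a non-empty connected bounded open set lying locally on one side
of its `C^m` boundary. -/
structure IsBoundedCmDomain {n : ℕ} (m : ℕ) (Ω : Set (EuclideanSpace ℝ (Fin n))) : Prop where
  isOpen : IsOpen Ω
  isConnected : IsConnected Ω
  isBounded : Bornology.IsBounded Ω
  exists_defining : ∀ x ∈ frontier Ω, ∃ ρ, IsLocalDefiningFunction m Ω x ρ

/-- `ν` is the unit inner normal of `Ω` at the boundary point `x`, i.e. the normalized gradient
of a local defining function (it does not depend on the choice of that function). -/
def IsUnitInnerNormal {n : ℕ} (Ω : Set (EuclideanSpace ℝ (Fin n)))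
    (x ν : EuclideanSpace ℝ (Fin n)) : Prop :=
  ∃ ρ, IsLocalDefiningFunction 1 Ω x ρ ∧ ν = ‖gradient ρ x‖⁻¹ • gradient ρ x

/-- `σ_j` of the eigenvalues (with multiplicity) of a real symmetric matrix. -/
def sigma {n : ℕ} (j : ℕ) (A : Matrix (Fin n) (Fin n) ℝ) : ℝ :=
  A.charpoly.roots.esymm j

/-- The eigenvalues of the symmetric matrix `A` lie in the Gårding cone `Γ_k`. -/
def InGardingCone {n : ℕ} (k : ℕ) (A : Matrix (Fin n) (Fin n) ℝ) : Prop :=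
  ∀ i : ℕ, 1 ≤ i → i ≤ k → 0 < sigma i A

/-- The Hessian matrix `D²u(x)`. Derivatives are taken within `closure Ω`, so that they are
the usual ones in `Ω` and their continuous extensions on the boundary. -/
def hessian {n : ℕ} (Ω : Set (EuclideanSpace ℝ (Fin n))) (u : EuclideanSpace ℝ (Fin n) → ℝ)
    (x : EuclideanSpace ℝ (Fin n)) : Matrix (Fin n) (Fin n) ℝ :=
  Matrix.of fun i j => iteratedFDerivWithin ℝ 2 u (closure Ω) x
    ![EuclideanSpace.single i 1, EuclideanSpace.single j 1]

/-- The matrix `U = γ Δu I - D²u`. -/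
def augmentedHessian {n : ℕ} (Ω : Set (EuclideanSpace ℝ (Fin n))) (γ : ℝ)
    (u : EuclideanSpace ℝ (Fin n) → ℝ) (x : EuclideanSpace ℝ (Fin n)) :
    Matrix (Fin n) (Fin n) ℝ :=
  (γ * (hessian Ω u x).trace) • (1 : Matrix (Fin n) (Fin n) ℝ) - hessian Ω u x

/-- `u` is `k`-admissible in `Ω`. -/
def IsAdmissible {n : ℕ} (Ω : Set (EuclideanSpace ℝ (Fin n))) (γ : ℝ) (k : ℕ)
    (u : EuclideanSpace ℝ (Fin n) → ℝ) : Prop :=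
  ∀ x ∈ Ω, InGardingCone k (augmentedHessian Ω γ u x)

/-- `u` solves `(σ_k/σ_l)(γ Δu I - D²u) = f(x,u)` in `Ω`, `G(x,u,Du) = 0` on `∂Ω`. -/
structure IsSolution {n : ℕ} (Ω : Set (EuclideanSpace ℝ (Fin n))) (γ : ℝ) (k l : ℕ)
    (f : EuclideanSpace ℝ (Fin n) × ℝ → ℝ)
    (G : EuclideanSpace ℝ (Fin n) × ℝ × EuclideanSpace ℝ (Fin n) → ℝ)
    (u : EuclideanSpace ℝ (Fin n) → ℝ) : Prop where
  equation : ∀ x ∈ Ω, sigma k (augmentedHessian Ω γ u x) / sigma l (augmentedHessian Ω γ u x)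
    = f (x, u x)
  boundary : ∀ x ∈ frontier Ω, G (x, u x, gradientWithin u (closure Ω) x) = 0

/-- `|u|_{C¹} ≤ M` on `closure Ω`. -/
def C1NormLE {n : ℕ} (Ω : Set (EuclideanSpace ℝ (Fin n))) (u : EuclideanSpace ℝ (Fin n) → ℝ)
    (M : ℝ) : Prop :=
  ∀ x ∈ closure Ω, |u x| ≤ M ∧ ‖gradientWithin u (closure Ω) x‖ ≤ M

/-- `g ∈ C^{1,1}(closure Ω × ℝ)`: `g` is `C¹` with locally Lipschitz differential (up to the
boundary). -/
def IsC11 {n : ℕ} (Ω : Set (EuclideanSpace ℝ (Fin n)))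
    (g : EuclideanSpace ℝ (Fin n) × ℝ → ℝ) : Prop :=
  ContDiffOn ℝ 1 g (closure Ω ×ˢ univ) ∧
    LocallyLipschitzOn (closure Ω ×ˢ univ) (fderivWithin ℝ g (closure Ω ×ˢ univ))

/-- `|g|_{C^{1,1}} ≤ K`, the norm being taken over the bounded range
`closure Ω × [-M, M]` of the arguments `(x, z)`. -/
def C11NormLE {n : ℕ} (Ω : Set (EuclideanSpace ℝ (Fin n))) (M : ℝ)
    (g : EuclideanSpace ℝ (Fin n) × ℝ → ℝ) (K : ℝ) : Prop :=
  (∀ y ∈ closure Ω ×ˢ Icc (-M) M,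
    |g y| ≤ K ∧ ‖fderivWithin ℝ g (closure Ω ×ˢ univ) y‖ ≤ K) ∧
  ∀ y ∈ closure Ω ×ˢ Icc (-M) M, ∀ y' ∈ closure Ω ×ˢ Icc (-M) M,
    ‖fderivWithin ℝ g (closure Ω ×ˢ univ) y - fderivWithin ℝ g (closure Ω ×ˢ univ) y'‖
      ≤ K * ‖y - y'‖

/-- `G ∈ C²(∂Ω × ℝ × ℝⁿ)` and `|G|_{C²} ≤ K`, the norm being taken over the bounded range
`|z| ≤ M`, `|p| ≤ M`. As usual for functions on a (closed) hypersurface, being `C²` means being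
the restriction of an ambient `C²` function; the norm is the one of the derivatives of order
at most two of such an extension along `∂Ω`. -/
def IsC2BoundaryWithNormLE {n : ℕ} (Ω : Set (EuclideanSpace ℝ (Fin n))) (M : ℝ)
    (G : EuclideanSpace ℝ (Fin n) × ℝ × EuclideanSpace ℝ (Fin n) → ℝ) (K : ℝ) : Prop :=
  ∃ H : EuclideanSpace ℝ (Fin n) × ℝ × EuclideanSpace ℝ (Fin n) → ℝ,
    ContDiff ℝ 2 H ∧
    (∀ x ∈ frontier Ω, ∀ z p, H (x, z, p) = G (x, z, p)) ∧
    ∀ x ∈ frontier Ω, ∀ z p, |z| ≤ M → ‖p‖ ≤ M →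
      ∀ j : ℕ, j ≤ 2 → ‖iteratedFDeriv ℝ j H (x, z, p)‖ ≤ K

/-- Strict obliqueness: `G_p(x,z,p) · ν ≥ β₀` on `∂Ω × ℝ × ℝⁿ`. -/
def IsStrictlyOblique {n : ℕ} (Ω : Set (EuclideanSpace ℝ (Fin n)))
    (G : EuclideanSpace ℝ (Fin n) × ℝ × EuclideanSpace ℝ (Fin n) → ℝ) (β₀ : ℝ) : Prop :=
  ∀ x ∈ frontier Ω, ∀ ν, IsUnitInnerNormal Ω x ν → ∀ z p,
    β₀ ≤ inner ℝ (gradient (fun q => G (x, z, q)) p) ν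

/-- `G_pp = 0` on `∂Ω × ℝ × ℝⁿ`. -/
def GppEqZero {n : ℕ} (Ω : Set (EuclideanSpace ℝ (Fin n)))
    (G : EuclideanSpace ℝ (Fin n) × ℝ × EuclideanSpace ℝ (Fin n) → ℝ) : Prop :=
  ∀ x ∈ frontier Ω, ∀ z p, iteratedFDeriv ℝ 2 (fun q => G (x, z, q)) p = 0

end HessianQuotient

end

/-! The function F = (σ_k/σ_l)^{1/(k-l)} is concave on the Gårding cone. Concavity is used only
through supporting functionals: at each matrix of the cone a linear functional, diagonal in an
eigenbasis and with weights p_i ≥ 0, touches F from above (`exists_elliptic_support`). Composed with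
γΔu I - D²u and divided by its trace s = ∑ p_i, it becomes ∑ α_i D²u(v_i, v_i) with α_i = γ - p_i/s.
These coefficients lie between a constant lam > 0 and γ, because either γ > 1, or k < n and then no
single weight can carry almost all of the trace. The operator is thus uniformly elliptic. Moreover s
≥ F(1,…,1), so the right-hand side is f^{1/(k-l)} times a bounded factor, and inf f never enters.
Equality at a point together with an inequality nearby gives, along lines, the once differentiated
equation and a one-sided twice differentiated one (`IsRegular.differentiate_equation`).

Let m bound |D²u|. Applied to |Du|², a uniformly elliptic operator produces lam |D²u|², whereas the
other terms are O(1+m). At an interior maximum of u_ξξ + |Du|² this gives (u_ξξ)² ≤ C(1+m), hence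
u_ξξ ≤ ε(1+m) + C_ε (`le_of_sq_le_mul`). Every estimate below aims at this form. Since σ_1 > 0
forces Δu > 0, upper bounds of u_ξξ control the whole Hessian, and for small ε the resulting
inequality for m = max |D²u| closes (`exists_second_derivative_bound`).

At the boundary, G_pp = 0 makes the condition Du·A + β = 0 with A and β depending on (x, u) only.
Extending A, β and the traces of u along a retraction π onto ∂Ω makes the condition an identity on
an open set, which may be differentiated freely. One differentiation controls u_τA for tangential τ
by the gradient. The derivative u_AA is bounded by a barrier for Du·A(x₀)
(`exists_normal_estimate`). For u_ττ, the maximum of u_ττ + |Du|² over unit tangent vectors is taken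
at some (x₀, e). Near x₀ the function u_ee + |Du|² is bounded on ∂Ω by an affine function plus a
quadratic error (`Problem.tangential_expansion`). A barrier then yields either an interior maximum,
which is good, or a sign of u_Aee contradicting the twice differentiated boundary condition
(`exists_tangential_estimate`). Decomposing ξ = τ + cA combines the three bounds. -/

noncomputable section
namespace HessianQuotient

/-! ### Elementary symmetric functions of real families -/

/-- The `j`-th elementary symmetric function of the family `x` restricted to `s`. -/
def esym {ι : Type*} (s : Finset ι) (j : ℕ) (x : ι → ℝ) : ℝ :=
  ∑ t ∈ s.powersetCard j, ∏ i ∈ t, x i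

/-! ### Newton's inequalities from real-rootedness. -/

section Newton

open Polynomial

theorem splits_derivative {p : ℝ[X]} (hp : p.Splits) : (derivative p).Splits := by
  rw [splits_iff_card_roots] at hp ⊢
  have h1 := card_roots_le_derivative p
  have h2 := (derivative p).card_roots'
  have h3 := natDegree_derivative_le p
  rcases Nat.eq_zero_or_pos p.natDegree with h | h
  · omega
  · omega

theorem splits_iterate_derivative {p : ℝ[X]} (hp : p.Splits) (k : ℕ) :
    (derivative^[k] p).Splits := by
  induction k with
  | zero => exact hp
  | succ k ih => rw [Function.iterate_succ_apply']; exact splits_derivative ih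

/-- This is (p'/p)' = -∑ (x - a)⁻² ≤ 0 with denominators cleared. The induction on the roots avoids
dividing by p. -/
theorem laguerre_prod (m : Multiset ℝ) (x : ℝ) :
    (m.map fun a => X - C a).prod.eval x *
      (derivative (derivative (m.map fun a => X - C a).prod)).eval x ≤
      (derivative (m.map fun a => X - C a).prod).eval x ^ 2 := by
  induction m using Multiset.induction with
  | empty => simp
  | cons a m ih =>
    simp only [Multiset.map_cons, Multiset.prod_cons, derivative_mul, derivative_sub, derivative_X,
      derivative_C, sub_zero, one_mul, derivative_add, eval_mul, eval_add, eval_sub, eval_X, eval_C]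
    set p := (m.map fun a => X - C a).prod
    nlinarith [mul_nonneg (sq_nonneg (x - a)) (sub_nonneg.2 ih), sq_nonneg (p.eval x)]

theorem Splits.laguerre {p : ℝ[X]} (hp : p.Splits) (x : ℝ) :
    p.eval x * (derivative (derivative p)).eval x ≤ (derivative p).eval x ^ 2 := by
  have h := hp.eq_prod_roots
  have := laguerre_prod p.roots x
  rw [h]
  simp only [derivative_C_mul, eval_mul, eval_C]
  nlinarith [mul_le_mul_of_nonneg_left this (sq_nonneg p.leadingCoeff)]

/-- Laguerre's inequality at 0 for the k-th derivative, which is again real-rooted: its value and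
first two derivatives there are factorials times consecutive coefficients. The sharp binomial factor
is discarded. -/
theorem Splits.coeff_mul_coeff_le {p : ℝ[X]} (hp : p.Splits) (k : ℕ) :
    p.coeff k * p.coeff (k + 2) ≤ p.coeff (k + 1) ^ 2 := by
  have h := Splits.laguerre (splits_iterate_derivative hp k) 0
  rw [← Function.iterate_succ_apply' derivative, ← Function.iterate_succ_apply' derivative,
    ← coeff_zero_eq_eval_zero, ← coeff_zero_eq_eval_zero, ← coeff_zero_eq_eval_zero,
    coeff_iterate_derivative, coeff_iterate_derivative, coeff_iterate_derivative] at h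
  simp only [zero_add, Nat.succ_eq_add_one, Nat.descFactorial_self, nsmul_eq_mul,
    Nat.factorial_succ] at h
  push_cast at h
  have hk : (0 : ℝ) < k.factorial := by positivity
  have h2 : (p.coeff k * p.coeff (k + 2)) * (k + 2) ≤ p.coeff (k + 1) ^ 2 * (k + 1) := by
    have h3 : (k.factorial : ℝ) ^ 2 * (k + 1) * ((p.coeff k * p.coeff (k + 2)) * (k + 2))
      ≤ (k.factorial : ℝ) ^ 2 * (k + 1) * (p.coeff (k + 1) ^ 2 * (k + 1)) := by
      have e1 : k + 1 + 1 = k + 2 := rfl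
      rw [e1] at h
      nlinarith
    exact le_of_mul_le_mul_left h3 (by positivity)
  have hk0 : (0 : ℝ) ≤ k := by positivity
  have := sq_nonneg (p.coeff (k + 1))
  by_contra hc
  push Not at hc
  nlinarith

theorem esym_mul_esym_le {ι : Type*} (s : Finset ι) (x : ι → ℝ) (j : ℕ) :
    esym s j x * esym s (j + 2) x ≤ esym s (j + 1) x ^ 2 := by
  by_cases hj : j + 2 ≤ s.card
  · have hp : (∏ i ∈ s, (X + C (x i))).Splits :=
      Splits.prod fun i _ => Splits.X_add_C _
    have h := Splits.coeff_mul_coeff_le hp (s.card - (j + 2))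
    rw [Finset.prod_X_add_C_coeff s x (by omega), Finset.prod_X_add_C_coeff s x (by omega),
      Finset.prod_X_add_C_coeff s x (by omega)] at h
    have e1 : s.card - (s.card - (j + 2)) = j + 2 := by omega
    have e2 : s.card - (s.card - (j + 2) + 2) = j := by omega
    have e3 : s.card - (s.card - (j + 2) + 1) = j + 1 := by omega
    rw [e1, e2, e3] at h
    unfold esym
    linarith
  · have : esym s (j + 2) x = 0 := by
      unfold esym
      rw [Finset.powersetCard_eq_empty.2 (by omega)]; simp
    rw [this]; nlinarith [sq_nonneg (esym s (j + 1) x)]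

end Newton

/-! ### The vector Gårding cone and concavity of consecutive quotients. -/

section Cone

variable {ι : Type*}

@[simp] theorem esym_zero (s : Finset ι) (x : ι → ℝ) : esym s 0 x = 1 := by simp [esym]

theorem esym_one (s : Finset ι) (x : ι → ℝ) : esym s 1 x = ∑ i ∈ s, x i := by
  simp [esym, Finset.powersetCard_one]

theorem esym_insert [DecidableEq ι] {s : Finset ι} {i : ι} (hi : i ∉ s) (j : ℕ) (x : ι → ℝ) :
    esym (insert i s) (j + 1) x = esym s (j + 1) x + x i * esym s j x := by
  unfold esym
  rw [Finset.powersetCard_succ_insert hi, Finset.sum_union, Finset.sum_image, Finset.mul_sum]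
  · congr 1
    refine Finset.sum_congr rfl fun t ht => ?_
    rw [Finset.prod_insert]
    exact fun h => hi ((Finset.mem_powersetCard.1 ht).1 h)
  · intro t ht t' ht' h
    have h1 : i ∉ t := fun h => hi ((Finset.mem_powersetCard.1 ht).1 h)
    have h2 : i ∉ t' := fun h => hi ((Finset.mem_powersetCard.1 ht').1 h)
    rw [← Finset.erase_insert h1, ← Finset.erase_insert h2]
    exact congrArg (fun u => Finset.erase u i) h
  · rw [Finset.disjoint_left]
    intro t ht ht'
    obtain ⟨t', _, rfl⟩ := Finset.mem_image.1 ht'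
    exact hi ((Finset.mem_powersetCard.1 ht).1 (Finset.mem_insert_self _ _))

theorem esym_erase [DecidableEq ι] {s : Finset ι} {i : ι} (hi : i ∈ s) (j : ℕ) (x : ι → ℝ) :
    esym s (j + 1) x = esym (s.erase i) (j + 1) x + x i * esym (s.erase i) j x := by
  conv_lhs => rw [← Finset.insert_erase hi]
  exact esym_insert (Finset.notMem_erase i s) j x

/-- Each monomial of degree j + 1 arises once for each of its j + 1 factors. -/
theorem sum_mul_esym_erase [DecidableEq ι] (s : Finset ι) (j : ℕ) (x : ι → ℝ) :
    ∑ i ∈ s, x i * esym (s.erase i) j x = (j + 1) * esym s (j + 1) x := by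
  induction s using Finset.induction generalizing j with
  | empty =>
    have : Finset.powersetCard (j + 1) (∅ : Finset ι) = ∅ :=
      Finset.powersetCard_eq_empty.2 (by simp)
    simp [esym, this]
  | insert a s ha ih =>
    rw [Finset.sum_insert ha, Finset.erase_insert ha, esym_insert ha]
    have h1 : ∀ i ∈ s, (insert a s).erase i = insert a (s.erase i) := fun i hi =>
      Finset.erase_insert_of_ne (by rintro rfl; exact ha hi)
    have h2 : ∀ i ∈ s, a ∉ s.erase i := fun i _ h => ha (Finset.mem_of_mem_erase h)
    cases j with
    | zero =>
      have := ih 0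
      simp only [esym_zero, mul_one, Nat.cast_zero, zero_add, one_mul] at this ⊢
      linarith
    | succ j =>
      have : ∑ i ∈ s, x i * esym ((insert a s).erase i) (j + 1) x
          = ∑ i ∈ s, (x i * esym (s.erase i) (j + 1) x + x a * (x i * esym (s.erase i) j x)) := by
        refine Finset.sum_congr rfl fun i hi => ?_
        rw [h1 i hi, esym_insert (h2 i hi)]; ring
      rw [this, Finset.sum_add_distrib, ← Finset.mul_sum, ih, ih]
      push_cast; ring

/-- The vector Gårding cone. -/
def Cone (s : Finset ι) (k : ℕ) : Set (ι → ℝ) :=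
  {x | ∀ j, 1 ≤ j → j ≤ k → 0 < esym s j x}

theorem Cone.pos {s : Finset ι} {k j : ℕ} {x : ι → ℝ} (hx : x ∈ Cone s k) (hj : j ≤ k) :
    0 < esym s j x := by
  rcases Nat.eq_zero_or_pos j with rfl | h
  · simp
  · exact hx j h hj

theorem Cone.mono {s : Finset ι} {k k' : ℕ} (h : k ≤ k') : Cone s k' ⊆ Cone s k :=
  fun _ hx j h1 h2 => hx j h1 (h2.trans h)

/-- Write a, b, c for the functions of degree k+2, k+1, k of the erased family. If b ≤ 0, combining
a + x_i b > 0 (times c) and b + x_i c > 0 (times -b) eliminates x_i and gives ac > b², against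
Newton's inequality. -/
theorem Cone.erase [DecidableEq ι] {s : Finset ι} {k : ℕ} {x : ι → ℝ} (hx : x ∈ Cone s (k + 1))
    {i : ι} (hi : i ∈ s) : x ∈ Cone (s.erase i) k := by
  induction k with
  | zero => intro j h1 h2; omega
  | succ k ih =>
    have h0 := ih (Cone.mono (Nat.le_succ _) hx)
    intro j h1 h2
    rcases Nat.lt_or_ge j (k + 1) with h | h
    · exact h0 j h1 (by omega)
    obtain rfl : j = k + 1 := le_antisymm h2 h
    by_contra hneg
    push Not at hneg
    have p1 := Cone.pos hx (le_refl (k + 1 + 1))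
    have p2 := Cone.pos hx (Nat.le_succ (k + 1))
    have p3 := Cone.pos h0 (le_refl k)
    have nw := esym_mul_esym_le (s.erase i) x k
    rw [esym_erase hi] at p1 p2
    have e1 : k + 1 + 1 = k + 2 := rfl
    rw [e1] at p1
    generalize esym (s.erase i) (k + 2) x = a at *
    generalize esym (s.erase i) (k + 1) x = b at *
    generalize esym (s.erase i) k x = c at *
    nlinarith [mul_pos p1 p3, mul_nonneg (neg_nonneg.2 hneg) p2.le]

/-- The Marcus–Lopes supporting functional of `σ_{j+1} / σ_j`. -/
theorem exists_support_quotient [DecidableEq ι] (j : ℕ) (s : Finset ι) {x : ι → ℝ}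
    (hx : x ∈ Cone s j) :
    ∃ L : (ι → ℝ) →ₗ[ℝ] ℝ, L x = esym s (j + 1) x / esym s j x ∧
      ∀ y ∈ Cone s j, esym s (j + 1) y / esym s j y ≤ L y := by
  induction j generalizing s with
  | zero =>
    refine ⟨∑ i ∈ s, LinearMap.proj i, ?_, fun y _ => ?_⟩ <;> simp [esym_one]
  | succ j ih =>
    -- This writes the quotient as a sum of y_i - y_i²/q_i(y), where q_i divides the full function
    -- of degree j+1 by the erased one of degree j. Concavity then follows from concavity of q_i,
    -- since y²/q is convex and decreasing in q > 0.
    have key : ∀ y ∈ Cone s (j + 1), (j + 2 : ℝ) * (esym s (j + 2) y / esym s (j + 1) y)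
        = ∑ i ∈ s, (y i - y i ^ 2 * (esym (s.erase i) j y / esym s (j + 1) y)) := by
      intro y hy
      have h1 := sum_mul_esym_erase s (j + 1) y
      have hp := Cone.pos hy le_rfl
      have h2 : ∀ i ∈ s, y i * esym (s.erase i) (j + 1) y
          = y i * esym s (j + 1) y - y i ^ 2 * esym (s.erase i) j y := by
        intro i hi; rw [esym_erase hi j y]; ring
      rw [Finset.sum_congr rfl h2] at h1
      push_cast at h1
      have h3 : (j + 2 : ℝ) * esym s (j + 2) y
        = ∑ i ∈ s, (y i * esym s (j + 1) y - y i ^ 2 * esym (s.erase i) j y) := by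
        rw [h1]; ring
      rw [← mul_div_assoc, h3, Finset.sum_div]
      refine Finset.sum_congr rfl fun i _ => ?_
      field_simp
    have hden : ∀ y ∈ Cone s (j + 1), ∀ i ∈ s, 0 < esym (s.erase i) j y := fun y hy i hi =>
      Cone.pos (Cone.erase hy hi) le_rfl
    -- Here q_i is y_i plus the consecutive quotient of lower degree for the erased family, to which
    -- the induction hypothesis applies.
    have hyq : ∀ y ∈ Cone s (j + 1), ∀ i ∈ s, esym s (j + 1) y / esym (s.erase i) j y
        = y i + esym (s.erase i) (j + 1) y / esym (s.erase i) j y := by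
      intro y hy i hi
      have := hden y hy i hi
      rw [esym_erase hi j y]; field_simp; ring
    choose! L hL1 hL2 using fun i (hi : i ∈ s) => ih (s.erase i) (Cone.erase hx hi)
    -- The ratio x_i/q_i(x): the plane 2cy - c²q supports y²/q from below and touches it at x.
    let c : ι → ℝ := fun i => x i * (esym (s.erase i) j x / esym s (j + 1) x)
    refine ⟨(1 / (j + 2 : ℝ)) • ∑ i ∈ s, ((1 - 2 * c i + c i ^ 2) • (LinearMap.proj i)
      + c i ^ 2 • L i), ?_, ?_⟩
    · have hj : (0 : ℝ) < j + 2 := by positivity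
      rw [← mul_right_inj' hj.ne', show j + 1 + 1 = j + 2 from rfl, key x hx]
      simp only [LinearMap.smul_apply, LinearMap.sum_apply, LinearMap.add_apply, smul_eq_mul,
        LinearMap.proj_apply]
      rw [← mul_assoc, mul_one_div_cancel hj.ne', one_mul]
      refine Finset.sum_congr rfl fun i hi => ?_
      have h1 := hden x hx i hi
      have h2 := Cone.pos hx le_rfl
      rw [hL1 i hi]
      have h3 := hyq x hx i hi
      have h4 : esym (s.erase i) (j + 1) x / esym (s.erase i) j x
        = esym s (j + 1) x / esym (s.erase i) j x - x i := by linarith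
      rw [h4]
      simp only [c]
      field_simp
      ring
    · intro y hy
      have hj : (0 : ℝ) < j + 2 := by positivity
      rw [← mul_le_mul_iff_right₀ hj, show j + 1 + 1 = j + 2 from rfl, key y hy]
      simp only [LinearMap.smul_apply, LinearMap.sum_apply, LinearMap.add_apply, smul_eq_mul,
        LinearMap.proj_apply]
      rw [← mul_assoc, mul_one_div_cancel hj.ne', one_mul]
      refine Finset.sum_le_sum fun i hi => ?_
      have h1 := hden y hy i hi
      have h2 := Cone.pos hy le_rfl
      have h3 := hyq y hy i hi
      have h4 := hL2 i hi y (Cone.erase hy hi)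
      have h5 : 0 < esym s (j + 1) y / esym (s.erase i) j y := div_pos h2 h1
      have h6 : esym (s.erase i) j y / esym s (j + 1) y
        = (esym s (j + 1) y / esym (s.erase i) j y)⁻¹ := by rw [inv_div]
      rw [h6]
      set q := esym s (j + 1) y / esym (s.erase i) j y
      have h7 : 2 * c i * y i - c i ^ 2 * q ≤ y i ^ 2 * q⁻¹ := by
        rw [← div_eq_mul_inv, le_div_iff₀ h5]
        nlinarith [sq_nonneg (y i - c i * q)]
      nlinarith [mul_le_mul_of_nonneg_left h4 (sq_nonneg (c i))]

end Cone

/-! ### Supporting functionals of the general quotient, and symmetrization. -/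

section Support

variable {ι : Type*}

theorem prod_quotient (s : Finset ι) (l m : ℕ) {x : ι → ℝ} (hx : x ∈ Cone s (l + m)) :
    ∏ i ∈ Finset.range m, esym s (l + i + 1) x / esym s (l + i) x
      = esym s (l + m) x / esym s l x := by
  induction m with
  | zero => simp [(Cone.pos hx (Nat.le_add_right l 0)).ne']
  | succ m ih =>
    rw [Finset.prod_range_succ, ih (Cone.mono (by omega) hx)]
    have h1 := Cone.pos hx (show l + m ≤ l + (m + 1) by omega)
    have h2 := Cone.pos hx (show l ≤ l + (m + 1) by omega)
    field_simp
    rfl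

/-- The function `(σ_k / σ_l)^{1/(k-l)}` has a supporting functional at every point of the cone. -/
theorem exists_support [DecidableEq ι] (s : Finset ι) {k l : ℕ} (hlk : l < k) {x : ι → ℝ}
    (hx : x ∈ Cone s k) :
    ∃ L : (ι → ℝ) →ₗ[ℝ] ℝ,
      L x = (esym s k x / esym s l x) ^ (1 / ((k : ℝ) - (l : ℝ))) ∧
      ∀ y ∈ Cone s k, (esym s k y / esym s l y) ^ (1 / ((k : ℝ) - (l : ℝ))) ≤ L y := by
  obtain ⟨m, rfl⟩ := Nat.exists_eq_add_of_lt hlk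
  set m' := m + 1 with hm'
  have hkl : l + m + 1 = l + m' := by omega
  rw [hkl] at hx ⊢
  have hw : (((l + m' : ℕ) : ℝ) - l) = m' := by push_cast; ring
  rw [hw]
  have hm0 : (0 : ℝ) < m' := by rw [hm']; positivity
  have hx' : ∀ i, i < m' → x ∈ Cone s (l + i) := fun i hi => Cone.mono (by omega) hx
  choose! L hL1 hL2 using fun i (hi : i < m') => exists_support_quotient (l + i) s (hx' i hi)
  let q : ℕ → (ι → ℝ) → ℝ := fun i y => esym s (l + i + 1) y / esym s (l + i) y
  have hq : ∀ y ∈ Cone s (l + m'), ∀ i, i < m' → 0 < q i y := fun y hy i hi =>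
    div_pos (Cone.pos hy (by omega)) (Cone.pos hy (by omega))
  set φ := (esym s (l + m') x / esym s l x) ^ (1 / (m' : ℝ)) with hφ
  have hφ0 : 0 < φ := Real.rpow_pos_of_pos
    (div_pos (Cone.pos hx le_rfl) (Cone.pos hx (by omega))) _
  -- The quotient root is the geometric mean of consecutive quotients q_i. The functional is the
  -- differential at x of the geometric mean, with each q_i replaced by its support; that it lies
  -- above is the arithmetic-geometric mean inequality for q_i(y)/q_i(x).
  refine ⟨φ • ∑ i ∈ Finset.range m', (1 / (m' : ℝ) * (q i x)⁻¹) • L i, ?_, ?_⟩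
  · simp only [LinearMap.smul_apply, LinearMap.sum_apply, smul_eq_mul]
    rw [Finset.sum_congr rfl (g := fun _ => 1 / (m' : ℝ))]
    · rw [Finset.sum_const, Finset.card_range, nsmul_eq_mul, mul_one_div_cancel hm0.ne', mul_one]
    · intro i hi
      rw [hL1 i (Finset.mem_range.1 hi)]
      have := hq x hx i (Finset.mem_range.1 hi)
      change 1 / (m' : ℝ) * (q i x)⁻¹ * q i x = _
      field_simp
  · intro y hy
    simp only [LinearMap.smul_apply, LinearMap.sum_apply, smul_eq_mul]
    have hz : ∀ i ∈ Finset.range m', 0 ≤ q i y / q i x := fun i hi =>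
      (div_pos (hq y hy i (Finset.mem_range.1 hi)) (hq x hx i (Finset.mem_range.1 hi))).le
    have amgm := Real.geom_mean_le_arith_mean_weighted (Finset.range m') (fun _ => 1 / (m' : ℝ))
      (fun i => q i y / q i x) (fun _ _ => by positivity)
      (by rw [Finset.sum_const, Finset.card_range, nsmul_eq_mul, mul_one_div_cancel hm0.ne']) hz
    rw [Real.finsetProd_rpow _ _ hz, Finset.prod_div_distrib] at amgm
    have e1 : ∏ i ∈ Finset.range m', q i y = esym s (l + m') y / esym s l y :=
      prod_quotient s l m' hy
    have e2 : ∏ i ∈ Finset.range m', q i x = esym s (l + m') x / esym s l x :=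
      prod_quotient s l m' hx
    rw [e1, e2, Real.div_rpow (div_pos (Cone.pos hy le_rfl) (Cone.pos hy (by omega))).le
      (div_pos (Cone.pos hx le_rfl) (Cone.pos hx (by omega))).le, ← hφ, div_le_iff₀ hφ0] at amgm
    refine amgm.trans ?_
    rw [mul_comm]
    refine mul_le_mul_of_nonneg_left (Finset.sum_le_sum fun i hi => ?_) hφ0.le
    have h1 := hL2 i (Finset.mem_range.1 hi) y
      (Cone.mono (by have := Finset.mem_range.1 hi; omega) hy)
    have h2 := hq x hx i (Finset.mem_range.1 hi)
    calc 1 / (m' : ℝ) * (q i y / q i x) = 1 / (m' : ℝ) * (q i x)⁻¹ * q i y := by ring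
      _ ≤ _ := mul_le_mul_of_nonneg_left h1 (by positivity)

theorem esym_comp_perm [Fintype ι] (j : ℕ) (x : ι → ℝ) (e : Equiv.Perm ι) :
    esym Finset.univ j (x ∘ e) = esym Finset.univ j x := by
  have h : ∀ y : ι → ℝ, esym Finset.univ j y = (Finset.univ.val.map y).esymm j := fun y => by
    rw [Finset.esymm_map_val]; rfl
  rw [h, h, ← Multiset.map_map]
  congr 2
  have := Finset.map_univ_equiv e
  exact congrArg Finset.val this

theorem esym_const [Fintype ι] (s : Finset ι) (j : ℕ) :
    esym s j (fun _ => (1 : ℝ)) = (s.card.choose j : ℝ) := by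
  simp [esym]

theorem esym_congr {s : Finset ι} {j : ℕ} {x y : ι → ℝ} (h : ∀ i ∈ s, x i = y i) :
    esym s j x = esym s j y :=
  Finset.sum_congr rfl fun _ ht => Finset.prod_congr rfl fun i hi =>
    h i ((Finset.mem_powersetCard.1 ht).1 hi)

theorem mem_cone_of_pos [Fintype ι] {k : ℕ} (hk : k ≤ Fintype.card ι) {x : ι → ℝ}
    (hx : ∀ i, 0 < x i) : x ∈ Cone Finset.univ k := by
  intro j _ hj
  refine Finset.sum_pos (fun t _ => Finset.prod_pos fun i _ => hx i) ?_
  exact Finset.powersetCard_nonempty.2 (by rw [Finset.card_univ]; omega)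

/-- For k below the dimension the cone reaches beyond the positive orthant by a definite amount in
each coordinate direction. Here 2^N beats every binomial coefficient that occurs. This is the source
of uniform ellipticity when γ = 1. -/
theorem mem_cone_one_sub [Fintype ι] [DecidableEq ι] {k : ℕ} (hk : k < Fintype.card ι) (i : ι) :
    (fun m => if m = i then -(1 / 2 ^ Fintype.card ι) else (1 : ℝ)) ∈ Cone Finset.univ k := by
  intro j hj1 hj2
  obtain ⟨j, rfl⟩ : ∃ j', j = j' + 1 := ⟨j - 1, by omega⟩
  rw [esym_erase (Finset.mem_univ i)]
  have hc : ∀ m ∈ Finset.univ.erase i,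
      (fun m => if m = i then -(1 / 2 ^ Fintype.card ι) else (1 : ℝ)) m = (fun _ => 1) m := by
    intro m hm; simp [Finset.ne_of_mem_erase hm]
  rw [esym_congr hc, esym_congr hc, esym_const, esym_const, if_pos rfl]
  rw [Finset.card_erase_of_mem (Finset.mem_univ _), Finset.card_univ]
  set N := Fintype.card ι
  have h1 : (1 : ℝ) ≤ ((N - 1).choose (j + 1) : ℝ) := by
    exact_mod_cast Nat.choose_pos (by omega)
  have h2 : ((N - 1).choose j : ℝ) < 2 ^ N := by
    have : (N - 1).choose j ≤ 2 ^ (N - 1) := Nat.choose_le_two_pow _ _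
    have h3 : 2 ^ (N - 1) < 2 ^ N := Nat.pow_lt_pow_right (by norm_num) (by omega)
    exact_mod_cast lt_of_le_of_lt this h3
  have h4 : (1 / 2 ^ N : ℝ) * ((N - 1).choose j : ℝ) < 1 := by
    rw [one_div_mul_eq_div, div_lt_one (by positivity)]; exact h2
  linarith

/-- By Birkhoff's theorem T is an average of permutations; the quotient is symmetric, so the support
inequality holds with the same left side at each permuted vector, and these are averaged. -/
theorem support_birkhoff [Fintype ι] [DecidableEq ι] {k l : ℕ} {L : (ι → ℝ) →ₗ[ℝ] ℝ}
    (hL : ∀ y ∈ Cone Finset.univ k,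
      (esym Finset.univ k y / esym Finset.univ l y) ^ (1 / ((k : ℝ) - (l : ℝ))) ≤ L y)
    {y : ι → ℝ} (hy : y ∈ Cone Finset.univ k) {T : Matrix ι ι ℝ} (hT : T ∈ doublyStochastic ℝ ι) :
    (esym Finset.univ k y / esym Finset.univ l y) ^ (1 / ((k : ℝ) - (l : ℝ)))
      ≤ L (T.mulVec y) := by
  obtain ⟨w, hw0, hw1, rfl⟩ := exists_eq_sum_perm_of_mem_doublyStochastic hT
  rw [Matrix.sum_mulVec, map_sum]
  set φ := (esym Finset.univ k y / esym Finset.univ l y) ^ (1 / ((k : ℝ) - (l : ℝ)))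
  calc φ = ∑ e, w e * φ := by rw [← Finset.sum_mul, hw1, one_mul]
    _ ≤ _ := by
      refine Finset.sum_le_sum fun e _ => ?_
      rw [Matrix.smul_mulVec, map_smul, smul_eq_mul, Matrix.permMatrix_mulVec]
      refine mul_le_mul_of_nonneg_left ?_ (hw0 e)
      have := hL (y ∘ e) (fun j h1 h2 => by rw [esym_comp_perm]; exact hy j h1 h2)
      rwa [esym_comp_perm, esym_comp_perm] at this

end Support

/-! ### From eigenvalue vectors to symmetric matrices. -/

section Matrices

variable {n : ℕ}

theorem sigma_eq_esym (j : ℕ) {A : Matrix (Fin n) (Fin n) ℝ} (hA : A.IsHermitian) :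
    sigma j A = esym Finset.univ j hA.eigenvalues := by
  rw [sigma, hA.roots_charpoly_eq_eigenvalues]
  exact Finset.esymm_map_val _ _ _

/-- The quadratic form of the matrix `B`. -/
def quadForm (B : Matrix (Fin n) (Fin n) ℝ) (v : EuclideanSpace ℝ (Fin n)) : ℝ :=
  v.ofLp ⬝ᵥ (B.mulVec v.ofLp)

theorem quadForm_eq_sum {B : Matrix (Fin n) (Fin n) ℝ} (hB : B.IsHermitian)
    (v : EuclideanSpace ℝ (Fin n)) :
    quadForm B v = ∑ j, (inner ℝ (hB.eigenvectorBasis j) v) ^ 2 * hB.eigenvalues j := by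
  have h1 : v.ofLp = ∑ j, (inner ℝ (hB.eigenvectorBasis j) v) • (hB.eigenvectorBasis j).ofLp := by
    conv_lhs => rw [← hB.eigenvectorBasis.sum_repr' v]
    simp
  have h2 : B.mulVec v.ofLp = ∑ j, (inner ℝ (hB.eigenvectorBasis j) v * hB.eigenvalues j) •
      (hB.eigenvectorBasis j).ofLp := by
    conv_lhs => rw [h1]
    rw [Matrix.mulVec_sum]
    refine Finset.sum_congr rfl fun j _ => ?_
    rw [Matrix.mulVec_smul, hB.mulVec_eigenvectorBasis, smul_smul]
  rw [quadForm, h2, dotProduct_sum]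
  refine Finset.sum_congr rfl fun j _ => ?_
  rw [dotProduct_smul, smul_eq_mul]
  have : v.ofLp ⬝ᵥ (hB.eigenvectorBasis j).ofLp = inner ℝ (hB.eigenvectorBasis j) v := by
    rw [EuclideanSpace.inner_eq_star_dotProduct]; simp
  rw [this]; ring

/-- If c is an eigenbasis of B, this matrix sends the eigenvalues of B to the diagonal of B in the
basis b (Schur–Horn). -/
theorem orthonormalBasis_doublyStochastic
    (b c : OrthonormalBasis (Fin n) ℝ (EuclideanSpace ℝ (Fin n))) :
    (Matrix.of fun i j => (inner ℝ (c j) (b i) : ℝ) ^ 2) ∈ doublyStochastic ℝ (Fin n) := by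
  rw [mem_doublyStochastic_iff_sum]
  refine ⟨fun i j => sq_nonneg _, fun i => ?_, fun j => ?_⟩
  · have := c.sum_sq_norm_inner_right (b i)
    simpa [b.orthonormal.1 i] using this
  · have := b.sum_sq_norm_inner_right (c j)
    simp only [c.orthonormal.1 j, Real.norm_eq_abs, sq_abs] at this
    simp only [Matrix.of_apply]
    rw [one_pow] at this
    exact (Finset.sum_congr rfl fun i _ => by rw [real_inner_comm]).trans this

/-- The function `(σ_k/σ_l)^{1/(k-l)}` on the matrix Gårding cone has supporting functionals which
are diagonal in an eigenbasis, and the induced coefficients `γ tr P - P` are elliptic. -/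
theorem exists_elliptic_support (n k l : ℕ) (hlk : l < k) (hkn : k ≤ n)
    (γ : ℝ) (hγ : 1 ≤ γ) (hkγ : k < n ∨ 1 < γ) :
    ∃ c₀ lam : ℝ, 0 < c₀ ∧ 0 < lam ∧ ∀ A : Matrix (Fin n) (Fin n) ℝ, A.IsHermitian →
      InGardingCone k A →
      ∃ (b : OrthonormalBasis (Fin n) ℝ (EuclideanSpace ℝ (Fin n))) (p : Fin n → ℝ),
        (∀ i, 0 ≤ p i) ∧ c₀ ≤ ∑ i, p i ∧ (∀ i, lam * ∑ j, p j ≤ γ * ∑ j, p j - p i) ∧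
        (sigma k A / sigma l A) ^ (1 / ((k : ℝ) - (l : ℝ))) = ∑ i, p i * quadForm A (b i) ∧
        ∀ B : Matrix (Fin n) (Fin n) ℝ, B.IsHermitian → InGardingCone k B →
          (sigma k B / sigma l B) ^ (1 / ((k : ℝ) - (l : ℝ))) ≤ ∑ i, p i * quadForm B (b i) := by
  have hone : (fun _ => 1 : Fin n → ℝ) ∈ Cone Finset.univ k :=
    mem_cone_of_pos (by simpa using hkn) fun _ => one_pos
  have hqpos : ∀ y ∈ Cone (Finset.univ : Finset (Fin n)) k,
      0 < (esym Finset.univ k y / esym Finset.univ l y) ^ (1 / ((k : ℝ) - (l : ℝ))) := fun y hy =>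
    Real.rpow_pos_of_pos (div_pos (Cone.pos hy le_rfl) (Cone.pos hy hlk.le)) _
  -- The first constant is the value at (1,…,1), a lower bound for the trace of any supporting
  -- functional. For k < n the second comes from `mem_cone_one_sub`; otherwise only p_i ≤ ∑ p_j is
  -- available and γ > 1 is needed.
  refine ⟨_, if k < n then 1 - 1 / (1 + 1 / 2 ^ n) else γ - 1, hqpos _ hone, ?_, ?_⟩
  · split_ifs with h
    · have : (0 : ℝ) < 1 / 2 ^ n := by positivity
      rw [sub_pos, div_lt_one (by positivity)]; linarith
    · have := hkγ.resolve_left h; linarith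
  intro A hA hAk
  have hAc : hA.eigenvalues ∈ Cone Finset.univ k := fun j h1 h2 => by
    rw [← sigma_eq_esym]; exact hAk j h1 h2
  obtain ⟨L, hL1, hL2⟩ := exists_support Finset.univ hlk hAc
  have hLsum : ∀ y, L y = ∑ i, L (Pi.single i 1) * y i := by
    intro y
    conv_lhs => rw [← Finset.univ_sum_single y]
    rw [map_sum]
    refine Finset.sum_congr rfl fun i _ => ?_
    have : (Pi.single i (y i) : Fin n → ℝ) = y i • Pi.single i 1 := by
      rw [← Pi.single_smul]; simp
    rw [this, map_smul, smul_eq_mul, mul_comm]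
  set p : Fin n → ℝ := fun i => L (Pi.single i 1) with hp
  have hLone : L (fun _ => 1) = ∑ i, p i := by rw [hLsum]; simp [hp]
  have hp0 : ∀ i, 0 ≤ p i := by
    intro i
    -- The basis vector lies only on the boundary of the positive orthant, so it is pushed inside by
    -- ε(1,…,1), and then ε tends to 0.
    have h : ∀ ε : ℝ, 0 < ε → 0 ≤ p i + ε * ∑ j, p j := by
      intro ε hε
      have hc : (Pi.single i 1 + ε • (fun _ => 1) : Fin n → ℝ) ∈ Cone Finset.univ k := by
        refine mem_cone_of_pos (by simpa using hkn) fun j => ?_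
        have : (0 : ℝ) ≤ (Pi.single i 1 : Fin n → ℝ) j := by
          rw [Pi.single_apply]; split_ifs <;> norm_num
        simp only [Pi.add_apply, Pi.smul_apply, smul_eq_mul, mul_one]; linarith
      have := (hqpos _ hc).le.trans (hL2 _ hc)
      rwa [map_add, map_smul, smul_eq_mul, hLone] at this
    have hlim : Tendsto (fun ε : ℝ => p i + ε * ∑ j, p j) (𝓝[>] 0) (𝓝 (p i + 0 * ∑ j, p j)) :=
      ((continuous_const.add (continuous_id.mul continuous_const)).tendsto 0).mono_left
        nhdsWithin_le_nhds
    rw [zero_mul, add_zero] at hlim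
    exact ge_of_tendsto hlim (eventually_nhdsWithin_of_forall fun ε hε => h ε hε)
  have hsum0 : 0 ≤ ∑ j, p j := Finset.sum_nonneg fun j _ => hp0 j
  refine ⟨hA.eigenvectorBasis, p, hp0, ?_, ?_, ?_, ?_⟩
  · rw [← hLone]; exact hL2 _ hone
  · intro i
    split_ifs with h
    · have hc := mem_cone_one_sub (k := k) (by simpa using h) i
      have h1 := (hqpos _ hc).le.trans (hL2 _ hc)
      have h2 : (fun m => if m = i then -(1 / 2 ^ Fintype.card (Fin n)) else (1 : ℝ))
          = (fun _ => 1) - (1 + 1 / 2 ^ n : ℝ) • (Pi.single i 1 : Fin n → ℝ) := by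
        ext m
        simp only [Pi.sub_apply, Pi.smul_apply, Pi.single_apply, smul_eq_mul, Fintype.card_fin]
        split_ifs <;> ring
      rw [h2, map_sub, map_smul, hLone, smul_eq_mul] at h1
      have h3 : (0 : ℝ) < 1 + 1 / 2 ^ n := by positivity
      have h4 : p i ≤ 1 / (1 + 1 / 2 ^ n) * ∑ j, p j := by
        rw [one_div_mul_eq_div, le_div_iff₀ h3]
        simp only [hp] at h1 ⊢; linarith
      nlinarith
    · have := Finset.single_le_sum (f := p) (fun j _ => hp0 j) (Finset.mem_univ i)
      linarith
  · rw [sigma_eq_esym _ hA, sigma_eq_esym _ hA, ← hL1, hLsum]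
    refine Finset.sum_congr rfl fun i _ => ?_
    congr 1
    rw [quadForm_eq_sum hA, Finset.sum_eq_single i]
    · simp
    · intro j _ hj
      rw [hA.eigenvectorBasis.inner_eq_zero hj]; simp
    · simp
  · intro B hB hBk
    have hBc : hB.eigenvalues ∈ Cone Finset.univ k := fun j h1 h2 => by
      rw [← sigma_eq_esym]; exact hBk j h1 h2
    rw [sigma_eq_esym _ hB, sigma_eq_esym _ hB]
    -- The functional found at the eigenvalues of A sees only the diagonal of B in the eigenbasis of
    -- A, a doubly stochastic image of the eigenvalues of B.
    have := support_birkhoff hL2 hBc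
      (orthonormalBasis_doublyStochastic hA.eigenvectorBasis hB.eigenvectorBasis)
    rw [hLsum] at this
    refine this.trans (le_of_eq (Finset.sum_congr rfl fun i _ => ?_))
    rw [quadForm_eq_sum hB]
    rfl

end Matrices

set_option maxSynthPendingDepth 10

theorem IsLocalDefiningFunction.differentiableAt {n m : ℕ} {Ω : Set (EuclideanSpace ℝ (Fin n))}
    {x : EuclideanSpace ℝ (Fin n)} {ρ : EuclideanSpace ℝ (Fin n) → ℝ}
    (h : IsLocalDefiningFunction m Ω x ρ) (hm : 1 ≤ m) : DifferentiableAt ℝ ρ x :=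
  h.contDiffAt.differentiableAt (by exact_mod_cast (by omega : m ≠ 0))

theorem eq_zero_of_mem_frontier {X : Type*} [TopologicalSpace X] {Ω : Set X} {x : X} {ρ : X → ℝ}
    (hΩ : IsOpen Ω) (hc : ContinuousAt ρ x)
    (hm : ∀ᶠ y in 𝓝 x, (y ∈ Ω ↔ 0 < ρ y)) (hx : x ∈ frontier Ω) : ρ x = 0 := by
  have h1 : ¬ 0 < ρ x := fun h => by
    have := hm.self_of_nhds.2 h
    rw [hΩ.frontier_eq] at hx
    exact hx.2 this
  refine le_antisymm (not_lt.1 h1) ?_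
  by_contra hneg
  push Not at hneg
  have h2 : ∀ᶠ y in 𝓝 x, ρ y < 0 := hc.eventually_lt continuousAt_const hneg
  have h3 : ∃ᶠ y in 𝓝 x, y ∈ Ω := mem_closure_iff_frequently.1 (frontier_subset_closure hx)
  obtain ⟨y, hy, hy2, hy3⟩ := (h3.and_eventually (h2.and hm)).exists
  exact absurd (hy3.1 hy) (not_lt.2 hy2.le)

/-! ### Defining functions, tangent vectors and boundary patches. -/

section Boundary

variable {E : Type*} [NormedAddCommGroup E] [NormedSpace ℝ E] {Ω : Set E} {x : E}
  {ρ ρ' : E → ℝ}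

theorem tendsto_ray (x w : E) :
    Tendsto (fun t : ℝ => x + t • w) (𝓝[>] 0) (𝓝 x) := by
  have : Continuous fun t : ℝ => x + t • w := by fun_prop
  have h := (this.tendsto 0).mono_left (nhdsWithin_le_nhds (s := Ioi 0))
  simpa using h

theorem eventually_pos_of_fderiv_pos (hd : DifferentiableAt ℝ ρ x) (h0 : ρ x = 0)
    {w : E} (hw : 0 < fderiv ℝ ρ x w) :
    ∀ᶠ t : ℝ in 𝓝[>] 0, 0 < ρ (x + t • w) := by
  have h1 : HasDerivAt (fun t : ℝ => ρ (x + t • w)) (fderiv ℝ ρ x w) 0 := by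
    have hl : HasDerivAt (fun t : ℝ => x + t • w) w 0 := by
      simpa using ((hasDerivAt_id (0 : ℝ)).smul_const w).const_add x
    have hd' : HasFDerivAt ρ (fderiv ℝ ρ x) (x + (0 : ℝ) • w) := by simpa using hd.hasFDerivAt
    exact hd'.comp_hasDerivAt 0 hl
  have h2 := h1.tendsto_slope_zero_right
  filter_upwards [h2.eventually (lt_mem_nhds hw), self_mem_nhdsWithin] with t ht ht0
  simp only [zero_add, zero_smul, add_zero, h0, sub_zero, smul_eq_mul] at ht
  exact (pos_iff_pos_of_mul_pos ht).1 (inv_pos.2 ht0)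

theorem eventually_mem_of_fderiv_pos (hΩ : IsOpen Ω) (hd : DifferentiableAt ℝ ρ x)
    (hm : ∀ᶠ y in 𝓝 x, (y ∈ Ω ↔ 0 < ρ y)) (hx : x ∈ frontier Ω) {w : E} (hw : 0 < fderiv ℝ ρ x w) :
    ∀ᶠ t : ℝ in 𝓝[>] 0, x + t • w ∈ Ω := by
  have h0 := eq_zero_of_mem_frontier hΩ hd.continuousAt hm hx
  filter_upwards [eventually_pos_of_fderiv_pos hd h0 hw,
    (tendsto_ray x w).eventually hm] with t h1 h2
  exact h2.2 h1

theorem exists_fderiv_eq_one {L : E →L[ℝ] ℝ} (hL : L ≠ 0) :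
    ∃ w, L w = 1 := by
  obtain ⟨v, hv⟩ : ∃ v, L v ≠ 0 := by
    by_contra! h
    exact hL (ContinuousLinearMap.ext h)
  exact ⟨(L v)⁻¹ • v, by simp [hv]⟩

/-- Two defining functions have the same tangent vectors. -/
theorem fderiv_eq_zero_of_defining (hΩ : IsOpen Ω)
    (hd : DifferentiableAt ℝ ρ x) (hm : ∀ᶠ y in 𝓝 x, (y ∈ Ω ↔ 0 < ρ y))
    (hne : fderiv ℝ ρ x ≠ 0)
    (hd' : DifferentiableAt ℝ ρ' x) (hm' : ∀ᶠ y in 𝓝 x, (y ∈ Ω ↔ 0 < ρ' y))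
    (hx : x ∈ frontier Ω) {τ : E} (hτ : fderiv ℝ ρ x τ = 0) :
    fderiv ℝ ρ' x τ = 0 := by
  have key : ∀ w, 0 < fderiv ℝ ρ x w → 0 ≤ fderiv ℝ ρ' x w := by
    intro w hw
    by_contra hneg
    push Not at hneg
    have h0 := eq_zero_of_mem_frontier hΩ hd'.continuousAt hm' hx
    have hneg' : 0 < fderiv ℝ (fun y => - ρ' y) x w := by
      rw [fderiv_fun_neg]; simpa using hneg
    have e1 := eventually_pos_of_fderiv_pos (ρ := fun y => - ρ' y) hd'.fun_neg (by simp [h0]) hneg'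
    have e2 := eventually_mem_of_fderiv_pos hΩ hd hm hx hw
    have e3 := (tendsto_ray x w).eventually hm'
    obtain ⟨t, t1, t2, t3⟩ := (e1.and (e2.and e3)).exists
    have := t3.1 t2
    linarith
  obtain ⟨w, hw⟩ := exists_fderiv_eq_one hne
  -- All vectors w + sτ point into Ω, and an affine function of s that is nonnegative on the whole
  -- line has slope zero.
  have hs : ∀ s : ℝ, 0 ≤ fderiv ℝ ρ' x w + s * fderiv ℝ ρ' x τ := by
    intro s
    have := key (w + s • τ) (by simp [hw, hτ])
    simpa using this
  by_contra hne'
  have := hs (-(fderiv ℝ ρ' x w + 1) / fderiv ℝ ρ' x τ)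
  rw [div_mul_cancel₀ _ hne'] at this
  linarith

/-- On the open set `V` the boundary of `Ω` is the zero set of `ρ`, and `π` is a `C²`
retraction of `V` onto the boundary; all with derivatives bounded by `P`. -/
structure Patch (Ω V : Set E) (P : ℝ)
    (ρ : E → ℝ)
    (π : E → E) : Prop where
  ρ_contDiffAt : ∀ x ∈ V, ContDiffAt ℝ 4 ρ x
  ρ_bound₁ : ∀ x ∈ V, ‖fderiv ℝ ρ x‖ ≤ P
  ρ_bound₂ : ∀ x ∈ V, ‖fderiv ℝ (fderiv ℝ ρ) x‖ ≤ P
  ρ_bound₃ : ∀ x ∈ V, ‖fderiv ℝ (fderiv ℝ (fderiv ℝ ρ)) x‖ ≤ P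
  ρ_grad : ∀ x ∈ V, 1 ≤ P * ‖fderiv ℝ ρ x‖
  mem_iff : ∀ x ∈ V, (x ∈ Ω ↔ 0 < ρ x)
  zero : ∀ x ∈ V, x ∈ frontier Ω → ρ x = 0
  π_contDiffAt : ∀ x ∈ V, ContDiffAt ℝ 4 π x
  π_bound₁ : ∀ x ∈ V, ‖fderiv ℝ π x‖ ≤ P
  π_bound₂ : ∀ x ∈ V, ‖fderiv ℝ (fderiv ℝ π) x‖ ≤ P
  π_mem : ∀ x ∈ V, π x ∈ frontier Ω
  π_eq : ∀ x ∈ V, x ∈ frontier Ω → π x = x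
  π_tangent : ∀ x ∈ V, x ∈ frontier Ω → ∀ τ, fderiv ℝ ρ x τ = 0 → fderiv ℝ π x τ = τ

theorem Patch.mono {V V' : Set E} {P P' : ℝ}
    {π : E → E}
    (h : Patch Ω V P ρ π) (hV : V' ⊆ V) (hP : P ≤ P') : Patch Ω V' P' ρ π where
  ρ_contDiffAt x hx := h.ρ_contDiffAt x (hV hx)
  ρ_bound₁ x hx := (h.ρ_bound₁ x (hV hx)).trans hP
  ρ_bound₂ x hx := (h.ρ_bound₂ x (hV hx)).trans hP
  ρ_bound₃ x hx := (h.ρ_bound₃ x (hV hx)).trans hP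
  ρ_grad x hx := (h.ρ_grad x (hV hx)).trans (by gcongr)
  mem_iff x hx := h.mem_iff x (hV hx)
  zero x hx := h.zero x (hV hx)
  π_contDiffAt x hx := h.π_contDiffAt x (hV hx)
  π_bound₁ x hx := (h.π_bound₁ x (hV hx)).trans hP
  π_bound₂ x hx := (h.π_bound₂ x (hV hx)).trans hP
  π_mem x hx := h.π_mem x (hV hx)
  π_eq x hx := h.π_eq x (hV hx)
  π_tangent x hx := h.π_tangent x (hV hx)

theorem Patch.eventually_mem_iff {V : Set E} {P : ℝ} {π : E → E} (h : Patch Ω V P ρ π)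
    (hV : IsOpen V) (hx : x ∈ V) : ∀ᶠ y in 𝓝 x, (y ∈ Ω ↔ 0 < ρ y) := by
  filter_upwards [hV.mem_nhds hx] with y hy using h.mem_iff y hy

theorem Patch.ρ_differentiableAt {V : Set E} {P : ℝ} {π : E → E} (h : Patch Ω V P ρ π)
    (hx : x ∈ V) : DifferentiableAt ℝ ρ x :=
  (h.ρ_contDiffAt x hx).differentiableAt (by norm_num)

theorem Patch.fderiv_ne_zero {V : Set E} {P : ℝ} {π : E → E} (h : Patch Ω V P ρ π)
    (hx : x ∈ V) : fderiv ℝ ρ x ≠ 0 := fun h0 => by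
  have := h.ρ_grad x hx
  rw [h0, norm_zero, mul_zero] at this
  linarith

/-- `τ` is tangent to `∂Ω` at `x`. -/
def IsTangent (Ω : Set E) (x τ : E) : Prop :=
  ∀ (V : Set E) (P : ℝ) (ρ : E → ℝ) (π : E → E), IsOpen V → x ∈ V → Patch Ω V P ρ π →
    fderiv ℝ ρ x τ = 0

theorem Patch.isTangent (hΩ : IsOpen Ω) {V : Set E} {P : ℝ} {π : E → E} (h : Patch Ω V P ρ π)
    (hV : IsOpen V) (hxV : x ∈ V) (hx : x ∈ frontier Ω) {τ : E} (hτ : fderiv ℝ ρ x τ = 0) :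
    IsTangent Ω x τ := fun _ _ _ _ hV' hxV' h' =>
  fderiv_eq_zero_of_defining hΩ (h.ρ_differentiableAt hxV) (h.eventually_mem_iff hV hxV)
    (h.fderiv_ne_zero hxV) (h'.ρ_differentiableAt hxV') (h'.eventually_mem_iff hV' hxV') hx hτ

end Boundary

/-! ### Boundary patches of uniform size for a C⁴ domain. -/

section Domain

variable {n : ℕ} {Ω : Set (EuclideanSpace ℝ (Fin n))} {x : EuclideanSpace ℝ (Fin n)}
  {ρ ρ' : EuclideanSpace ℝ (Fin n) → ℝ}

/-- At a boundary point the tangent cone contains the open half space on which the differential of a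
defining function is positive, and this spans. -/
theorem uniqueDiffOn_closure (hΩ : IsBoundedCmDomain 4 Ω) : UniqueDiffOn ℝ (closure Ω) := by
  intro x hx
  by_cases hxΩ : x ∈ Ω
  · exact uniqueDiffWithinAt_of_mem_nhds
      (mem_of_superset (hΩ.isOpen.mem_nhds hxΩ) subset_closure)
  have hxf : x ∈ frontier Ω := by rw [hΩ.isOpen.frontier_eq]; exact ⟨hx, hxΩ⟩
  obtain ⟨ρ, hρ⟩ := hΩ.exists_defining x hxf
  have hd := hρ.differentiableAt (by norm_num)
  rw [uniqueDiffWithinAt_iff]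
  refine ⟨?_, subset_closure hx⟩
  have hcone : ∀ w, 0 < fderiv ℝ ρ x w → w ∈ tangentConeAt ℝ (closure Ω) x := by
    intro w hw
    refine mem_tangentConeAt_of_frequently (𝓝[>] (0 : ℝ)) (fun t => t⁻¹) (fun t => t • w) ?_ ?_ ?_
    · have : Continuous fun t : ℝ => t • w := by fun_prop
      simpa using (this.tendsto 0).mono_left (nhdsWithin_le_nhds (s := Ioi 0))
    · exact ((eventually_mem_of_fderiv_pos hΩ.isOpen hd hρ.mem_iff hxf hw).mono
        fun t ht => subset_closure ht).frequently
    · refine tendsto_const_nhds.congr' ?_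
      filter_upwards [self_mem_nhdsWithin] with t ht
      rw [smul_smul, inv_mul_cancel₀ (ne_of_gt ht), one_smul]
  obtain ⟨w, hw⟩ := exists_fderiv_eq_one hρ.fderiv_ne_zero
  have : Submodule.span ℝ (tangentConeAt ℝ (closure Ω) x) = ⊤ := by
    rw [eq_top_iff]
    intro v _
    have h1 : v = (v + (1 - fderiv ℝ ρ x v) • w) - (1 - fderiv ℝ ρ x v) • w := by abel
    rw [h1]
    refine Submodule.sub_mem _ (Submodule.subset_span (hcone _ ?_))
      (Submodule.smul_mem _ _ (Submodule.subset_span (hcone _ ?_)))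
    · simp [hw]
    · rw [hw]; exact one_pos
  rw [this]
  exact dense_univ

theorem Patch.isLocalDefiningFunction {V : Set (EuclideanSpace ℝ (Fin n))} {P : ℝ}
    {π : EuclideanSpace ℝ (Fin n) → EuclideanSpace ℝ (Fin n)}
    (h : Patch Ω V P ρ π) (hV : IsOpen V) (hx : x ∈ V) :
    IsLocalDefiningFunction 1 Ω x ρ where
  contDiffAt := (h.ρ_contDiffAt x hx).of_le (by norm_num)
  fderiv_ne_zero := h.fderiv_ne_zero hx
  mem_iff := h.eventually_mem_iff hV hx

/-- A local diffeomorphism Φ straightens ∂Ω to the kernel of the differential ψ of ρ at z. The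
retraction is a linear projection onto this kernel followed by Φ⁻¹. The derivative bounds hold near
z by continuity. -/
theorem exists_patch_nhds (hΩ : IsBoundedCmDomain 4 Ω) {z : EuclideanSpace ℝ (Fin n)}
    (hz : z ∈ frontier Ω) :
    ∃ V ∈ 𝓝 z, ∃ P ρ π, Patch Ω V P ρ π := by
  obtain ⟨ρ, hρ⟩ := hΩ.exists_defining z hz
  have hρc : ContDiffAt ℝ 4 ρ z := hρ.contDiffAt
  have hρz : ρ z = 0 := eq_zero_of_mem_frontier hΩ.isOpen hρc.continuousAt hρ.mem_iff hz
  set ψ := fderiv ℝ ρ z with hψ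
  obtain ⟨w, hw⟩ := exists_fderiv_eq_one hρ.fderiv_ne_zero
  -- Chosen so that ψ ∘ Φ = ρ and DΦ(z) = id. On {ρ = 0} it coincides with the projection `pr`, so
  -- `g ∘ pr` fixes the boundary points.
  let Φ : EuclideanSpace ℝ (Fin n) → EuclideanSpace ℝ (Fin n) := fun x => x + (ρ x - ψ x) • w
  let pr : EuclideanSpace ℝ (Fin n) → EuclideanSpace ℝ (Fin n) := fun x => x - ψ x • w
  have hΦc : ContDiffAt ℝ 4 Φ z :=
    contDiffAt_id.add ((hρc.sub ψ.contDiff.contDiffAt).smul contDiffAt_const)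
  have hΦd : ∀ x, DifferentiableAt ℝ ρ x → HasFDerivAt Φ
      (ContinuousLinearMap.id ℝ _ + (fderiv ℝ ρ x - ψ).smulRight w) x := fun x hx =>
    (hasFDerivAt_id x).add ((hx.hasFDerivAt.sub ψ.hasFDerivAt).smul_const w)
  have hΦ' : HasFDerivAt Φ ((ContinuousLinearEquiv.refl ℝ (EuclideanSpace ℝ (Fin n)) :
      EuclideanSpace ℝ (Fin n) ≃L[ℝ] EuclideanSpace ℝ (Fin n)) :
      EuclideanSpace ℝ (Fin n) →L[ℝ] EuclideanSpace ℝ (Fin n)) z := by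
    have := hΦd z (hρc.differentiableAt (by norm_num))
    rw [← hψ, sub_self] at this
    convert this using 1
    ext v; simp
  let e := hΦc.toOpenPartialHomeomorph Φ hΦ' (by norm_num)
  let g := hΦc.localInverse hΦ' (by norm_num)
  have hg : ContDiffAt ℝ 4 g (Φ z) := hΦc.to_localInverse hΦ' (by norm_num)
  have hgz : g (Φ z) = z := hΦc.localInverse_apply_image hΦ' (by norm_num)
  have hes : z ∈ e.source := hΦc.mem_toOpenPartialHomeomorph_source hΦ' (by norm_num)
  have het : Φ z ∈ e.target := hΦc.image_mem_toOpenPartialHomeomorph_target hΦ' (by norm_num)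
  have hprz : pr z = Φ z := by simp [pr, Φ, hρz, sub_eq_add_neg]
  have hprc : ContDiff ℝ 4 pr := contDiff_id.sub (ψ.contDiff.smul contDiff_const)
  let π : EuclideanSpace ℝ (Fin n) → EuclideanSpace ℝ (Fin n) := fun x => g (pr x)
  have hπc : ContDiffAt ℝ 4 π z := ContDiffAt.comp z (by rw [hprz]; exact hg) hprc.contDiffAt
  have hπz : π z = z := by simp only [π, hprz, hgz]
  have hπt : Tendsto π (𝓝 z) (𝓝 z) := by
    have := hπc.continuousAt.tendsto; rwa [hπz] at this
  have hprt : Tendsto pr (𝓝 z) (𝓝 (Φ z)) := by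
    have := hprc.continuous.tendsto z; rwa [hprz] at this
  have ev1 := hρc.eventually (by norm_num)
  have c1 := (hρc.fderiv_right (m := 3) (by norm_num))
  have c2 := (c1.fderiv_right (m := 2) (by norm_num))
  have c3 := (c2.fderiv_right (m := 1) (by norm_num))
  have p1 := (hπc.fderiv_right (m := 3) (by norm_num))
  have p2 := (p1.fderiv_right (m := 2) (by norm_num))
  have b1 := c1.continuousAt.norm.eventually_lt continuousAt_const (lt_add_one _)
  have b2 := c2.continuousAt.norm.eventually_lt continuousAt_const (lt_add_one _)
  have b3 := c3.continuousAt.norm.eventually_lt continuousAt_const (lt_add_one _)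
  have b4 := p1.continuousAt.norm.eventually_lt continuousAt_const (lt_add_one _)
  have b5 := p2.continuousAt.norm.eventually_lt continuousAt_const (lt_add_one _)
  have hψ0 : 0 < ‖ψ‖ := norm_pos_iff.2 hρ.fderiv_ne_zero
  have b6 := (continuousAt_const (y := ‖ψ‖ / 2)).eventually_lt c1.continuousAt.norm
    (half_lt_self hψ0)
  have hdw : ∀ᶠ x in 𝓝 z, 0 < fderiv ℝ ρ x w := by
    have : ContinuousAt (fun x => fderiv ℝ ρ x w) z := c1.continuousAt.clm_apply continuousAt_const
    exact continuousAt_const.eventually_lt this (by rw [← hψ, hw]; exact one_pos)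
  have hmem := hρ.mem_iff.eventually_nhds
  have hfr : ∀ᶠ y in 𝓝 z, ρ y = 0 → y ∈ frontier Ω := by
    filter_upwards [hmem, hdw, ev1] with y hy1 hy2 hy3 hy0
    rw [hΩ.isOpen.frontier_eq]
    refine ⟨?_, fun h => by have := hy1.self_of_nhds.1 h; linarith⟩
    have hd : DifferentiableAt ℝ ρ y := hy3.differentiableAt (by norm_num)
    refine mem_closure_of_tendsto (tendsto_ray y w) ?_
    filter_upwards [eventually_pos_of_fderiv_pos hd hy0 hy2, (tendsto_ray y w).eventually hy1]
      with t h1 h2 using h2.2 h1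
  have hzero : ∀ᶠ y in 𝓝 z, y ∈ frontier Ω → ρ y = 0 := by
    filter_upwards [hmem, ev1] with y hy1 hy2 hy
    exact eq_zero_of_mem_frontier hΩ.isOpen hy2.continuousAt hy1 hy
  have hright : ∀ᶠ x in 𝓝 z, Φ (π x) = pr x := by
    filter_upwards [hprt.eventually (e.open_target.mem_nhds het)] with x hx
    exact e.right_inv hx
  have hψΦ : ∀ x, ψ (Φ x) = ρ x := fun x => by
    have hw' : ψ w = 1 := hw
    simp [Φ, hw']
  have hψpr : ∀ x, ψ (pr x) = 0 := fun x => by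
    have hw' : ψ w = 1 := hw
    simp [pr, hw']
  have hπfr : ∀ᶠ x in 𝓝 z, π x ∈ frontier Ω := by
    filter_upwards [hright, hπt.eventually hfr] with x h1 h2
    exact h2 (by rw [← hψΦ, h1, hψpr])
  have hleft : ∀ᶠ x in 𝓝 z, g (Φ x) = x := by
    filter_upwards [e.open_source.mem_nhds hes] with x hx using e.left_inv hx
  have hprΦ : ∀ x, ρ x = 0 → pr x = Φ x := fun x hx => by
    simp [pr, Φ, hx, sub_eq_add_neg]
  have hπid : ∀ᶠ x in 𝓝 z, x ∈ frontier Ω → π x = x := by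
    filter_upwards [hzero, hleft] with x h1 h2 hx
    simp only [π]; rw [hprΦ x (h1 hx), h2]
  have hgd : ∀ᶠ x in 𝓝 z, DifferentiableAt ℝ g (Φ x) :=
    hΦc.continuousAt.eventually ((hg.eventually (by norm_num)).mono
      fun y hy => hy.differentiableAt (by norm_num))
  -- On tangent vectors `pr` and Φ have the same differential, and the differential of g ∘ Φ is the
  -- identity.
  have hπtan : ∀ᶠ x in 𝓝 z, x ∈ frontier Ω → ∀ τ, fderiv ℝ ρ x τ = 0 →
      fderiv ℝ π x τ = τ := by
    filter_upwards [hzero, hleft.eventually_nhds, hgd, ev1] with x h1 h2 h3 h4 hx τ hτ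
    have hpx := hprΦ x (h1 hx)
    have hprd : HasFDerivAt pr (ContinuousLinearMap.id ℝ _ - ψ.smulRight w) x :=
      (hasFDerivAt_id x).sub (ψ.hasFDerivAt.smul_const w)
    have d1 : HasFDerivAt π ((fderiv ℝ g (Φ x)).comp
        (ContinuousLinearMap.id ℝ _ - ψ.smulRight w)) x :=
      HasFDerivAt.comp x (by rw [hpx]; exact h3.hasFDerivAt) hprd
    have d2 := (h3.hasFDerivAt).comp x (hΦd x (h4.differentiableAt (by norm_num)))
    have d3 : HasFDerivAt (g ∘ Φ) (ContinuousLinearMap.id ℝ _) x :=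
      (hasFDerivAt_id x).congr_of_eventuallyEq h2
    have d4 := congrArg (fun L => L τ) (d2.unique d3)
    rw [d1.fderiv]
    simp only [ContinuousLinearMap.comp_apply, add_apply,
      sub_apply, ContinuousLinearMap.id_apply,
      ContinuousLinearMap.smulRight_apply, hτ, zero_sub, neg_smul] at d4 ⊢
    rw [sub_eq_add_neg]; exact d4
  have evall := (ev1.and (b1.and (b2.and (b3.and (b4.and (b5.and b6)))))).and
    (hρ.mem_iff.and (hzero.and ((hπc.eventually (by norm_num)).and
      (hπfr.and (hπid.and hπtan)))))
  set P := (‖fderiv ℝ ρ z‖ + 1) + (‖fderiv ℝ (fderiv ℝ ρ) z‖ + 1)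
    + (‖fderiv ℝ (fderiv ℝ (fderiv ℝ ρ)) z‖ + 1) + (‖fderiv ℝ π z‖ + 1)
    + (‖fderiv ℝ (fderiv ℝ π) z‖ + 1) + 2 / ‖ψ‖ with hP
  have n1 := norm_nonneg (fderiv ℝ ρ z)
  have n2 := norm_nonneg (fderiv ℝ (fderiv ℝ ρ) z)
  have n3 := norm_nonneg (fderiv ℝ (fderiv ℝ (fderiv ℝ ρ)) z)
  have n4 := norm_nonneg (fderiv ℝ π z)
  have n5 := norm_nonneg (fderiv ℝ (fderiv ℝ π) z)
  have n6 : 0 < 2 / ‖ψ‖ := by positivity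
  refine ⟨_, evall, P, ρ, π, ?_⟩
  constructor
  · exact fun x hx => hx.1.1
  · exact fun x hx => hx.1.2.1.le.trans (by rw [hP]; linarith)
  · exact fun x hx => hx.1.2.2.1.le.trans (by rw [hP]; linarith)
  · exact fun x hx => hx.1.2.2.2.1.le.trans (by rw [hP]; linarith)
  · intro x hx
    have h := hx.1.2.2.2.2.2.2
    have h1 : 2 / ‖ψ‖ ≤ P := by rw [hP]; linarith
    calc (1 : ℝ) = 2 / ‖ψ‖ * (‖ψ‖ / 2) := by field_simp
      _ ≤ P * ‖fderiv ℝ ρ x‖ := by gcongr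
  · exact fun x hx => hx.2.1
  · exact fun x hx => hx.2.2.1
  · exact fun x hx => hx.2.2.2.1
  · exact fun x hx => hx.1.2.2.2.2.1.le.trans (by rw [hP]; linarith)
  · exact fun x hx => hx.1.2.2.2.2.2.1.le.trans (by rw [hP]; linarith)
  · exact fun x hx => hx.2.2.2.2.1
  · exact fun x hx => hx.2.2.2.2.2.1
  · exact fun x hx => hx.2.2.2.2.2.2

/-- Compactness of ∂Ω: patch data survive shrinking the ball and enlarging P. Thus r and P depend on
Ω alone. -/
theorem exists_uniform_patch (hΩ : IsBoundedCmDomain 4 Ω) :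
    ∃ r P : ℝ, 0 < r ∧ r ≤ 1 ∧ 1 ≤ P ∧
      ∀ x ∈ frontier Ω, ∃ ρ π, Patch Ω (Metric.ball x r) P ρ π := by
  have hcomp : IsCompact (frontier Ω) :=
    Metric.isCompact_of_isClosed_isBounded isClosed_frontier
      (hΩ.isBounded.closure.subset frontier_subset_closure)
  refine hcomp.induction_on (p := fun s => ∃ r P : ℝ, 0 < r ∧ r ≤ 1 ∧ 1 ≤ P ∧ ∀ x ∈ s, ∃ ρ π,
    Patch Ω (Metric.ball x r) P ρ π) ⟨1, 1, one_pos, le_rfl, le_rfl, by simp⟩ ?_ ?_ ?_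
  · rintro s t hst ⟨r, P, h1, h2, h3, h4⟩
    exact ⟨r, P, h1, h2, h3, fun x hx => h4 x (hst hx)⟩
  · rintro s t ⟨r, P, h1, h2, h3, h4⟩ ⟨r', P', h1', h2', h3', h4'⟩
    refine ⟨min r r', max P P', lt_min h1 h1', (min_le_left _ _).trans h2,
      h3.trans (le_max_left _ _), ?_⟩
    rintro x (hx | hx)
    · obtain ⟨ρ, π, h⟩ := h4 x hx
      exact ⟨ρ, π, h.mono (Metric.ball_subset_ball (min_le_left _ _)) (le_max_left _ _)⟩
    · obtain ⟨ρ, π, h⟩ := h4' x hx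
      exact ⟨ρ, π, h.mono (Metric.ball_subset_ball (min_le_right _ _)) (le_max_right _ _)⟩
  · intro z hz
    obtain ⟨V, hV, P, ρ, π, h⟩ := exists_patch_nhds hΩ hz
    obtain ⟨r, hr, hrV⟩ := Metric.mem_nhds_iff.1 hV
    refine ⟨Metric.ball z (r / 2),
      mem_nhdsWithin_of_mem_nhds (Metric.ball_mem_nhds z (by linarith)),
      min (r / 2) 1, max P 1, lt_min (by linarith) one_pos, min_le_right _ _, le_max_right _ _, ?_⟩
    intro x hx
    refine ⟨ρ, π, h.mono ((Metric.ball_subset_ball' ?_).trans hrV) (le_max_left _ _)⟩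
    have := Metric.mem_ball.1 hx
    have := min_le_left (r / 2) 1
    linarith

end Domain

/-! ### A second derivative test in one variable. -/

section OneVariable

/-- If c < 0, then f' < 0 just to the right of 0 and f would drop below its minimum. Only
differentiability of f' at 0 is needed, which suits the fourth derivatives of a merely C⁴ function.
-/
theorem nonneg_of_isLocalMin {f f' : ℝ → ℝ} {c : ℝ} (h1 : ∀ᶠ t in 𝓝 0, HasDerivAt f (f' t) t)
    (h2 : HasDerivAt f' c 0) (hmin : IsLocalMin f 0) : f' 0 = 0 ∧ 0 ≤ c := by
  have h0 : f' 0 = 0 := hmin.hasDerivAt_eq_zero h1.self_of_nhds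
  refine ⟨h0, ?_⟩
  by_contra hc
  push Not at hc
  have hs := h2.tendsto_slope_zero_right
  have e1 : ∀ᶠ t in 𝓝[>] (0 : ℝ), f' t < 0 := by
    filter_upwards [hs.eventually (gt_mem_nhds hc), self_mem_nhdsWithin] with t ht ht0
    simp only [zero_add, h0, sub_zero, smul_eq_mul] at ht
    have ht0' : (0 : ℝ) < t := ht0
    by_contra hn
    push Not at hn
    have := mul_nonneg (inv_pos.2 ht0').le hn
    linarith
  obtain ⟨ε, hε, hball⟩ := Metric.eventually_nhds_iff.1 (h1.and hmin)
  obtain ⟨δ, hδ, hδ2⟩ := (mem_nhdsGT_iff_exists_Ioo_subset).1 e1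
  set t := min (ε / 2) (δ / 2) with ht
  have ht0 : 0 < t := lt_min (by linarith) (by have : (0 : ℝ) < δ := hδ; linarith)
  have htε : t < ε := (min_le_left _ _).trans_lt (by linarith)
  have htδ : t < δ := (min_le_right _ _).trans_lt (by have : (0 : ℝ) < δ := hδ; linarith)
  have hd : ∀ s ∈ Icc 0 t, HasDerivAt f (f' s) s := fun s hs =>
    (hball (by rw [Real.dist_eq, sub_zero, abs_of_nonneg hs.1]; exact hs.2.trans_lt htε)).1
  obtain ⟨s, hs, hs2⟩ := exists_hasDerivAt_eq_slope f f' ht0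
    (fun s hs => (hd s hs).continuousAt.continuousWithinAt)
    (fun s hs => hd s (Ioo_subset_Icc_self hs))
  have h3 : f' s < 0 := hδ2 ⟨hs.1, hs.2.trans htδ⟩
  have h4 : f 0 ≤ f t :=
    (hball (by rw [Real.dist_eq, sub_zero, abs_of_nonneg ht0.le]; exact htε)).2
  rw [hs2, sub_zero] at h3
  have := div_nonneg (sub_nonneg.2 h4) ht0.le
  linarith

end OneVariable

theorem eq_of_eq_on_closure {X : Type*} [TopologicalSpace X] {Ω : Set X} {x : X}
    {f g : X → ℝ} (hf : ContinuousOn f (closure Ω))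
    (hg : ContinuousOn g (closure Ω)) (hfg : ∀ y ∈ Ω, f y = g y) (hx : x ∈ closure Ω) :
    f x = g x :=
  EqOn.of_subset_closure (s := Ω) (t := closure Ω) (fun y hy => hfg y hy) hf hg subset_closure
    Subset.rfl hx

/-! ### Iterated derivatives up to the boundary, their symmetries, and the differentiated equation.
-/

section Derivatives

variable {E : Type*} [NormedAddCommGroup E] [NormedSpace ℝ E]

/-- First derivative of `u` within `S`. -/
def d1 (S : Set E) (u : E → ℝ) : E → E →L[ℝ] ℝ := fderivWithin ℝ u S
/-- Second derivative of `u` within `S`. -/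
def d2 (S : Set E) (u : E → ℝ) : E → E →L[ℝ] E →L[ℝ] ℝ := fderivWithin ℝ (d1 S u) S
/-- Third derivative of `u` within `S`. -/
def d3 (S : Set E) (u : E → ℝ) : E → E →L[ℝ] E →L[ℝ] E →L[ℝ] ℝ := fderivWithin ℝ (d2 S u) S
/-- Fourth derivative of `u` within `S`. -/
def d4 (S : Set E) (u : E → ℝ) : E → E →L[ℝ] E →L[ℝ] E →L[ℝ] E →L[ℝ] ℝ :=
  fderivWithin ℝ (d3 S u) S

/-- `u` is `C⁴` on the closure of the open set `Ω`, where derivatives are unique. -/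
structure IsRegular (Ω : Set E) (u : E → ℝ) : Prop where
  isOpen : IsOpen Ω
  uniqueDiffOn : UniqueDiffOn ℝ (closure Ω)
  contDiffOn : ContDiffOn ℝ 4 u (closure Ω)

namespace IsRegular

variable {Ω : Set E} {u : E → ℝ} {x : E}

theorem c1 (h : IsRegular Ω u) : ContDiffOn ℝ 3 (d1 (closure Ω) u) (closure Ω) :=
  h.contDiffOn.fderivWithin h.uniqueDiffOn (by norm_num)
theorem c2 (h : IsRegular Ω u) : ContDiffOn ℝ 2 (d2 (closure Ω) u) (closure Ω) :=
  h.c1.fderivWithin h.uniqueDiffOn (by norm_num)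
theorem c3 (h : IsRegular Ω u) : ContDiffOn ℝ 1 (d3 (closure Ω) u) (closure Ω) :=
  h.c2.fderivWithin h.uniqueDiffOn (by norm_num)

theorem hasFDerivWithinAt_u (h : IsRegular Ω u) (hx : x ∈ closure Ω) :
    HasFDerivWithinAt u (d1 (closure Ω) u x) (closure Ω) x :=
  ((h.contDiffOn.differentiableOn (by norm_num)) x hx).hasFDerivWithinAt
theorem hasFDerivWithinAt_d1 (h : IsRegular Ω u) (hx : x ∈ closure Ω) :
    HasFDerivWithinAt (d1 (closure Ω) u) (d2 (closure Ω) u x) (closure Ω) x :=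
  ((h.c1.differentiableOn (by norm_num)) x hx).hasFDerivWithinAt
theorem hasFDerivWithinAt_d2 (h : IsRegular Ω u) (hx : x ∈ closure Ω) :
    HasFDerivWithinAt (d2 (closure Ω) u) (d3 (closure Ω) u x) (closure Ω) x :=
  ((h.c2.differentiableOn (by norm_num)) x hx).hasFDerivWithinAt
theorem hasFDerivWithinAt_d3 (h : IsRegular Ω u) (hx : x ∈ closure Ω) :
    HasFDerivWithinAt (d3 (closure Ω) u) (d4 (closure Ω) u x) (closure Ω) x :=
  ((h.c3.differentiableOn (by norm_num)) x hx).hasFDerivWithinAt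

theorem mem_nhds (h : IsRegular Ω u) (hx : x ∈ Ω) : closure Ω ∈ 𝓝 x :=
  mem_of_superset (h.isOpen.mem_nhds hx) subset_closure

theorem hasFDerivAt_u (h : IsRegular Ω u) (hx : x ∈ Ω) : HasFDerivAt u (d1 (closure Ω) u x) x :=
  (h.hasFDerivWithinAt_u (subset_closure hx)).hasFDerivAt (h.mem_nhds hx)
theorem hasFDerivAt_d1 (h : IsRegular Ω u)
    (hx : x ∈ Ω) : HasFDerivAt (d1 (closure Ω) u) (d2 (closure Ω) u x) x :=
  (h.hasFDerivWithinAt_d1 (subset_closure hx)).hasFDerivAt (h.mem_nhds hx)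
theorem hasFDerivAt_d2 (h : IsRegular Ω u)
    (hx : x ∈ Ω) : HasFDerivAt (d2 (closure Ω) u) (d3 (closure Ω) u x) x :=
  (h.hasFDerivWithinAt_d2 (subset_closure hx)).hasFDerivAt (h.mem_nhds hx)
theorem hasFDerivAt_d3 (h : IsRegular Ω u)
    (hx : x ∈ Ω) : HasFDerivAt (d3 (closure Ω) u) (d4 (closure Ω) u x) x :=
  (h.hasFDerivWithinAt_d3 (subset_closure hx)).hasFDerivAt (h.mem_nhds hx)

theorem d2_symm_interior (h : IsRegular Ω u) (hx : x ∈ Ω) (a b : E) :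
    d2 (closure Ω) u x a b = d2 (closure Ω) u x b a :=
  second_derivative_symmetric_of_eventually
    (by filter_upwards [h.isOpen.mem_nhds hx] with y hy using h.hasFDerivAt_u hy)
    (h.hasFDerivAt_d1 hx) a b

theorem d3_symm_left_interior (h : IsRegular Ω u) (hx : x ∈ Ω) (a b : E) :
    d3 (closure Ω) u x a b = d3 (closure Ω) u x b a :=
  second_derivative_symmetric_of_eventually
    (by filter_upwards [h.isOpen.mem_nhds hx] with y hy using h.hasFDerivAt_d1 hy)
    (h.hasFDerivAt_d2 hx) a b

theorem d4_symm_left_interior (h : IsRegular Ω u) (hx : x ∈ Ω) (a b : E) :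
    d4 (closure Ω) u x a b = d4 (closure Ω) u x b a :=
  second_derivative_symmetric_of_eventually
    (by filter_upwards [h.isOpen.mem_nhds hx] with y hy using h.hasFDerivAt_d2 hy)
    (h.hasFDerivAt_d3 hx) a b

theorem d3_symm_right_interior (h : IsRegular Ω u) (hx : x ∈ Ω) (a b c : E) :
    d3 (closure Ω) u x a b c = d3 (closure Ω) u x a c b := by
  have h1 : HasFDerivAt (fun y => d2 (closure Ω) u y b c - d2 (closure Ω) u y c b)
      (((d3 (closure Ω) u x).flip b).flip c - ((d3 (closure Ω) u x).flip c).flip b) x :=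
    (((h.hasFDerivAt_d2 hx).clm_apply (hasFDerivAt_const b x)).clm_apply
      (hasFDerivAt_const c x)).sub (((h.hasFDerivAt_d2 hx).clm_apply
      (hasFDerivAt_const c x)).clm_apply (hasFDerivAt_const b x)) |>.congr_fderiv (by ext; simp)
  have h2 : HasFDerivAt (fun y => d2 (closure Ω) u y b c - d2 (closure Ω) u y c b)
      (0 : E →L[ℝ] ℝ) x := by
    refine (hasFDerivAt_const (0 : ℝ) x).congr_of_eventuallyEq ?_
    filter_upwards [h.isOpen.mem_nhds hx] with y hy
    rw [h.d2_symm_interior hy, sub_self]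
  have := congrArg (fun L => L a) (h1.unique h2)
  simp only [sub_apply, ContinuousLinearMap.flip_apply, zero_apply] at this
  linarith

theorem d4_symm_middle_interior (h : IsRegular Ω u) (hx : x ∈ Ω) (a b c : E) :
    d4 (closure Ω) u x a b c = d4 (closure Ω) u x a c b := by
  have h1 : HasFDerivAt (fun y => d3 (closure Ω) u y b c - d3 (closure Ω) u y c b)
      (((d4 (closure Ω) u x).flip b).flip c - ((d4 (closure Ω) u x).flip c).flip b) x :=
    (((h.hasFDerivAt_d3 hx).clm_apply (hasFDerivAt_const b x)).clm_apply
      (hasFDerivAt_const c x)).sub (((h.hasFDerivAt_d3 hx).clm_apply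
      (hasFDerivAt_const c x)).clm_apply (hasFDerivAt_const b x)) |>.congr_fderiv (by ext; simp)
  have h2 : HasFDerivAt (fun y => d3 (closure Ω) u y b c - d3 (closure Ω) u y c b)
      (0 : E →L[ℝ] E →L[ℝ] ℝ) x := by
    refine (hasFDerivAt_const (0 : E →L[ℝ] ℝ) x).congr_of_eventuallyEq ?_
    filter_upwards [h.isOpen.mem_nhds hx] with y hy
    rw [h.d3_symm_left_interior hy, sub_self]
  have := congrArg (fun L => L a) (h1.unique h2)
  simp only [sub_apply, ContinuousLinearMap.flip_apply, zero_apply] at this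
  exact sub_eq_zero.1 this

theorem d4_symm_right_interior (h : IsRegular Ω u) (hx : x ∈ Ω) (a b c d : E) :
    d4 (closure Ω) u x a b c d = d4 (closure Ω) u x a b d c := by
  have h1 : HasFDerivAt (fun y => d3 (closure Ω) u y b c d - d3 (closure Ω) u y b d c)
      ((((d4 (closure Ω) u x).flip b).flip c).flip d
        - (((d4 (closure Ω) u x).flip b).flip d).flip c) x :=
    ((((h.hasFDerivAt_d3 hx).clm_apply (hasFDerivAt_const b x)).clm_apply
      (hasFDerivAt_const c x)).clm_apply (hasFDerivAt_const d x)).sub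
      ((((h.hasFDerivAt_d3 hx).clm_apply
      (hasFDerivAt_const b x)).clm_apply (hasFDerivAt_const d x)).clm_apply
      (hasFDerivAt_const c x)) |>.congr_fderiv (by ext; simp)
  have h2 : HasFDerivAt (fun y => d3 (closure Ω) u y b c d - d3 (closure Ω) u y b d c)
      (0 : E →L[ℝ] ℝ) x := by
    refine (hasFDerivAt_const (0 : ℝ) x).congr_of_eventuallyEq ?_
    filter_upwards [h.isOpen.mem_nhds hx] with y hy
    rw [h.d3_symm_right_interior hy, sub_self]
  have := congrArg (fun L => L a) (h1.unique h2)
  simp only [sub_apply, ContinuousLinearMap.flip_apply, zero_apply] at this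
  linarith

/-- The maximum principle differentiates u_ee along the directions of the operator, the equation
differentiates the operator along e; this identifies the two. -/
theorem d4_swap (h : IsRegular Ω u) (hx : x ∈ Ω) (a b : E) :
    d4 (closure Ω) u x a a b b = d4 (closure Ω) u x b b a a := by
  rw [h.d4_symm_middle_interior hx, h.d4_symm_left_interior hx, h.d4_symm_right_interior hx,
    h.d4_symm_middle_interior hx b a b]

theorem d2_symm (h : IsRegular Ω u) (hx : x ∈ closure Ω) (a b : E) :
    d2 (closure Ω) u x a b = d2 (closure Ω) u x b a := by
  have hc := h.c2.continuousOn
  exact eq_of_eq_on_closure ((hc.clm_apply continuousOn_const).clm_apply continuousOn_const)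
    ((hc.clm_apply continuousOn_const).clm_apply continuousOn_const)
    (fun y hy => h.d2_symm_interior hy a b) hx

theorem d3_cycle (h : IsRegular Ω u) (hx : x ∈ closure Ω) (a b : E) :
    d3 (closure Ω) u x a b b = d3 (closure Ω) u x b b a := by
  have hc := h.c3.continuousOn
  exact eq_of_eq_on_closure
    (((hc.clm_apply continuousOn_const).clm_apply continuousOn_const).clm_apply continuousOn_const)
    (((hc.clm_apply continuousOn_const).clm_apply continuousOn_const).clm_apply continuousOn_const)
    (fun y hy => by rw [h.d3_symm_left_interior hy, h.d3_symm_right_interior hy]) hx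

end IsRegular

theorem hasDerivAt_ray (x v : E) (t : ℝ) : HasDerivAt (fun t : ℝ => x + t • v) v t := by
  simpa using ((hasDerivAt_id t).smul_const v).const_add x

theorem HasFDerivAt.hasDerivAt_comp_ray {F : Type*} [NormedAddCommGroup F] [NormedSpace ℝ F]
    {f : E → F} {L : E →L[ℝ] F} {x v : E} {t : ℝ}
    (hf : HasFDerivAt f L (x + t • v)) : HasDerivAt (fun t : ℝ => f (x + t • v)) (L v) t :=
  hf.comp_hasDerivAt t (hasDerivAt_ray x v t)

theorem eventually_ray_mem {Ω : Set E} (hΩ : IsOpen Ω) {x : E} (hx : x ∈ Ω) (v : E) :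
    ∀ᶠ t : ℝ in 𝓝 0, x + t • v ∈ Ω := by
  have hc : Continuous fun t : ℝ => x + t • v := by fun_prop
  exact hc.continuousAt.eventually (hΩ.mem_nhds (by simpa using hx))

namespace IsRegular

variable {Ω : Set E} {u : E → ℝ} {x : E}

theorem hasFDerivWithinAt_d1_apply (h : IsRegular Ω u) (hx : x ∈ closure Ω) (a : E) :
    HasFDerivWithinAt (fun y => d1 (closure Ω) u y a) ((d2 (closure Ω) u x).flip a)
      (closure Ω) x :=
  ((h.hasFDerivWithinAt_d1 hx).clm_apply (hasFDerivWithinAt_const a x _)).congr_fderiv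
    (by ext; simp)

theorem hasFDerivWithinAt_d2_apply (h : IsRegular Ω u) (hx : x ∈ closure Ω) (a b : E) :
    HasFDerivWithinAt (fun y => d2 (closure Ω) u y a b)
      (((d3 (closure Ω) u x).flip a).flip b) (closure Ω) x :=
  (((h.hasFDerivWithinAt_d2 hx).clm_apply (hasFDerivWithinAt_const a x _)).clm_apply
    (hasFDerivWithinAt_const b x _)).congr_fderiv (by ext; simp)

theorem hasFDerivAt_d3_apply (h : IsRegular Ω u) (hx : x ∈ Ω) (a b c : E) :
    HasFDerivAt (fun y => d3 (closure Ω) u y a b c)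
      ((((d4 (closure Ω) u x).flip a).flip b).flip c) x :=
  ((((h.hasFDerivAt_d3 hx).clm_apply (hasFDerivAt_const a x)).clm_apply
    (hasFDerivAt_const b x)).clm_apply (hasFDerivAt_const c x)).congr_fderiv (by ext; simp)

theorem hasDerivAt_d1_ray (h : IsRegular Ω u) {v a : E} {t : ℝ} (hx : x + t • v ∈ Ω) :
    HasDerivAt (fun t : ℝ => d1 (closure Ω) u (x + t • v) a)
      (d2 (closure Ω) u (x + t • v) v a) t :=
  HasFDerivAt.hasDerivAt_comp_ray (((h.hasFDerivWithinAt_d1_apply (subset_closure hx) a).hasFDerivAt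
    (h.mem_nhds hx)))

theorem hasDerivAt_d2_ray (h : IsRegular Ω u) {v a b : E} {t : ℝ} (hx : x + t • v ∈ Ω) :
    HasDerivAt (fun t : ℝ => d2 (closure Ω) u (x + t • v) a b)
      (d3 (closure Ω) u (x + t • v) v a b) t :=
  HasFDerivAt.hasDerivAt_comp_ray
    ((h.hasFDerivWithinAt_d2_apply (subset_closure hx) a b).hasFDerivAt (h.mem_nhds hx))

theorem hasDerivAt_d3_ray (h : IsRegular Ω u) {v a b c : E} {t : ℝ} (hx : x + t • v ∈ Ω) :
    HasDerivAt (fun t : ℝ => d3 (closure Ω) u (x + t • v) a b c)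
      (d4 (closure Ω) u (x + t • v) v a b c) t :=
  HasFDerivAt.hasDerivAt_comp_ray ((h.hasFDerivAt_d3_apply hx a b c))

/-- Differentiating twice an inequality `θ g ≤ ∑ αᵢ D²u(vᵢ,vᵢ)` which is an equality at `x`. -/
theorem differentiate_equation (h : IsRegular Ω u)
    {ι : Type*} [Fintype ι] (hx : x ∈ Ω) (v : ι → E) (α : ι → ℝ)
    {θ C : ℝ} (hθ : 0 ≤ θ) {g : E → ℝ} {L : E →L[ℝ] ℝ}
    (hg : ∀ᶠ y in 𝓝 x, |g y - g x - L (y - x)| ≤ C * ‖y - x‖ ^ 2)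
    (hle : ∀ y ∈ Ω, θ * g y ≤ ∑ i, α i * d2 (closure Ω) u y (v i) (v i))
    (heq : θ * g x = ∑ i, α i * d2 (closure Ω) u x (v i) (v i)) (e : E) :
    ∑ i, α i * d3 (closure Ω) u x e (v i) (v i) = θ * L e ∧
      -(2 * θ * C * ‖e‖ ^ 2) ≤ ∑ i, α i * d4 (closure Ω) u x e e (v i) (v i) := by
  -- Since g is only C^{1,1}, it is replaced along the line by the parabola touching it from below.
  -- The difference χ then is twice differentiable at 0, vanishes there, and has a local minimum
  -- there.
  let χ : ℝ → ℝ := fun t => ∑ i, α i * d2 (closure Ω) u (x + t • e) (v i) (v i)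
    - θ * (g x + t * L e - C * (t * t) * ‖e‖ ^ 2)
  let χ' : ℝ → ℝ := fun t => ∑ i, α i * d3 (closure Ω) u (x + t • e) e (v i) (v i)
    - θ * (L e - C * (t + t) * ‖e‖ ^ 2)
  have hray := eventually_ray_mem h.isOpen hx e
  have h1 : ∀ᶠ t in 𝓝 (0 : ℝ), HasDerivAt χ (χ' t) t := by
    filter_upwards [hray] with t ht
    refine (HasDerivAt.fun_sum fun i _ => (h.hasDerivAt_d2_ray ht).const_mul (α i)).sub ?_
    have e1 : HasDerivAt (fun t : ℝ => t * L e) (L e) t := by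
      simpa using (hasDerivAt_id t).mul_const (L e)
    have e2 : HasDerivAt (fun t : ℝ => C * (t * t) * ‖e‖ ^ 2) (C * (t + t) * ‖e‖ ^ 2) t := by
      have := ((hasDerivAt_id t).mul (hasDerivAt_id t)).const_mul C |>.mul_const (‖e‖ ^ 2)
      simpa using this
    exact ((e1.const_add (g x)).sub e2).const_mul θ
  have hx0 : x + (0 : ℝ) • e ∈ Ω := by simpa using hx
  have h2 : HasDerivAt χ' (∑ i, α i * d4 (closure Ω) u (x + (0 : ℝ) • e) e e (v i) (v i)
      - θ * (0 - C * (1 + 1) * ‖e‖ ^ 2)) 0 := by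
    refine (HasDerivAt.fun_sum fun i _ => (h.hasDerivAt_d3_ray hx0).const_mul (α i)).sub ?_
    have e2 : HasDerivAt (fun t : ℝ => C * (t + t) * ‖e‖ ^ 2) (C * (1 + 1) * ‖e‖ ^ 2) 0 :=
      (((hasDerivAt_id (0 : ℝ)).add (hasDerivAt_id 0)).const_mul C).mul_const (‖e‖ ^ 2)
    exact ((hasDerivAt_const _ _).sub e2).const_mul θ
  have hmin : IsLocalMin χ 0 := by
    have hc : Continuous fun t : ℝ => x + t • e := by fun_prop
    have hgr : ∀ᶠ t in 𝓝 (0 : ℝ), |g (x + t • e) - g x - L (x + t • e - x)|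
        ≤ C * ‖x + t • e - x‖ ^ 2 := by
      have hc0 : Tendsto (fun t : ℝ => x + t • e) (𝓝 0) (𝓝 x) := by simpa using hc.tendsto 0
      exact hc0.eventually hg
    filter_upwards [hray, hgr] with t ht htg
    have hχ0 : χ 0 = 0 := by
      simp only [χ, zero_smul, add_zero, zero_mul, mul_zero, sub_zero, heq, sub_self]
    rw [hχ0]
    have := hle _ ht
    simp only [add_sub_cancel_left, map_smul, smul_eq_mul, norm_smul, Real.norm_eq_abs, mul_pow,
      sq_abs] at htg
    have h3 := (abs_le.1 htg).1
    have h4 : θ * (g x + t * L e - C * (t * t) * ‖e‖ ^ 2) ≤ θ * g (x + t • e) :=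
      mul_le_mul_of_nonneg_left (by nlinarith) hθ
    simp only [χ]
    linarith
  obtain ⟨r1, r2⟩ := nonneg_of_isLocalMin h1 h2 hmin
  simp only [χ', zero_smul, add_zero] at r1 r2
  constructor
  · linarith
  · linarith

end IsRegular
end Derivatives

/-! ### Test functions and the maximum principle. -/

section Comparison

variable {E : Type*} [NormedAddCommGroup E] [InnerProductSpace ℝ E]
  {ι : Type*} [Fintype ι]

theorem sum_sq_apply_orthonormalBasis (v : OrthonormalBasis ι ℝ E) (s : E →L[ℝ] ℝ) :
    ∑ i, (s (v i)) ^ 2 = ‖s‖ ^ 2 := by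
  have : FiniteDimensional ℝ E := v.toBasis.finiteDimensional_of_finite
  have : CompleteSpace E := FiniteDimensional.complete ℝ E
  have h := v.sum_sq_norm_inner_left ((InnerProductSpace.toDual ℝ E).symm s)
  rw [LinearIsometryEquiv.norm_map] at h
  rw [← h]
  refine Finset.sum_congr rfl fun i _ => ?_
  rw [InnerProductSpace.toDual_symm_apply, Real.norm_eq_abs, sq_abs]

/-- The right side is the squared Hilbert–Schmidt norm, which the operator produces from |Du|²; two
different bases are allowed because one diagonalizes the operator and the other is fixed. -/
theorem sq_apply_le_sum_sq (v b : OrthonormalBasis ι ℝ E) (T : E →L[ℝ] E →L[ℝ] ℝ) {e : E}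
    (he : ‖e‖ = 1) : (T e e) ^ 2 ≤ ∑ i, ∑ j, (T (v i) (b j)) ^ 2 := by
  have key : ∀ s : E →L[ℝ] ℝ, (s e) ^ 2 ≤ ‖s‖ ^ 2 := fun s => by
    have := s.le_opNorm e
    rw [he, mul_one, Real.norm_eq_abs] at this
    exact sq_le_sq' (by linarith [neg_abs_le (s e)]) ((le_abs_self _).trans this)
  rw [Finset.sum_comm]
  calc (T e e) ^ 2 ≤ ‖T e‖ ^ 2 := key _
    _ = ∑ j, (T e (b j)) ^ 2 := (sum_sq_apply_orthonormalBasis b _).symm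
    _ ≤ _ := Finset.sum_le_sum fun j _ => by
      have := key (T.flip (b j))
      rw [← sum_sq_apply_orthonormalBasis v] at this
      simpa using this

/-- The squared length of the gradient, in the coordinates of an orthonormal basis. -/
def sqGrad (b : ι → E) (S : Set E) (u : E → ℝ) (x : E) : ℝ := ∑ j, (d1 S u x (b j)) ^ 2

/-- The functions to which the maximum principle is applied. -/
def testFun (b : ι → E) (S : Set E) (u : E → ℝ) (ω ω' : ℝ) (e a x₀ : E) (κ s : E →L[ℝ] ℝ)
    (c q B : ℝ) (x : E) : ℝ :=
  ω * d2 S u x e e + ω' * sqGrad b S u x + d1 S u x a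
    + (c + κ (x - x₀) - q * ‖x - x₀‖ ^ 2 + B * (s (x - x₀)) ^ 2)

variable {Ω : Set E} {u : E → ℝ} {x : E}

theorem IsRegular.hasFDerivWithinAt_sqGrad (h : IsRegular Ω u) (b : ι → E)
    (hx : x ∈ closure Ω) :
    HasFDerivWithinAt (sqGrad b (closure Ω) u)
      (∑ j, (2 * d1 (closure Ω) u x (b j)) • (d2 (closure Ω) u x).flip (b j)) (closure Ω) x := by
  refine HasFDerivWithinAt.fun_sum fun j _ => ?_
  have := (h.hasFDerivWithinAt_d1_apply hx (b j)).pow 2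
  simpa using this

theorem IsRegular.continuousOn_sqGrad (h : IsRegular Ω u) (b : ι → E) :
    ContinuousOn (sqGrad b (closure Ω) u) (closure Ω) := fun _ hx =>
  (h.hasFDerivWithinAt_sqGrad b hx).continuousWithinAt

theorem IsRegular.continuousOn_testFun (h : IsRegular Ω u) (b : ι → E) (ω ω' : ℝ)
    (e a x₀ : E) (κ s : E →L[ℝ] ℝ) (c q B : ℝ) :
    ContinuousOn (testFun b (closure Ω) u ω ω' e a x₀ κ s c q B) (closure Ω) := by
  have h1 : ContinuousOn (fun x => d2 (closure Ω) u x e e) (closure Ω) :=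
    (h.c2.continuousOn.clm_apply continuousOn_const).clm_apply continuousOn_const
  have h2 : ContinuousOn (fun x => d1 (closure Ω) u x a) (closure Ω) :=
    h.c1.continuousOn.clm_apply continuousOn_const
  have h3 := h.continuousOn_sqGrad b
  have h4 : Continuous fun x => c + κ (x - x₀) - q * ‖x - x₀‖ ^ 2 + B * (s (x - x₀)) ^ 2 := by
    fun_prop
  exact (((h1.const_smul ω).add (h3.const_smul ω')).add h2).add h4.continuousOn

/-- One-sided derivative of the comparison function at its base point. -/
theorem IsRegular.testFun_ray_le (h : IsRegular Ω u) (b : ι → E) {ω ω' : ℝ}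
    {e a x₀ : E} {κ s : E →L[ℝ] ℝ} {c q B : ℝ} {w : E} (hx : x₀ ∈ closure Ω)
    (hw : ∀ᶠ t : ℝ in 𝓝[>] 0, x₀ + t • w ∈ closure Ω ∧
      testFun b (closure Ω) u ω ω' e a x₀ κ s c q B (x₀ + t • w) ≤
        testFun b (closure Ω) u ω ω' e a x₀ κ s c q B x₀) :
    ω * d3 (closure Ω) u x₀ w e e
      + ω' * (∑ j, 2 * d1 (closure Ω) u x₀ (b j) * d2 (closure Ω) u x₀ w (b j))
      + d2 (closure Ω) u x₀ w a + κ w ≤ 0 := by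
  set S := closure Ω
  have hp : HasFDerivAt
      (fun x => c + κ (x - x₀) - q * ‖x - x₀‖ ^ 2 + B * (s (x - x₀)) ^ 2) κ x₀ := by
    have k1 : HasFDerivAt (fun x : E => x - x₀) (ContinuousLinearMap.id ℝ E) x₀ :=
      (hasFDerivAt_id x₀).sub_const x₀
    have k2 : HasFDerivAt (fun x : E => κ (x - x₀)) κ x₀ := by
      exact (κ.hasFDerivAt.comp x₀ k1).congr_fderiv (by ext; simp)
    have k3 : HasFDerivAt (fun x : E => ‖x - x₀‖ ^ 2) (0 : E →L[ℝ] ℝ) x₀ := by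
      have := k1.norm_sq
      simpa using this
    have k4 : HasFDerivAt (fun x : E => s (x - x₀)) s x₀ := by
      exact (s.hasFDerivAt.comp x₀ k1).congr_fderiv (by ext; simp)
    have k5 : HasFDerivAt (fun x : E => (s (x - x₀)) ^ 2) (0 : E →L[ℝ] ℝ) x₀ := by
      simpa using k4.pow 2
    exact (((k2.const_add c).sub (k3.const_mul q)).add (k5.const_mul B)).congr_fderiv (by simp)
  have hd := ((((h.hasFDerivWithinAt_d2_apply hx e e).const_mul ω).add
    ((h.hasFDerivWithinAt_sqGrad b hx).const_mul ω')).add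
    (h.hasFDerivWithinAt_d1_apply hx a)).add hp.hasFDerivWithinAt
  set L := (ω • ((d3 S u x₀).flip e).flip e
    + ω' • ∑ j, (2 * d1 S u x₀ (b j)) • (d2 S u x₀).flip (b j)
    + (d2 S u x₀).flip a) + κ with hL
  have hLw : L w = ω * d3 S u x₀ w e e + ω' * (∑ j, 2 * d1 S u x₀ (b j) * d2 S u x₀ w (b j))
      + d2 S u x₀ w a + κ w := by
    simp [hL]
  rw [← hLw]
  have hray : HasDerivWithinAt (fun t : ℝ => x₀ + t • w) w (Ioi 0) 0 :=
    (hasDerivAt_ray x₀ w 0).hasDerivWithinAt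
  obtain ⟨ε, hε, hsub⟩ := mem_nhdsGT_iff_exists_Ioo_subset.1 hw
  have hε0 : (0 : ℝ) < ε := hε
  have hmaps : MapsTo (fun t : ℝ => x₀ + t • w) (Ioo 0 ε) S := fun t ht => (hsub ht).1
  have hd' : HasFDerivWithinAt (testFun b S u ω ω' e a x₀ κ s c q B) L S (x₀ + (0 : ℝ) • w) := by
    rw [zero_smul, add_zero]; exact hd
  have hder := hd'.comp_hasDerivWithinAt (0 : ℝ) (hray.mono Ioo_subset_Ioi_self) hmaps
  have hlim := hasDerivWithinAt_iff_tendsto_slope' (left_notMem_Ioo) |>.1 hder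
  have : (𝓝[Ioo 0 ε] (0 : ℝ)).NeBot := by
    rw [nhdsWithin_Ioo_eq_nhdsGT hε0]; infer_instance
  refine le_of_tendsto hlim ?_
  filter_upwards [self_mem_nhdsWithin] with t ht
  have h1 := (hsub ht).2
  rw [slope_def_field]
  refine div_nonpos_of_nonpos_of_nonneg ?_ (by linarith [ht.1])
  simp only [Function.comp_apply, zero_smul, add_zero]
  linarith

theorem IsRegular.testFun_second_deriv_le (h : IsRegular Ω u) (b : ι → E) {ω ω' : ℝ}
    {e a x₀ : E} {κ s : E →L[ℝ] ℝ} {c q B : ℝ} (hx : x ∈ Ω)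
    (hmax : IsLocalMax (testFun b (closure Ω) u ω ω' e a x₀ κ s c q B) x) (v : E) :
    ω * d4 (closure Ω) u x v v e e
      + ω' * (∑ j, 2 * ((d2 (closure Ω) u x v (b j)) ^ 2
          + d1 (closure Ω) u x (b j) * d3 (closure Ω) u x v v (b j)))
      + d3 (closure Ω) u x v v a - 2 * q * ‖v‖ ^ 2 + 2 * B * (s v) ^ 2 ≤ 0 := by
  set S := closure Ω
  let W := testFun b S u ω ω' e a x₀ κ s c q B
  let f : ℝ → ℝ := fun t => - W (x + t • v)
  let f' : ℝ → ℝ := fun t => -(ω * d3 S u (x + t • v) v e e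
      + ω' * (∑ j, 2 * d1 S u (x + t • v) (b j) * d2 S u (x + t • v) v (b j))
      + d2 S u (x + t • v) v a + (κ v - q * (2 * (inner ℝ (x + t • v - x₀) v : ℝ))
        + B * (2 * s (x + t • v - x₀) * s v)))
  have hsub : ∀ t : ℝ, HasDerivAt (fun t : ℝ => x + t • v - x₀) v t := fun t =>
    (hasDerivAt_ray x v t).sub_const x₀
  have hcl : ∀ (L : E →L[ℝ] ℝ) (t : ℝ), HasDerivAt (fun t : ℝ => L (x + t • v - x₀)) (L v) t :=
    fun L t => L.hasFDerivAt.comp_hasDerivAt t (hsub t)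
  have h1 : ∀ᶠ t in 𝓝 (0 : ℝ), HasDerivAt f (f' t) t := by
    filter_upwards [eventually_ray_mem h.isOpen hx v] with t ht
    refine HasDerivAt.neg (HasDerivAt.add (HasDerivAt.add (HasDerivAt.add ?_ ?_) ?_) ?_)
    · exact (h.hasDerivAt_d2_ray ht).const_mul ω
    · refine HasDerivAt.const_mul ω' (HasDerivAt.fun_sum fun j _ => ?_)
      exact ((h.hasDerivAt_d1_ray (a := b j) ht).pow 2).congr_deriv (by simp [S])
    · exact h.hasDerivAt_d1_ray ht
    · refine HasDerivAt.add (HasDerivAt.sub ?_ ?_) ?_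
      · exact (hcl κ t).const_add c
      · exact ((hsub t).norm_sq).const_mul q
      · exact (((hcl s t).pow 2).const_mul B).congr_deriv (by simp)
  have hx0 : x + (0 : ℝ) • v ∈ Ω := by simpa using hx
  have h2 : HasDerivAt f' (-(ω * d4 S u (x + (0 : ℝ) • v) v v e e
      + ω' * (∑ j, (2 * d2 S u (x + (0 : ℝ) • v) v (b j) * d2 S u (x + (0 : ℝ) • v) v (b j)
          + 2 * d1 S u (x + (0 : ℝ) • v) (b j) * d3 S u (x + (0 : ℝ) • v) v v (b j)))
      + d3 S u (x + (0 : ℝ) • v) v v a + (0 - q * (2 * (inner ℝ v v : ℝ))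
        + B * (2 * s v * s v)))) 0 := by
    refine HasDerivAt.neg (HasDerivAt.add (HasDerivAt.add (HasDerivAt.add ?_ ?_) ?_) ?_)
    · exact (h.hasDerivAt_d3_ray hx0).const_mul ω
    · refine HasDerivAt.const_mul ω' (HasDerivAt.fun_sum fun j _ => ?_)
      exact ((h.hasDerivAt_d1_ray (a := b j) hx0).const_mul 2).mul (h.hasDerivAt_d2_ray hx0)
    · exact h.hasDerivAt_d2_ray hx0
    · refine HasDerivAt.add (HasDerivAt.sub (hasDerivAt_const _ _) ?_) ?_
      · have := ((hsub 0).inner ℝ (hasDerivAt_const (0 : ℝ) v)).const_mul 2 |>.const_mul q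
        simpa using this
      · exact (((hcl s 0).const_mul 2).mul_const (s v)).const_mul B
  have hmin : IsLocalMin f 0 := by
    have hc : Tendsto (fun t : ℝ => x + t • v) (𝓝 0) (𝓝 x) := by
      have : Continuous fun t : ℝ => x + t • v := by fun_prop
      simpa using this.tendsto 0
    filter_upwards [hc.eventually hmax] with t ht
    simp only [f, zero_smul, add_zero]
    exact neg_le_neg ht
  have r := (nonneg_of_isLocalMin h1 h2 hmin).2
  simp only [zero_smul, add_zero, real_inner_self_eq_norm_sq] at r
  have e1 : ∑ j, (2 * d2 S u x v (b j) * d2 S u x v (b j) + 2 * d1 S u x (b j) * d3 S u x v v (b j))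
      = ∑ j, 2 * ((d2 S u x v (b j)) ^ 2 + d1 S u x (b j) * d3 S u x v v (b j)) :=
    Finset.sum_congr rfl fun j _ => by ring
  rw [e1] at r
  nlinarith

/-- The once and twice differentiated equation, with coefficients `α` of ellipticity `lam`. -/
def IsElliptic (ι : Type*) [Fintype ι] (Ω : Set E) (u : E → ℝ) (lam K H : ℝ) : Prop :=
  ∀ x ∈ Ω, ∃ (v : OrthonormalBasis ι ℝ E) (α : ι → ℝ) (L : E →L[ℝ] ℝ),
    (∀ i, lam ≤ α i ∧ α i ≤ K) ∧ ‖L‖ ≤ K ∧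
    (∀ e, ∑ i, α i * d3 (closure Ω) u x e (v i) (v i) = L e) ∧
    ∀ e, -(K * H * ‖e‖ ^ 2) ≤ ∑ i, α i * d4 (closure Ω) u x e e (v i) (v i)

/-- The second derivatives of the test function along the v_i are summed with weights α_i. The
fourth derivatives are bounded below by the twice differentiated equation and the third ones are
given by the once differentiated equation. What remains are the good term from |Du|² and the term
2BT from the barrier, where T = ∑ α_i s(v_i)². -/
theorem IsElliptic.testFun_le {lam K H : ℝ} (hE : IsElliptic ι Ω u lam K H) (hlam : 0 < lam)
    (h : IsRegular Ω u) (b : OrthonormalBasis ι ℝ E) {ω ω' : ℝ} (hω : 0 ≤ ω) (hω' : 0 ≤ ω')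
    {e a x₀ : E} {κ s : E →L[ℝ] ℝ} {c q B : ℝ} (hq : 0 ≤ q) (hx : x ∈ Ω)
    (hd1 : ‖d1 (closure Ω) u x‖ ≤ K)
    (hmax : IsLocalMax (testFun b (closure Ω) u ω ω' e a x₀ κ s c q B) x) {e' : E}
    (he' : ‖e'‖ = 1) :
    ∃ T, lam * ‖s‖ ^ 2 ≤ T ∧ T ≤ K * ‖s‖ ^ 2 ∧
      -(ω * (K * H * ‖e‖ ^ 2)) + 2 * ω' * lam * (d2 (closure Ω) u x e' e') ^ 2
        - 2 * ω' * (Fintype.card ι * K ^ 2) - K * ‖a‖ - 2 * q * (Fintype.card ι * K)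
        + 2 * B * T ≤ 0 := by
  obtain ⟨v, α, L, hα, hL, h3, h4⟩ := hE x hx
  set S := closure Ω
  have hK : 0 ≤ K := (norm_nonneg _).trans hd1
  refine ⟨∑ i, α i * (s (v i)) ^ 2, ?_, ?_, ?_⟩
  · rw [← sum_sq_apply_orthonormalBasis v, Finset.mul_sum]
    exact Finset.sum_le_sum fun i _ => mul_le_mul_of_nonneg_right (hα i).1 (sq_nonneg _)
  · rw [← sum_sq_apply_orthonormalBasis v, Finset.mul_sum]
    exact Finset.sum_le_sum fun i _ => mul_le_mul_of_nonneg_right (hα i).2 (sq_nonneg _)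
  have hsum : ∑ i, α i * (ω * d4 S u x (v i) (v i) e e
      + ω' * (∑ j, 2 * ((d2 S u x (v i) (b j)) ^ 2
          + d1 S u x (b j) * d3 S u x (v i) (v i) (b j)))
      + d3 S u x (v i) (v i) a - 2 * q * ‖v i‖ ^ 2 + 2 * B * (s (v i)) ^ 2) ≤ 0 :=
    Finset.sum_nonpos fun i _ => mul_nonpos_of_nonneg_of_nonpos (hlam.le.trans (hα i).1)
      (h.testFun_second_deriv_le b hx hmax (v i))
  have hL3 : ∀ c, ∑ i, α i * d3 S u x (v i) (v i) c = L c := fun c => by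
    rw [← h3 c]
    exact Finset.sum_congr rfl fun i _ => by rw [h.d3_cycle (subset_closure hx)]
  have hsplit : ∑ i, α i * (ω * d4 S u x (v i) (v i) e e
      + ω' * (∑ j, 2 * ((d2 S u x (v i) (b j)) ^ 2
          + d1 S u x (b j) * d3 S u x (v i) (v i) (b j)))
      + d3 S u x (v i) (v i) a - 2 * q * ‖v i‖ ^ 2 + 2 * B * (s (v i)) ^ 2)
      = ω * (∑ i, α i * d4 S u x e e (v i) (v i))
        + 2 * ω' * (∑ i, α i * ∑ j, (d2 S u x (v i) (b j)) ^ 2)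
        + 2 * ω' * (∑ j, d1 S u x (b j) * L (b j)) + L a - 2 * q * (∑ i, α i)
        + 2 * B * ∑ i, α i * (s (v i)) ^ 2 := by
    have e1 : ∑ j, d1 S u x (b j) * L (b j)
        = ∑ i, α i * ∑ j, d1 S u x (b j) * d3 S u x (v i) (v i) (b j) := by
      simp_rw [← hL3, Finset.mul_sum]
      rw [Finset.sum_comm]
      exact Finset.sum_congr rfl fun i _ => Finset.sum_congr rfl fun j _ => by ring
    rw [e1, ← hL3 a, Finset.mul_sum, Finset.mul_sum, Finset.mul_sum, Finset.mul_sum,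
      Finset.mul_sum, ← Finset.sum_add_distrib, ← Finset.sum_add_distrib,
      ← Finset.sum_add_distrib, ← Finset.sum_sub_distrib, ← Finset.sum_add_distrib]
    refine Finset.sum_congr rfl fun i _ => ?_
    rw [h.d4_swap hx (v i) e, v.orthonormal.1 i, ← Finset.mul_sum, Finset.sum_add_distrib]
    ring
  rw [hsplit] at hsum
  have t1 := mul_le_mul_of_nonneg_left (h4 e) hω
  have t2 : lam * (d2 S u x e' e') ^ 2 ≤ ∑ i, α i * ∑ j, (d2 S u x (v i) (b j)) ^ 2 := by
    refine (mul_le_mul_of_nonneg_left (sq_apply_le_sum_sq v b _ he') hlam.le).trans ?_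
    rw [Finset.mul_sum]
    exact Finset.sum_le_sum fun i _ => mul_le_mul_of_nonneg_right (hα i).1
      (Finset.sum_nonneg fun j _ => sq_nonneg _)
  have t3 : -(Fintype.card ι * K ^ 2) ≤ ∑ j, d1 S u x (b j) * L (b j) := by
    have : ∀ j, -(K ^ 2) ≤ d1 S u x (b j) * L (b j) := fun j => by
      have a1 := (d1 S u x).le_opNorm (b j)
      have a2 := L.le_opNorm (b j)
      rw [b.orthonormal.1 j, mul_one, Real.norm_eq_abs] at a1 a2
      have a3 : |d1 S u x (b j) * L (b j)| ≤ K * K := by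
        rw [abs_mul]
        exact mul_le_mul (a1.trans hd1) (a2.trans hL) (abs_nonneg _) hK
      rw [sq]; exact (abs_le.1 a3).1
    calc -(Fintype.card ι * K ^ 2) = ∑ _j : ι, -(K ^ 2) := by simp
      _ ≤ _ := Finset.sum_le_sum fun j _ => this j
  have t4 : -(K * ‖a‖) ≤ L a := by
    have := (L.le_opNorm a).trans (mul_le_mul_of_nonneg_right hL (norm_nonneg a))
    exact (abs_le.1 this).1
  have t5 : ∑ i, α i ≤ Fintype.card ι * K := by
    calc ∑ i, α i ≤ ∑ _i : ι, K := Finset.sum_le_sum fun i _ => (hα i).2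
      _ = _ := by simp
  have t2' := mul_le_mul_of_nonneg_left t2 hω'
  have t3' := mul_le_mul_of_nonneg_left t3 hω'
  have t5' := mul_le_mul_of_nonneg_left t5 hq
  linarith

/-- Maximum principle on the part of `Ω` in a ball about a boundary point. -/
theorem exists_isLocalMax_or_le [FiniteDimensional ℝ E] {W : E → ℝ} {x₀ : E} {r : ℝ}
    (hΩ : IsOpen Ω) (hW : ContinuousOn W (closure Ω))
    (hfr : ∀ x ∈ frontier Ω, ‖x - x₀‖ ≤ r → W x ≤ 0)
    (hsph : ∀ x ∈ Ω, ‖x - x₀‖ = r → W x ≤ 0) :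
    (∃ x ∈ Ω, ‖x - x₀‖ ≤ r ∧ IsLocalMax W x ∧ 0 < W x) ∨
      ∀ x ∈ closure Ω, ‖x - x₀‖ ≤ r → W x ≤ 0 := by
  by_cases hall : ∀ x ∈ closure Ω, ‖x - x₀‖ ≤ r → W x ≤ 0
  · exact Or.inr hall
  left
  push Not at hall
  obtain ⟨y, hy, hyr, hyW⟩ := hall
  have hcomp : IsCompact (closure Ω ∩ Metric.closedBall x₀ r) :=
    (isCompact_closedBall x₀ r).inter_left isClosed_closure
  have hmem : ∀ z, z ∈ closure Ω ∩ Metric.closedBall x₀ r ↔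
      z ∈ closure Ω ∧ ‖z - x₀‖ ≤ r := fun z => by
    rw [mem_inter_iff, Metric.mem_closedBall, dist_eq_norm]
  obtain ⟨x, hx, hmax⟩ := hcomp.exists_isMaxOn ⟨y, (hmem y).2 ⟨hy, hyr⟩⟩
    (hW.mono inter_subset_left)
  have hxW : 0 < W x := hyW.trans_le (hmax ((hmem y).2 ⟨hy, hyr⟩))
  obtain ⟨hxc, hxr⟩ := (hmem x).1 hx
  have hxΩ : x ∈ Ω := by
    by_contra hn
    have := hfr x (by rw [hΩ.frontier_eq]; exact ⟨hxc, hn⟩) hxr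
    linarith
  have hxr' : ‖x - x₀‖ < r := lt_of_le_of_ne hxr fun heq => by
    have := hsph x hxΩ heq; linarith
  refine ⟨x, hxΩ, hxr, ?_, hxW⟩
  have h1 : ∀ᶠ z in 𝓝 x, ‖z - x₀‖ < r := by
    have : Continuous fun z : E => ‖z - x₀‖ := by fun_prop
    exact this.continuousAt.eventually_lt continuousAt_const hxr'
  filter_upwards [hΩ.mem_nhds hxΩ, h1] with z hz1 hz2
  exact hmax ((hmem z).2 ⟨subset_closure hz1, hz2.le⟩)

end Comparison

/-! ### Taylor estimates on balls. -/

section Taylor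

variable {E F : Type*} [NormedAddCommGroup E] [NormedSpace ℝ E] [NormedAddCommGroup F]
  [NormedSpace ℝ F] {f : E → F} {x x₀ : E} {r C : ℝ}

theorem norm_sub_le_of_fderiv_le (hf : ∀ y ∈ Metric.ball x₀ r, DifferentiableAt ℝ f y)
    (hC : ∀ y ∈ Metric.ball x₀ r, ‖fderiv ℝ f y‖ ≤ C) (hx : x ∈ Metric.ball x₀ r) :
    ‖f x - f x₀‖ ≤ C * ‖x - x₀‖ := by
  have hr : 0 < r := Metric.nonempty_ball.1 ⟨x, hx⟩
  exact (convex_ball x₀ r).norm_image_sub_le_of_norm_fderiv_le hf hC (Metric.mem_ball_self hr) hx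

theorem norm_taylor_le (hf : ∀ y ∈ Metric.ball x₀ r, ContDiffAt ℝ 2 f y)
    (hC : ∀ y ∈ Metric.ball x₀ r, ‖fderiv ℝ (fderiv ℝ f) y‖ ≤ C) (hx : x ∈ Metric.ball x₀ r) :
    ‖f x - f x₀ - fderiv ℝ f x₀ (x - x₀)‖ ≤ C * ‖x - x₀‖ ^ 2 := by
  have hr : 0 < r := Metric.nonempty_ball.1 ⟨x, hx⟩
  have hC0 : 0 ≤ C := (norm_nonneg _).trans (hC x hx)
  have hsub : Metric.closedBall x₀ ‖x - x₀‖ ⊆ Metric.ball x₀ r :=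
    Metric.closedBall_subset_ball (mem_ball_iff_norm.1 hx)
  have h1 : ∀ y ∈ Metric.closedBall x₀ ‖x - x₀‖, ‖fderiv ℝ f y - fderiv ℝ f x₀‖ ≤ C * ‖x - x₀‖ :=
    fun y hy => (norm_sub_le_of_fderiv_le (fun z hz => ((hf z hz).fderiv_right
      (m := 1) (by norm_num)).differentiableAt (by norm_num)) hC (hsub hy)).trans
      (by gcongr; exact mem_closedBall_iff_norm.1 hy)
  have := (convex_closedBall x₀ ‖x - x₀‖).norm_image_sub_le_of_norm_fderiv_le'
    (fun y hy => (hf y (hsub hy)).differentiableAt (by norm_num)) h1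
    (Metric.mem_closedBall_self (norm_nonneg _)) (mem_closedBall_iff_norm.2 le_rfl)
  rw [sq, ← mul_assoc]
  exact this

theorem norm_fderiv_sub_le (hf : ∀ y ∈ Metric.ball x₀ r, ContDiffAt ℝ 2 f y)
    (hC : ∀ y ∈ Metric.ball x₀ r, ‖fderiv ℝ (fderiv ℝ f) y‖ ≤ C) (hx : x ∈ Metric.ball x₀ r) :
    ‖fderiv ℝ f x - fderiv ℝ f x₀‖ ≤ C * ‖x - x₀‖ :=
  norm_sub_le_of_fderiv_le (fun z hz => ((hf z hz).fderiv_right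
      (m := 1) (by norm_num)).differentiableAt (by norm_num)) hC hx

theorem HasFDerivWithinAt.comp_of_mapsTo {G : Type*} [NormedAddCommGroup G] [NormedSpace ℝ G]
    {g : F → G} {g' : F →L[ℝ] G} {f' : E →L[ℝ] F} {S : Set F} {V : Set E}
    (hg : HasFDerivWithinAt g g' S (f x)) (hf : HasFDerivAt f f' x) (hV : V ∈ 𝓝 x)
    (hmaps : MapsTo f V S) : HasFDerivAt (fun y => g (f y)) (g'.comp f') x :=
  (hg.comp x hf.hasFDerivWithinAt hmaps).hasFDerivAt hV

theorem abs_apply_le (L : E →L[ℝ] ℝ) {a b : ℝ} {v : E} (hL : ‖L‖ ≤ a) (hv : ‖v‖ ≤ b) :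
    |L v| ≤ a * b := by
  have := L.le_opNorm v
  rw [Real.norm_eq_abs] at this
  exact this.trans (mul_le_mul hL hv (norm_nonneg _) ((norm_nonneg _).trans hL))

theorem norm_apply_le (L : E →L[ℝ] F) {a b : ℝ} {v : E} (hL : ‖L‖ ≤ a) (hv : ‖v‖ ≤ b) :
    ‖L v‖ ≤ a * b :=
  (L.le_opNorm v).trans (mul_le_mul hL hv (norm_nonneg _) ((norm_nonneg _).trans hL))

theorem abs_apply₂_le (L : E →L[ℝ] E →L[ℝ] ℝ) {a b c : ℝ} {v w : E} (hL : ‖L‖ ≤ a)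
    (hv : ‖v‖ ≤ b) (hw : ‖w‖ ≤ c) : |L v w| ≤ a * b * c :=
  abs_apply_le (L v) (norm_apply_le L hL hv) hw

end Taylor

/-! ### The oblique boundary condition and its derivatives. -/

section Oblique

variable {E : Type*} [NormedAddCommGroup E] [InnerProductSpace ℝ E]

/-- The boundary condition `Du · A + β = 0` near `x₀ ∈ ∂Ω`, where `A` and `β` have been extended
along the retraction `π`. -/
structure ObliqueData (Ω : Set E) (u : E → ℝ) (x₀ : E) (r K H : ℝ) (ρ : E → ℝ) (π : E → E)
    (A : E → E) (β : E → ℝ) : Prop where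
  patch : Patch Ω (Metric.ball x₀ r) K ρ π
  A_contDiffAt : ∀ x ∈ Metric.ball x₀ r, ContDiffAt ℝ 2 A x
  β_contDiffAt : ∀ x ∈ Metric.ball x₀ r, ContDiffAt ℝ 2 β x
  A_bound₀ : ∀ x ∈ Metric.ball x₀ r, ‖A x‖ ≤ K
  A_bound₁ : ∀ x ∈ Metric.ball x₀ r, ‖fderiv ℝ A x‖ ≤ K
  A_bound₂ : ∀ x ∈ Metric.ball x₀ r, ‖fderiv ℝ (fderiv ℝ A) x‖ ≤ K * H
  β_bound₁ : ∀ x ∈ Metric.ball x₀ r, ‖fderiv ℝ β x‖ ≤ K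
  β_bound₂ : ∀ x ∈ Metric.ball x₀ r, ‖fderiv ℝ (fderiv ℝ β) x‖ ≤ K * H
  eq_zero : ∀ x ∈ Metric.ball x₀ r, d1 (closure Ω) u (π x) (A x) + β x = 0
  oblique : ∀ x ∈ Metric.ball x₀ r, x ∈ frontier Ω → 1 ≤ K * fderiv ℝ ρ x (A x)

/-- The oblique problem with all quantitative data; `m` bounds the second derivatives of `u`. -/
structure Problem {ι : Type*} [Fintype ι] (Ω : Set E) (u : E → ℝ) (b : OrthonormalBasis ι ℝ E)
    (r lam K m : ℝ) : Prop where
  regular : IsRegular Ω u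
  bounded : Bornology.IsBounded Ω
  m_nonneg : 0 ≤ m
  d1_le : ∀ x ∈ closure Ω, ‖d1 (closure Ω) u x‖ ≤ K
  d2_le : ∀ x ∈ closure Ω, ‖d2 (closure Ω) u x‖ ≤ m
  elliptic : IsElliptic ι Ω u lam K (1 + m)
  laplace_nonneg : ∀ x ∈ Ω, 0 ≤ ∑ i, d2 (closure Ω) u x (b i) (b i)
  boundary : ∀ x₀ ∈ frontier Ω, ∃ ρ π A β, ObliqueData Ω u x₀ r K (1 + m) ρ π A β

namespace Patch

variable {Ω : Set E} {x x₀ : E} {r K : ℝ} {ρ : E → ℝ} {π : E → E}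

theorem nonneg (h : Patch Ω (Metric.ball x₀ r) K ρ π) (hΩ : IsOpen Ω)
    (hx : x ∈ Metric.ball x₀ r) (hxS : x ∈ closure Ω) : 0 ≤ ρ x := by
  by_cases hxΩ : x ∈ Ω
  · exact ((h.mem_iff x hx).1 hxΩ).le
  · exact (h.zero x hx (by rw [hΩ.frontier_eq]; exact ⟨hxS, hxΩ⟩)).ge

theorem ρ_taylor (h : Patch Ω (Metric.ball x₀ r) K ρ π) (hx₀ : x₀ ∈ frontier Ω)
    (hx : x ∈ Metric.ball x₀ r) : |ρ x - fderiv ℝ ρ x₀ (x - x₀)| ≤ K * ‖x - x₀‖ ^ 2 := by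
  have h0 := h.zero x₀ (Metric.mem_ball_self (Metric.nonempty_ball.1 ⟨x, hx⟩)) hx₀
  have := norm_taylor_le (fun y hy => (h.ρ_contDiffAt y hy).of_le (by norm_num)) h.ρ_bound₂ hx
  rwa [h0, sub_zero, Real.norm_eq_abs] at this

theorem neg_le_linear (h : Patch Ω (Metric.ball x₀ r) K ρ π) (hΩ : IsOpen Ω)
    (hx₀ : x₀ ∈ frontier Ω) (hx : x ∈ Metric.ball x₀ r) (hxS : x ∈ closure Ω) :
    -(K * ‖x - x₀‖ ^ 2) ≤ fderiv ℝ ρ x₀ (x - x₀) := by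
  have h1 := (abs_le.1 (h.ρ_taylor hx₀ hx)).2
  have h2 := h.nonneg hΩ hx hxS
  linarith

theorem linear_le (h : Patch Ω (Metric.ball x₀ r) K ρ π)
    (hx₀ : x₀ ∈ frontier Ω) (hx : x ∈ Metric.ball x₀ r) (hxS : x ∈ frontier Ω) :
    fderiv ℝ ρ x₀ (x - x₀) ≤ K * ‖x - x₀‖ ^ 2 := by
  have h1 := (abs_le.1 (h.ρ_taylor hx₀ hx)).1
  have h2 := h.zero x hx hxS
  linarith

end Patch

namespace ObliqueData

variable {Ω : Set E} {u : E → ℝ} {x x₀ : E} {r K H : ℝ} {ρ : E → ℝ} {π : E → E}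
  {A : E → E} {β : E → ℝ}

theorem π_mem_closure (h : ObliqueData Ω u x₀ r K H ρ π A β)
    (hx : x ∈ Metric.ball x₀ r) : π x ∈ closure Ω :=
  frontier_subset_closure (h.patch.π_mem x hx)

theorem π_hasFDerivAt (h : ObliqueData Ω u x₀ r K H ρ π A β)
    (hx : x ∈ Metric.ball x₀ r) : HasFDerivAt π (fderiv ℝ π x) x :=
  ((h.patch.π_contDiffAt x hx).differentiableAt (by norm_num)).hasFDerivAt

theorem A_hasFDerivAt (h : ObliqueData Ω u x₀ r K H ρ π A β)
    (hx : x ∈ Metric.ball x₀ r) : HasFDerivAt A (fderiv ℝ A x) x :=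
  ((h.A_contDiffAt x hx).differentiableAt (by norm_num)).hasFDerivAt

theorem β_hasFDerivAt (h : ObliqueData Ω u x₀ r K H ρ π A β)
    (hx : x ∈ Metric.ball x₀ r) : HasFDerivAt β (fderiv ℝ β x) x :=
  ((h.β_contDiffAt x hx).differentiableAt (by norm_num)).hasFDerivAt

theorem d1_hasFDerivAt (h : ObliqueData Ω u x₀ r K H ρ π A β)
    (hu : IsRegular Ω u) (hx : x ∈ Metric.ball x₀ r) :
    HasFDerivAt (fun y => d1 (closure Ω) u (π y))
      ((d2 (closure Ω) u (π x)).comp (fderiv ℝ π x)) x :=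
  HasFDerivWithinAt.comp_of_mapsTo (hu.hasFDerivWithinAt_d1 (h.π_mem_closure hx))
    (h.π_hasFDerivAt hx) (Metric.isOpen_ball.mem_nhds hx) (fun _ hy => h.π_mem_closure hy)

theorem d2_hasFDerivAt (h : ObliqueData Ω u x₀ r K H ρ π A β)
    (hu : IsRegular Ω u) (hx : x ∈ Metric.ball x₀ r) :
    HasFDerivAt (fun y => d2 (closure Ω) u (π y))
      ((d3 (closure Ω) u (π x)).comp (fderiv ℝ π x)) x :=
  HasFDerivWithinAt.comp_of_mapsTo (hu.hasFDerivWithinAt_d2 (h.π_mem_closure hx))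
    (h.π_hasFDerivAt hx) (Metric.isOpen_ball.mem_nhds hx) (fun _ hy => h.π_mem_closure hy)

/-- The boundary condition, differentiated once. -/
theorem differentiate (h : ObliqueData Ω u x₀ r K H ρ π A β)
    (hu : IsRegular Ω u) (hx : x ∈ Metric.ball x₀ r) (e : E) :
    d2 (closure Ω) u (π x) (fderiv ℝ π x e) (A x) + d1 (closure Ω) u (π x) (fderiv ℝ A x e)
      + fderiv ℝ β x e = 0 := by
  have h1 := ((h.d1_hasFDerivAt hu hx).clm_apply (h.A_hasFDerivAt hx)).add (h.β_hasFDerivAt hx)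
  have h2 : HasFDerivAt ((fun y => d1 (closure Ω) u (π y) (A y)) + β) (0 : E →L[ℝ] ℝ) x := by
    refine (hasFDerivAt_const (0 : ℝ) x).congr_of_eventuallyEq ?_
    filter_upwards [Metric.isOpen_ball.mem_nhds hx] with y hy
    exact h.eq_zero y hy
  have := congrArg (fun L => L e) (h1.unique h2)
  simp only [add_apply, ContinuousLinearMap.comp_apply, ContinuousLinearMap.flip_apply,
    zero_apply] at this
  linarith

/-- The boundary condition, differentiated twice in a tangential direction. -/
theorem differentiate_twice (h : ObliqueData Ω u x₀ r K H ρ π A β)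
    (hu : IsRegular Ω u) (hx₀ : x₀ ∈ frontier Ω) (hr : 0 < r) {e : E}
    (he : fderiv ℝ ρ x₀ e = 0) :
    d3 (closure Ω) u x₀ e e (A x₀) + d2 (closure Ω) u x₀ (fderiv ℝ (fderiv ℝ π) x₀ e e) (A x₀)
      + 2 * d2 (closure Ω) u x₀ e (fderiv ℝ A x₀ e)
      + d1 (closure Ω) u x₀ (fderiv ℝ (fderiv ℝ A) x₀ e e)
      + fderiv ℝ (fderiv ℝ β) x₀ e e = 0 := by
  have hx := Metric.mem_ball_self (x := x₀) hr
  have hπ0 : π x₀ = x₀ := h.patch.π_eq x₀ hx hx₀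
  have hπe : fderiv ℝ π x₀ e = e := h.patch.π_tangent x₀ hx hx₀ e he
  have kπ : HasFDerivAt (fderiv ℝ π) (fderiv ℝ (fderiv ℝ π) x₀) x₀ :=
    (((h.patch.π_contDiffAt x₀ hx).fderiv_right (m := 1) (by norm_num)).differentiableAt
      (by norm_num)).hasFDerivAt
  have kA : HasFDerivAt (fderiv ℝ A) (fderiv ℝ (fderiv ℝ A) x₀) x₀ :=
    (((h.A_contDiffAt x₀ hx).fderiv_right (m := 1) (by norm_num)).differentiableAt
      (by norm_num)).hasFDerivAt
  have kβ : HasFDerivAt (fderiv ℝ β) (fderiv ℝ (fderiv ℝ β) x₀) x₀ :=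
    (((h.β_contDiffAt x₀ hx).fderiv_right (m := 1) (by norm_num)).differentiableAt
      (by norm_num)).hasFDerivAt
  have t1 := ((h.d2_hasFDerivAt hu hx).clm_apply (kπ.clm_apply (hasFDerivAt_const e x₀))).clm_apply
    (h.A_hasFDerivAt hx)
  have t2 := (h.d1_hasFDerivAt hu hx).clm_apply (kA.clm_apply (hasFDerivAt_const e x₀))
  have t3 := kβ.clm_apply (hasFDerivAt_const e x₀)
  have h1 := (t1.add t2).add t3
  have h2 : HasFDerivAt (fun y => d2 (closure Ω) u (π y) (fderiv ℝ π y e) (A y)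
      + d1 (closure Ω) u (π y) (fderiv ℝ A y e) + fderiv ℝ β y e) (0 : E →L[ℝ] ℝ) x₀ := by
    refine (hasFDerivAt_const (0 : ℝ) x₀).congr_of_eventuallyEq ?_
    filter_upwards [Metric.isOpen_ball.mem_nhds hx] with y hy
    exact h.differentiate hu hy e
  have := congrArg (fun L => L e) (h1.unique h2)
  simp only [add_apply, ContinuousLinearMap.comp_apply, ContinuousLinearMap.flip_apply,
    zero_apply, hπ0, hπe, zero_add, ContinuousLinearMap.comp_zero] at this
  linarith

/-- Mixed second derivatives are controlled by the gradient. -/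
theorem d2_tangent (h : ObliqueData Ω u x₀ r K H ρ π A β)
    (hu : IsRegular Ω u) (hx : x ∈ Metric.ball x₀ r) (hxf : x ∈ frontier Ω)
    {τ : E} (hτ : fderiv ℝ ρ x τ = 0) :
    d2 (closure Ω) u x τ (A x) = -(d1 (closure Ω) u x (fderiv ℝ A x τ) + fderiv ℝ β x τ) := by
  have := h.differentiate hu hx τ
  rw [h.patch.π_eq x hx hxf, h.patch.π_tangent x hx hxf τ hτ] at this
  linarith

theorem norm_d1_sub_le (h : ObliqueData Ω u x₀ r K H ρ π A β) {m : ℝ} (hu : IsRegular Ω u)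
    (hm : ∀ y ∈ closure Ω, ‖d2 (closure Ω) u y‖ ≤ m) (hx₀ : x₀ ∈ frontier Ω)
    (hx : x ∈ Metric.ball x₀ r) (hxf : x ∈ frontier Ω) :
    ‖d1 (closure Ω) u x - d1 (closure Ω) u x₀‖ ≤ m * K * ‖x - x₀‖ := by
  have hr : 0 < r := Metric.nonempty_ball.1 ⟨x, hx⟩
  have := norm_sub_le_of_fderiv_le (f := fun y => d1 (closure Ω) u (π y)) (C := m * K)
    (fun y hy => (h.d1_hasFDerivAt hu hy).differentiableAt) (fun y hy => by
      rw [(h.d1_hasFDerivAt hu hy).fderiv]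
      refine (ContinuousLinearMap.opNorm_comp_le _ _).trans ?_
      have h1 := hm _ (h.π_mem_closure hy)
      exact mul_le_mul h1 (h.patch.π_bound₁ y hy) (norm_nonneg _) ((norm_nonneg _).trans h1)) hx
  simpa only [h.patch.π_eq x hx hxf, h.patch.π_eq x₀ (Metric.mem_ball_self hr) hx₀] using this

theorem norm_A_sub_le (h : ObliqueData Ω u x₀ r K H ρ π A β)
    (hx : x ∈ Metric.ball x₀ r) : ‖A x - A x₀‖ ≤ K * ‖x - x₀‖ :=
  norm_sub_le_of_fderiv_le (fun _ hy => (h.A_hasFDerivAt hy).differentiableAt) h.A_bound₁ hx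

/-- On the boundary, `Du · A(x₀)` is linear up to a quadratic error. -/
theorem linear_expansion (h : ObliqueData Ω u x₀ r K H ρ π A β)
    {m : ℝ} (hu : IsRegular Ω u) (hm0 : 0 ≤ m) (hH : H = 1 + m) (hK : 1 ≤ K)
    (hd1 : ∀ y ∈ closure Ω, ‖d1 (closure Ω) u y‖ ≤ K)
    (hm : ∀ y ∈ closure Ω, ‖d2 (closure Ω) u y‖ ≤ m) (hx₀ : x₀ ∈ frontier Ω)
    (hx : x ∈ Metric.ball x₀ r) (hxf : x ∈ frontier Ω) :
    |d1 (closure Ω) u x (A x₀) - d1 (closure Ω) u x₀ (A x₀)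
      + ((d1 (closure Ω) u x₀).comp (fderiv ℝ A x₀) + fderiv ℝ β x₀) (x - x₀)|
      ≤ 3 * K ^ 2 * H * ‖x - x₀‖ ^ 2 := by
  have hr : 0 < r := Metric.nonempty_ball.1 ⟨x, hx⟩
  have hx0 := Metric.mem_ball_self (x := x₀) hr
  have e1 := h.eq_zero x hx
  have e0 := h.eq_zero x₀ hx0
  rw [h.patch.π_eq x hx hxf] at e1
  rw [h.patch.π_eq x₀ hx0 hx₀] at e0
  have a1 := h.norm_d1_sub_le hu hm hx₀ hx hxf
  have a2 := h.norm_A_sub_le hx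
  have a3 := norm_taylor_le h.A_contDiffAt h.A_bound₂ hx
  have a4 := norm_taylor_le h.β_contDiffAt h.β_bound₂ hx
  have a5 := hd1 x₀ (frontier_subset_closure hx₀)
  have b1 := abs_apply_le _ a1 a2
  have b2 := abs_apply_le _ a5 a3
  rw [Real.norm_eq_abs] at a4
  -- The condition Du·A = -β is expanded at x₀. The product of the increments of Du and A is
  -- quadratic with a factor m, and the Taylor remainders of A and β carry the factor 1 + m.
  have key : d1 (closure Ω) u x (A x₀) - d1 (closure Ω) u x₀ (A x₀)
      + ((d1 (closure Ω) u x₀).comp (fderiv ℝ A x₀) + fderiv ℝ β x₀) (x - x₀)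
      = -((d1 (closure Ω) u x - d1 (closure Ω) u x₀) (A x - A x₀))
        - d1 (closure Ω) u x₀ (A x - A x₀ - fderiv ℝ A x₀ (x - x₀))
        - (β x - β x₀ - fderiv ℝ β x₀ (x - x₀)) := by
    simp only [map_sub, sub_apply, add_apply, ContinuousLinearMap.comp_apply]
    linarith
  rw [key]
  set t := ‖x - x₀‖
  have ht : 0 ≤ t := norm_nonneg _
  have c1 : m * K * t * (K * t) ≤ K ^ 2 * H * t ^ 2 := by
    rw [hH]; nlinarith [mul_nonneg (sq_nonneg K) (sq_nonneg t)]
  have c3 : K * H * t ^ 2 ≤ K ^ 2 * H * t ^ 2 := by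
    have : K ≤ K ^ 2 := by nlinarith
    have hH0 : 0 ≤ H := by linarith
    gcongr
  have d1' := abs_le.1 b1
  have d2' := abs_le.1 b2
  have d3' := abs_le.1 a4
  rw [abs_le]
  constructor <;> nlinarith

end ObliqueData
end Oblique

/-! ### The double oblique derivative. -/

section BoundaryEstimates

variable {E : Type*} [NormedAddCommGroup E] [InnerProductSpace ℝ E]
  {ι : Type*} [Fintype ι] {Ω : Set E} {u : E → ℝ} {x x₀ : E} {r K H : ℝ} {ρ : E → ℝ} {π : E → E}
  {A : E → E} {β : E → ℝ}

/-- Obliqueness makes A(x₀) point into Ω, so a test function that is maximal at x₀ has nonpositive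
derivative along it. -/
theorem ObliqueData.ray_inequality (h : ObliqueData Ω u x₀ r K H ρ π A β) (hu : IsRegular Ω u)
    (hx₀ : x₀ ∈ frontier Ω) (hr : 0 < r) (hK : 1 ≤ K) {r' : ℝ} (hr' : 0 < r') (b : ι → E)
    {ω ω' : ℝ} {e a : E} {κ s : E →L[ℝ] ℝ} {c q B : ℝ}
    (h0 : testFun b (closure Ω) u ω ω' e a x₀ κ s c q B x₀ = 0)
    (hle : ∀ y ∈ closure Ω, ‖y - x₀‖ ≤ r' →
      testFun b (closure Ω) u ω ω' e a x₀ κ s c q B y ≤ 0) :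
    ω * d3 (closure Ω) u x₀ (A x₀) e e
      + ω' * (∑ j, 2 * d1 (closure Ω) u x₀ (b j) * d2 (closure Ω) u x₀ (A x₀) (b j))
      + d2 (closure Ω) u x₀ (A x₀) a + κ (A x₀) ≤ 0 := by
  refine hu.testFun_ray_le b (c := c) (q := q) (B := B) (s := s) (frontier_subset_closure hx₀) ?_
  have hx := Metric.mem_ball_self (x := x₀) hr
  have hpos : 0 < fderiv ℝ ρ x₀ (A x₀) := by
    have := h.oblique x₀ hx hx₀
    by_contra hn
    push Not at hn
    nlinarith
  have hc : ∀ᶠ y in 𝓝 x₀, ‖y - x₀‖ < r' := by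
    have : Continuous fun y : E => ‖y - x₀‖ := by fun_prop
    exact this.continuousAt.eventually_lt continuousAt_const (by simpa using hr')
  filter_upwards [eventually_mem_of_fderiv_pos hu.isOpen (h.patch.ρ_differentiableAt hx)
    (h.patch.eventually_mem_iff Metric.isOpen_ball hx) hx₀ hpos,
    (tendsto_ray x₀ (A x₀)).eventually hc] with t h1 h2
  exact ⟨subset_closure h1, (hle _ (subset_closure h1) h2.le).trans h0.ge⟩

theorem ObliqueData.one_le_norm_fderiv_sq (h : ObliqueData Ω u x₀ r K H ρ π A β) (hr : 0 < r) :
    1 ≤ K ^ 2 * ‖fderiv ℝ ρ x₀‖ ^ 2 := by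
  have := h.patch.ρ_grad x₀ (Metric.mem_ball_self hr)
  rw [← mul_pow]
  nlinarith

set_option maxHeartbeats 1000000 in
/-- The double oblique derivative at the boundary. -/
theorem exists_normal_estimate (E : Type*) [NormedAddCommGroup E] [InnerProductSpace ℝ E]
    [FiniteDimensional ℝ E] (ι : Type*) [Fintype ι] {r lam K ε : ℝ} (hr : 0 < r) (hr1 : r ≤ 1)
    (hlam : 0 < lam) (hK : 1 ≤ K) (hε : 0 < ε) :
    ∃ C, 0 ≤ C ∧ ∀ (Ω : Set E) (u : E → ℝ) (b : OrthonormalBasis ι ℝ E) (m : ℝ),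
      Problem Ω u b r lam K m → ∀ x₀ ∈ frontier Ω, ∀ ρ π A β,
        ObliqueData Ω u x₀ r K (1 + m) ρ π A β →
          d2 (closure Ω) u x₀ (A x₀) (A x₀) ≤ ε * (1 + m) + C := by
  set n : ℝ := (Fintype.card ι : ℝ) with hn
  have hn0 : 0 ≤ n := by positivity
  have hK0 : 0 < K := by linarith
  -- The strength of the convex part of the barrier -s + N s². The second term lets it dominate the
  -- error that B itself contributes through q; the third makes the final contribution B K² at most
  -- ε(1+m) + C.
  set N : ℝ := 1 + 4 * n * K ^ 4 / lam + 6 * n * K ^ 7 / (lam * ε) with hN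
  have hN1 : 4 * n * K ^ 4 ≤ N * lam := by
    have : N * lam = lam + 4 * n * K ^ 4 + 6 * n * K ^ 7 / ε := by
      rw [hN]; field_simp
    rw [this]
    have : 0 ≤ 6 * n * K ^ 7 / ε := by positivity
    linarith
  have hN2 : 6 * n * K ^ 7 ≤ N * lam * ε := by
    have : N * lam * ε = lam * ε + 4 * n * K ^ 4 * ε + 6 * n * K ^ 7 := by
      rw [hN]; field_simp
    rw [this]
    have : 0 ≤ 4 * n * K ^ 4 * ε := by positivity
    have : 0 < lam * ε := by positivity
    linarith
  have hN0 : 1 ≤ N := by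
    have h1 : 0 ≤ 4 * n * K ^ 4 / lam := by positivity
    have h2 : 0 ≤ 6 * n * K ^ 7 / (lam * ε) := by positivity
    linarith
  set r' : ℝ := min (r / 2) (1 / (N * K)) with hr'
  have hr'0 : 0 < r' := lt_min (by linarith) (by positivity)
  have hr'r : r' < r := (min_le_left _ _).trans_lt (by linarith)
  have hr'1 : r' ≤ 1 := by linarith
  have hr'N : N * (K * r') ≤ 1 := by
    have : r' ≤ 1 / (N * K) := min_le_right _ _
    rw [le_div_iff₀ (by positivity)] at this
    linarith
  -- On the sphere of radius r' the difference of Du·A(x₀) and the linear term κ₀ contribute at most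
  -- 2K² each; R absorbs both.
  set R : ℝ := 4 * K ^ 2 / r' ^ 2 with hR
  have hRr : R * r' ^ 2 = 4 * K ^ 2 := by rw [hR]; field_simp
  have hR0 : 0 ≤ R := by positivity
  set D₀ : ℝ := K ^ 2 + 2 * n * K * R + 1 with hD₀
  have hD₀0 : 0 ≤ D₀ := by positivity
  refine ⟨2 * K ^ 3 + K ^ 4 * D₀ / (N * lam), by positivity, ?_⟩
  clear_value n N r' R D₀
  intro Ω u b m P x₀ hx₀ ρ π A β h
  set H := 1 + m with hH
  have hm := P.m_nonneg
  have hH1 : 1 ≤ H := by linarith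
  -- D exceeds by one the error terms of the operator that are independent of B, and B is taken so
  -- that the barrier contributes at least 2D: one D for those, one for the term in B.
  set D : ℝ := D₀ + 6 * n * K ^ 3 * H with hD
  have hD0 : 0 ≤ D := by positivity
  set B : ℝ := K ^ 2 * D / (N * lam) with hB
  have hB0 : 0 ≤ B := by positivity
  have hBN : B * (N * lam) = K ^ 2 * D := by rw [hB]; field_simp
  set q : ℝ := 3 * K ^ 2 * H + 2 * B * K + R with hq
  have hq0 : 0 ≤ q := by positivity
  clear_value H D B q
  have hx := Metric.mem_ball_self (x := x₀) hr
  set s := fderiv ℝ ρ x₀ with hs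
  set κ₀ := (d1 (closure Ω) u x₀).comp (fderiv ℝ A x₀) + fderiv ℝ β x₀ with hκ₀
  have hx₀S := frontier_subset_closure hx₀
  have hκ₀n : ‖κ₀‖ ≤ 2 * K ^ 2 := by
    refine (norm_add_le _ _).trans ?_
    have h1 := (ContinuousLinearMap.opNorm_comp_le (d1 (closure Ω) u x₀) (fderiv ℝ A x₀)).trans
      (mul_le_mul (P.d1_le x₀ hx₀S) (h.A_bound₁ x₀ hx) (norm_nonneg _) hK0.le)
    have h2 := h.β_bound₁ x₀ hx
    nlinarith
  have hA0 : ‖A x₀‖ ≤ K := h.A_bound₀ x₀ hx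
  -- No second derivatives and no |Du|² here: the function is Du·A(x₀), corrected by its linear part
  -- on ∂Ω, plus the barrier.
  set W := testFun b (closure Ω) u 0 0 (A x₀) (A x₀) x₀ (κ₀ - B • s) s
    (-(d1 (closure Ω) u x₀ (A x₀))) q (B * N) with hW
  have hWx : ∀ y, W y = (d1 (closure Ω) u y (A x₀) - d1 (closure Ω) u x₀ (A x₀) + κ₀ (y - x₀))
      + B * (-(s (y - x₀)) + N * (s (y - x₀)) ^ 2) - q * ‖y - x₀‖ ^ 2 := by
    intro y
    simp only [hW, testFun, sub_apply, smul_apply, smul_eq_mul]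
    ring
  have hball : ∀ y, ‖y - x₀‖ ≤ r' → y ∈ Metric.ball x₀ r := fun y hy =>
    mem_ball_iff_norm.2 (hy.trans_lt hr'r)
  -- For |y - x₀| ≤ r' one has N s² ≤ |s|, and s is negative on the closure only up to a quadratic
  -- amount. The barrier is therefore quadratically small and is swallowed by q.
  have hbar : ∀ y ∈ closure Ω, ‖y - x₀‖ ≤ r' →
      B * (-(s (y - x₀)) + N * (s (y - x₀)) ^ 2) ≤ 2 * B * K * ‖y - x₀‖ ^ 2 := by
    intro y hy hyr
    have h1 := h.patch.neg_le_linear P.regular.isOpen hx₀ (hball y hyr) hy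
    have h2 : |s (y - x₀)| ≤ K * r' := abs_apply_le s (h.patch.ρ_bound₁ x₀ hx) hyr
    have h3 : N * |s (y - x₀)| ≤ 1 := (mul_le_mul_of_nonneg_left h2 (by linarith)).trans hr'N
    have h4 : N * (s (y - x₀)) ^ 2 ≤ |s (y - x₀)| := by
      rw [← sq_abs]; nlinarith [abs_nonneg (s (y - x₀))]
    have h5 : -(s (y - x₀)) + |s (y - x₀)| ≤ 2 * (K * ‖y - x₀‖ ^ 2) := by
      have : 0 ≤ K * ‖y - x₀‖ ^ 2 := by positivity
      rcases abs_cases (s (y - x₀)) with ⟨e, _⟩ | ⟨e, _⟩ <;> rw [e] <;> linarith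
    have := mul_le_mul_of_nonneg_left
      (show -(s (y - x₀)) + N * (s (y - x₀)) ^ 2 ≤ 2 * (K * ‖y - x₀‖ ^ 2) by linarith) hB0
    linarith
  have hW0 : W x₀ = 0 := by rw [hWx]; simp
  have hdich := exists_isLocalMax_or_le (W := W) (x₀ := x₀) (r := r') P.regular.isOpen
    (P.regular.continuousOn_testFun b _ _ _ _ _ _ _ _ _ _) (by
      intro y hy hyr
      rw [hWx]
      have h1 := hbar y (frontier_subset_closure hy) hyr
      have h2 := (abs_le.1 (h.linear_expansion P.regular hm hH hK P.d1_le P.d2_le hx₀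
        (hball y hyr) hy)).2
      have h3 : 0 ≤ R * ‖y - x₀‖ ^ 2 := by positivity
      simp only [hq]
      linarith) (by
      intro y hy hyr
      rw [hWx]
      have hyS := subset_closure hy
      have h1 := hbar y hyS hyr.le
      have h2 := (abs_le.1 (abs_apply_le _ (P.d1_le y hyS) hA0)).2
      have h3 := (abs_le.1 (abs_apply_le _ (P.d1_le x₀ hx₀S) hA0)).1
      have h4 := (abs_le.1 (abs_apply_le κ₀ hκ₀n (hyr.le.trans hr'1))).2
      rw [hyr] at h1 ⊢
      have h5 : 0 ≤ 3 * K ^ 2 * H * r' ^ 2 := by positivity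
      simp only [hq]
      linarith)
  have hA0ne : A x₀ ≠ 0 := fun h0 => by
    have := h.oblique x₀ hx hx₀
    rw [h0, map_zero, mul_zero] at this
    linarith
  rcases hdich with ⟨y, hy, hyr, hmax, -⟩ | hle
  · exfalso
    obtain ⟨T, hT1, -, hT2⟩ := P.elliptic.testFun_le hlam P.regular b le_rfl le_rfl hq0 hy
      (P.d1_le y (subset_closure hy)) hmax (e' := ‖A x₀‖⁻¹ • A x₀) (by
        rw [norm_smul, norm_inv, norm_norm, inv_mul_cancel₀ (norm_ne_zero_iff.2 hA0ne)])
    have hs1 : 1 ≤ K ^ 2 * ‖s‖ ^ 2 := h.one_le_norm_fderiv_sq hr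
    have hT3 : lam ≤ K ^ 2 * T := by nlinarith [sq_nonneg K]
    have hT4 : 2 * D ≤ 2 * (B * N) * T := by
      have h1 : B * N * lam ≤ B * N * (K ^ 2 * T) :=
        mul_le_mul_of_nonneg_left hT3 (by positivity)
      have h2 : K ^ 2 * D ≤ K ^ 2 * (B * N * T) := by linarith
      have := le_of_mul_le_mul_left h2 (by positivity)
      linarith
    have h4B : 4 * n * K ^ 2 * B ≤ D := by
      have h1 : (4 * n * K ^ 2 * B) * (N * lam) ≤ D * (N * lam) := by
        have := mul_le_mul_of_nonneg_right hN1 hD0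
        calc (4 * n * K ^ 2 * B) * (N * lam) = 4 * n * K ^ 2 * (B * (N * lam)) := by ring
          _ = 4 * n * K ^ 4 * D := by rw [hBN]; ring
          _ ≤ _ := by linarith
      exact le_of_mul_le_mul_right h1 (by positivity)
    have hKA : K * ‖A x₀‖ ≤ K ^ 2 := by nlinarith
    have hqn : 2 * q * (n * K) = 6 * n * K ^ 3 * H + 4 * n * K ^ 2 * B + 2 * n * K * R := by
      simp only [hq]; ring
    simp only [zero_mul, mul_zero, neg_zero, zero_add, sub_zero, zero_sub] at hT2
    rw [← hn, hqn] at hT2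
    simp only [hD, hD₀] at hT4 h4B
    linarith
  -- The inward derivative at x₀ reads u_AA + κ₀(A) - B s(A) ≤ 0, which is the bound sought.
  · have hray := h.ray_inequality P.regular hx₀ hr hK hr'0 b hW0 hle
    simp only [zero_mul, zero_add, sub_apply, smul_apply, smul_eq_mul] at hray
    have h1 := (abs_le.1 (abs_apply_le κ₀ hκ₀n hA0)).1
    have h2 := (abs_le.1 (abs_apply_le s (h.patch.ρ_bound₁ x₀ hx) hA0)).2
    have h3 := mul_le_mul_of_nonneg_left h2 hB0
    have h4 : B * (K * K) ≤ ε * H + K ^ 4 * D₀ / (N * lam) := by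
      have e1 : B * (K * K) = 6 * n * K ^ 7 * H / (N * lam) + K ^ 4 * D₀ / (N * lam) := by
        simp only [hB, hD]; field_simp
        ring
      rw [e1]
      have : 6 * n * K ^ 7 * H / (N * lam) ≤ ε * H := by
        rw [div_le_iff₀ (by positivity)]
        have := mul_le_mul_of_nonneg_right hN2 (by linarith : 0 ≤ H)
        linarith
      linarith
    have h5 : 2 * K ^ 2 * K = 2 * K ^ 3 := by ring
    linarith

end BoundaryEstimates

/-! ### Expansion along the boundary in tangential directions. -/

section Tangential

variable {E : Type*} [NormedAddCommGroup E] [InnerProductSpace ℝ E]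
  {ι : Type*} [Fintype ι] {Ω : Set E} {u : E → ℝ} {x x₀ e : E} {r K H : ℝ} {ρ : E → ℝ} {π : E → E}
  {A : E → E} {β : E → ℝ}

/-- The coefficient `c` such that `e - c A` is tangential. -/
def obliqueCoeff (ρ : E → ℝ) (A : E → E) (e x : E) : ℝ := fderiv ℝ ρ x e / fderiv ℝ ρ x (A x)

namespace ObliqueData

theorem oblique_pos (h : ObliqueData Ω u x₀ r K H ρ π A β)
    (hK : 1 ≤ K) (hx : x ∈ Metric.ball x₀ r) (hxf : x ∈ frontier Ω) :
    0 < fderiv ℝ ρ x (A x) := by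
  have := h.oblique x hx hxf
  by_contra hn
  push Not at hn
  nlinarith

theorem abs_div_oblique_le (h : ObliqueData Ω u x₀ r K H ρ π A β)
    (hK : 1 ≤ K) (hx : x ∈ Metric.ball x₀ r) (hxf : x ∈ frontier Ω)
    {t B : ℝ} (ht : |t| ≤ B) : |t / fderiv ℝ ρ x (A x)| ≤ K * B := by
  have hp := h.oblique_pos hK hx hxf
  have h1 := h.oblique x hx hxf
  rw [abs_div, abs_of_pos hp, div_le_iff₀ hp]
  nlinarith [(abs_nonneg t).trans ht]

theorem abs_obliqueCoeff_le (h : ObliqueData Ω u x₀ r K H ρ π A β)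
    (hK : 1 ≤ K) (hx : x ∈ Metric.ball x₀ r) (hxf : x ∈ frontier Ω)
    (he : ‖e‖ ≤ 1) : |obliqueCoeff ρ A e x| ≤ K ^ 2 := by
  have := h.abs_div_oblique_le hK hx hxf (abs_apply_le _ (h.patch.ρ_bound₁ x hx) he)
  rw [obliqueCoeff]
  linarith

theorem abs_obliqueCoeff_le_norm (h : ObliqueData Ω u x₀ r K H ρ π A β)
    (hK : 1 ≤ K) (hx : x ∈ Metric.ball x₀ r) (hxf : x ∈ frontier Ω)
    (he : ‖e‖ ≤ 1) (h0 : fderiv ℝ ρ x₀ e = 0) : |obliqueCoeff ρ A e x| ≤ K ^ 2 * ‖x - x₀‖ := by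
  have h1 := norm_fderiv_sub_le (fun y hy => (h.patch.ρ_contDiffAt y hy).of_le (by norm_num))
    h.patch.ρ_bound₂ hx
  have h2 := abs_apply_le _ h1 he
  rw [sub_apply, h0, sub_zero] at h2
  have := h.abs_div_oblique_le hK hx hxf h2
  rw [obliqueCoeff]
  linarith

theorem fderiv_sub_obliqueCoeff_smul (h : ObliqueData Ω u x₀ r K H ρ π A β)
    (hK : 1 ≤ K) (hx : x ∈ Metric.ball x₀ r)
    (hxf : x ∈ frontier Ω) : fderiv ℝ ρ x (e - obliqueCoeff ρ A e x • A x) = 0 := by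
  have hp := h.oblique_pos hK hx hxf
  rw [map_sub, map_smul, obliqueCoeff, smul_eq_mul, div_mul_cancel₀ _ hp.ne', sub_self]

theorem obliqueCoeff_expansion (h : ObliqueData Ω u x₀ r K H ρ π A β)
    (hK : 1 ≤ K) (hx₀ : x₀ ∈ frontier Ω) (hx : x ∈ Metric.ball x₀ r)
    (hxf : x ∈ frontier Ω) (he : ‖e‖ ≤ 1) (h0 : fderiv ℝ ρ x₀ e = 0) :
    |obliqueCoeff ρ A e x - fderiv ℝ (fderiv ℝ ρ) x₀ (x - x₀) e / fderiv ℝ ρ x₀ (A x₀)|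
      ≤ 3 * K ^ 5 * ‖x - x₀‖ ^ 2 := by
  have hr : 0 < r := Metric.nonempty_ball.1 ⟨x, hx⟩
  have hx0 := Metric.mem_ball_self (x := x₀) hr
  have hp := h.oblique_pos hK hx hxf
  have hp0 := h.oblique_pos hK hx0 hx₀
  set t := ‖x - x₀‖
  have ht : 0 ≤ t := norm_nonneg _
  have h1 : |fderiv ℝ ρ x e - fderiv ℝ (fderiv ℝ ρ) x₀ (x - x₀) e| ≤ K * t ^ 2 := by
    have := norm_taylor_le (f := fderiv ℝ ρ) (fun y hy =>
      (h.patch.ρ_contDiffAt y hy).fderiv_right (m := 2) (by norm_num)) h.patch.ρ_bound₃ hx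
    have := abs_apply_le _ this he
    simpa [h0] using this
  have h2 : |fderiv ℝ ρ x (A x) - fderiv ℝ ρ x₀ (A x₀)| ≤ 2 * K ^ 2 * t := by
    have a1 := abs_apply_le _ (norm_fderiv_sub_le (fun y hy =>
      (h.patch.ρ_contDiffAt y hy).of_le (by norm_num)) h.patch.ρ_bound₂ hx) (h.A_bound₀ x hx)
    have a2 := abs_apply_le _ (h.patch.ρ_bound₁ x₀ hx0) (h.norm_A_sub_le hx)
    rw [sub_apply] at a1
    rw [map_sub] at a2
    have e1 : fderiv ℝ ρ x (A x) - fderiv ℝ ρ x₀ (A x₀) = (fderiv ℝ ρ x (A x)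
      - fderiv ℝ ρ x₀ (A x)) + (fderiv ℝ ρ x₀ (A x) - fderiv ℝ ρ x₀ (A x₀)) := by ring
    rw [e1]
    refine (abs_add_le _ _).trans ?_
    linarith
  have h3 : |fderiv ℝ (fderiv ℝ ρ) x₀ (x - x₀) e| ≤ K * t * 1 :=
    abs_apply₂_le _ (h.patch.ρ_bound₂ x₀ hx0) le_rfl he
  have h4 := h.abs_div_oblique_le hK hx hxf h1
  have h5 := h.abs_div_oblique_le hK hx hxf (h.abs_div_oblique_le hK hx0 hx₀
    (show |fderiv ℝ (fderiv ℝ ρ) x₀ (x - x₀) e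
      * (fderiv ℝ ρ x (A x) - fderiv ℝ ρ x₀ (A x₀))| ≤ 2 * K ^ 3 * t ^ 2 by
      rw [abs_mul]
      refine (mul_le_mul h3 h2 (abs_nonneg _) (by positivity)).trans (le_of_eq (by ring))))
  -- The numerator vanishes at x₀, so freezing the denominator there costs only a second-order
  -- error.
  have e2 : obliqueCoeff ρ A e x - fderiv ℝ (fderiv ℝ ρ) x₀ (x - x₀) e / fderiv ℝ ρ x₀ (A x₀)
      = (fderiv ℝ ρ x e - fderiv ℝ (fderiv ℝ ρ) x₀ (x - x₀) e) / fderiv ℝ ρ x (A x)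
        - fderiv ℝ (fderiv ℝ ρ) x₀ (x - x₀) e
          * (fderiv ℝ ρ x (A x) - fderiv ℝ ρ x₀ (A x₀)) / fderiv ℝ ρ x₀ (A x₀)
          / fderiv ℝ ρ x (A x) := by
    rw [obliqueCoeff]; field_simp; ring
  rw [e2]
  refine (abs_sub _ _).trans ?_
  have h6 : K ^ 2 ≤ K ^ 5 := pow_le_pow_right₀ hK (by norm_num)
  have h7 := mul_le_mul_of_nonneg_right h6 (sq_nonneg t)
  linarith

end ObliqueData

theorem sqGrad_eq_norm_sq (b : OrthonormalBasis ι ℝ E) (S : Set E) (u : E → ℝ) (x : E) :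
    sqGrad b S u x = ‖d1 S u x‖ ^ 2 := sum_sq_apply_orthonormalBasis b _

theorem d2_self_le_of_unit {S : Set E} {B : ℝ} (hB : ∀ τ, ‖τ‖ = 1 → IsTangent Ω x τ →
    d2 S u x τ τ ≤ B) {τ : E} (hτ : IsTangent Ω x τ) : d2 S u x τ τ ≤ B * ‖τ‖ ^ 2 := by
  by_cases h0 : τ = 0
  · simp [h0]
  have hn : 0 < ‖τ‖ := norm_pos_iff.2 h0
  have := hB (‖τ‖⁻¹ • τ) (by rw [norm_smul, norm_inv, norm_norm, inv_mul_cancel₀ hn.ne'])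
    (fun V P ρ π h1 h2 h3 => by rw [map_smul, hτ V P ρ π h1 h2 h3, smul_zero])
  simp only [map_smul, smul_apply, smul_eq_mul] at this
  have h2 := mul_le_mul_of_nonneg_right this (sq_nonneg ‖τ‖)
  have e1 : ‖τ‖⁻¹ * (‖τ‖⁻¹ * d2 S u x τ τ) * ‖τ‖ ^ 2 = d2 S u x τ τ := by field_simp
  linarith

set_option maxHeartbeats 1000000 in
/-- Expansion of `u_ee + |Du|²` along the boundary at a maximum over tangential directions. -/
theorem Problem.tangential_expansion {b : OrthonormalBasis ι ℝ E} {lam m M' : ℝ}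
    (P : Problem Ω u b r lam K m) (hr : 0 < r) (hr1 : r ≤ 1) (hK : 1 ≤ K)
    (hM' : ∀ x ∈ frontier Ω, ∀ τ, ‖τ‖ = 1 → IsTangent Ω x τ →
      d2 (closure Ω) u x τ τ + sqGrad b (closure Ω) u x ≤ M')
    (hx₀ : x₀ ∈ frontier Ω) (he : ‖e‖ = 1) (het : IsTangent Ω x₀ e)
    (heq : d2 (closure Ω) u x₀ e e + sqGrad b (closure Ω) u x₀ = M')
    (h : ObliqueData Ω u x₀ r K (1 + m) ρ π A β) :
    ∃ κ : E →L[ℝ] ℝ, ‖κ‖ ≤ 51 * K ^ 8 * (1 + m) ∧ ∀ x ∈ frontier Ω, x ∈ Metric.ball x₀ r →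
      d2 (closure Ω) u x e e + sqGrad b (closure Ω) u x
        ≤ M' + κ (x - x₀) + 51 * K ^ 8 * (1 + m) * ‖x - x₀‖ ^ 2 := by
  set H := 1 + m with hH
  have hm0 := P.m_nonneg
  have hH1 : 1 ≤ H := by linarith
  have hmH : m ≤ H := by linarith
  have hK0 : 0 < K := by linarith
  clear_value H
  have hx0 := Metric.mem_ball_self (x := x₀) hr
  have hx₀S := frontier_subset_closure hx₀
  have h0 : fderiv ℝ ρ x₀ e = 0 := het _ _ _ _ Metric.isOpen_ball hx0 h.patch
  have hQ0 : ∀ y, 0 ≤ sqGrad b (closure Ω) u y := fun y => by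
    rw [sqGrad_eq_norm_sq]; positivity
  have hQ1 : ∀ y ∈ closure Ω, sqGrad b (closure Ω) u y ≤ K ^ 2 := fun y hy => by
    rw [sqGrad_eq_norm_sq]
    exact pow_le_pow_left₀ (norm_nonneg _) (P.d1_le y hy) 2
  have hee := abs_le.1 (abs_apply₂_le _ (P.d2_le x₀ hx₀S) he.le he.le)
  have hMQ : ∀ y ∈ closure Ω, |M' - sqGrad b (closure Ω) u y| ≤ 2 * K ^ 2 * H := fun y hy => by
    have := hQ0 y; have := hQ1 y hy; have := hQ0 x₀; have := hQ1 x₀ hx₀S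
    have hKH : K ^ 2 ≤ K ^ 2 * H := le_mul_of_one_le_right (by positivity) hH1
    have hKH' : H ≤ K ^ 2 * H := le_mul_of_one_le_left (by linarith) (one_le_pow₀ hK)
    rw [abs_le]; constructor <;> linarith
  -- On ∂Ω and for tangential τ, w is -u_τA. In the decomposition e = τ + cA, the quantity Y
  -- collects everything multiplying the first power of c, and ℓ is the linear part of c.
  let w : E → E → ℝ := fun y τ => d1 (closure Ω) u y (fderiv ℝ A y τ) + fderiv ℝ β y τ
  let Y : E → E → ℝ := fun y τ =>
    -2 * (inner ℝ e (A y) : ℝ) * (M' - sqGrad b (closure Ω) u y) - 2 * w y τ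
  let ℓ : E →L[ℝ] ℝ := (fderiv ℝ ρ x₀ (A x₀))⁻¹ • (fderiv ℝ (fderiv ℝ ρ) x₀).flip e
  have hℓ : ∀ y, ℓ y = fderiv ℝ (fderiv ℝ ρ) x₀ y e / fderiv ℝ ρ x₀ (A x₀) := fun y => by
    simp only [ℓ, smul_apply, ContinuousLinearMap.flip_apply, smul_eq_mul]
    rw [div_eq_inv_mul]
  have hℓn : ‖ℓ‖ ≤ K ^ 2 := ContinuousLinearMap.opNorm_le_bound _ (by positivity) fun y => by
    rw [hℓ, Real.norm_eq_abs]
    refine (h.abs_div_oblique_le hK hx0 hx₀ (abs_apply₂_le _ (h.patch.ρ_bound₂ x₀ hx0)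
      le_rfl he.le)).trans (le_of_eq (by ring))
  have hKp : ∀ i j : ℕ, i ≤ j → ∀ t : ℝ, 0 ≤ t → K ^ i * t ≤ K ^ j * t := fun i j hij t ht =>
    mul_le_mul_of_nonneg_right (pow_le_pow_right₀ hK hij) ht
  have hinner : ∀ v : E, |(inner ℝ e v : ℝ)| ≤ ‖v‖ := fun v => by
    have := abs_real_inner_le_norm e v
    rwa [he, one_mul] at this
  have hY₀ : |Y x₀ e| ≤ 8 * K ^ 3 * H := by
    have a1 : |(inner ℝ e (A x₀) : ℝ) * (M' - sqGrad b (closure Ω) u x₀)|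
        ≤ K * (2 * K ^ 2 * H) := by
      rw [abs_mul]
      exact mul_le_mul ((hinner _).trans (h.A_bound₀ x₀ hx0)) (hMQ x₀ hx₀S) (abs_nonneg _) hK0.le
    have a2 : |d1 (closure Ω) u x₀ (fderiv ℝ A x₀ e)| ≤ K * (K * 1) :=
      abs_apply_le _ (P.d1_le x₀ hx₀S) (norm_apply_le _ (h.A_bound₁ x₀ hx0) he.le)
    have a3 : |fderiv ℝ β x₀ e| ≤ K * 1 := abs_apply_le _ (h.β_bound₁ x₀ hx0) he.le
    have a4 := hKp 2 3 (by norm_num) 1 zero_le_one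
    have a5 := hKp 1 3 (by norm_num) 1 zero_le_one
    have a6 : K ^ 3 ≤ K ^ 3 * H := le_mul_of_one_le_right (by positivity) hH1
    have b1 := abs_le.1 a1
    have b2 := abs_le.1 a2
    have b3 := abs_le.1 a3
    simp only [Y, w]
    rw [abs_le]; constructor <;> linarith
  refine ⟨Y x₀ e • ℓ, ?_, ?_⟩
  · rw [norm_smul, Real.norm_eq_abs]
    refine (mul_le_mul hY₀ hℓn (norm_nonneg _) (by positivity)).trans ?_
    have := hKp 5 8 (by norm_num) H (by linarith)
    nlinarith [show 0 ≤ K ^ 8 * H by positivity]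
  intro x hxf hx
  have hxS := frontier_subset_closure hxf
  set t := ‖x - x₀‖ with ht
  have ht0 : 0 ≤ t := norm_nonneg _
  have ht1 : t ≤ 1 := (mem_ball_iff_norm.1 hx).le.trans hr1
  clear_value t
  set c := obliqueCoeff ρ A e x with hc
  set τ := e - c • A x with hτ
  have hc1 : |c| ≤ K ^ 2 * t := by rw [ht]; exact h.abs_obliqueCoeff_le_norm hK hx hxf he.le h0
  have hc2 : |c - ℓ (x - x₀)| ≤ 3 * K ^ 5 * t ^ 2 := by
    rw [ht, hℓ]; exact h.obliqueCoeff_expansion hK hx₀ hx hxf he.le h0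
  have hτ0 : fderiv ℝ ρ x τ = 0 := h.fderiv_sub_obliqueCoeff_smul hK hx hxf
  have hτt : IsTangent Ω x τ := h.patch.isTangent P.regular.isOpen Metric.isOpen_ball hx hxf hτ0
  clear_value c
  have hAx := h.A_bound₀ x hx
  have hτe : ‖τ - e‖ ≤ K ^ 3 * t := by
    rw [hτ, sub_sub_cancel_left, norm_neg, norm_smul, Real.norm_eq_abs]
    exact (mul_le_mul hc1 hAx (norm_nonneg _) (by positivity)).trans (le_of_eq (by ring))
  have hτn : ‖τ‖ ≤ 2 * K ^ 3 := by
    have a1 : ‖τ‖ ≤ ‖τ - e‖ + ‖e‖ := by simpa using norm_add_le (τ - e) e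
    have a2 : K ^ 3 * t ≤ K ^ 3 := mul_le_of_le_one_right (by positivity) ht1
    have a3 : 1 ≤ K ^ 3 := one_le_pow₀ hK
    linarith
  have hττ : ‖τ‖ ^ 2 = 1 - 2 * c * (inner ℝ e (A x) : ℝ) + c ^ 2 * ‖A x‖ ^ 2 := by
    rw [hτ, norm_sub_sq_real, he, real_inner_smul_right, norm_smul, Real.norm_eq_abs, mul_pow,
      sq_abs]
    ring
  have hd2 : d2 (closure Ω) u x e e = d2 (closure Ω) u x τ τ - 2 * c * w x τ
      + c ^ 2 * d2 (closure Ω) u x (A x) (A x) := by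
    have k1 := h.d2_tangent P.regular hx hxf hτ0
    have k2 : e = τ + c • A x := by rw [hτ]; abel
    have k3 : d2 (closure Ω) u x e e = d2 (closure Ω) u x τ τ + 2 * c * d2 (closure Ω) u x τ (A x)
      + c ^ 2 * d2 (closure Ω) u x (A x) (A x) := by
      have k4 := P.regular.d2_symm hxS (A x) τ
      conv_lhs => rw [k2]
      simp only [map_add, add_apply, map_smul, smul_apply, smul_eq_mul, k4]
      ring
    rw [k3, k1]; ring
  have hττ' := d2_self_le_of_unit (B := M' - sqGrad b (closure Ω) u x)
    (fun τ h1 h2 => by have := hM' x hxf τ h1 h2; linarith) hτt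
  -- Maximality of M' bounds u_ττ by (M' - |Du|²)|τ|², and |τ|² = 1 - 2c⟨e, A⟩ + c²|A|².
  have hident : d2 (closure Ω) u x e e + sqGrad b (closure Ω) u x ≤ M' + c * Y x τ
      + c ^ 2 * (‖A x‖ ^ 2 * (M' - sqGrad b (closure Ω) u x)
        + d2 (closure Ω) u x (A x) (A x)) := by
    rw [hττ] at hττ'
    rw [hd2]
    simp only [Y]
    linarith
  have hlast : c ^ 2 * (‖A x‖ ^ 2 * (M' - sqGrad b (closure Ω) u x)
        + d2 (closure Ω) u x (A x) (A x)) ≤ 3 * K ^ 8 * H * t ^ 2 := by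
    have a1 : c ^ 2 ≤ K ^ 4 * t ^ 2 := by
      rw [← sq_abs]
      exact (pow_le_pow_left₀ (abs_nonneg _) hc1 2).trans (le_of_eq (by ring))
    have a2 : ‖A x‖ ^ 2 * (M' - sqGrad b (closure Ω) u x) ≤ K ^ 2 * (2 * K ^ 2 * H) :=
      (mul_le_mul_of_nonneg_left ((le_abs_self _).trans (hMQ x hxS)) (sq_nonneg _)).trans
        (mul_le_mul_of_nonneg_right (pow_le_pow_left₀ (norm_nonneg _) hAx 2) (by positivity))
    have a3 := (abs_le.1 (abs_apply₂_le _ ((P.d2_le x hxS).trans hmH) hAx hAx)).2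
    have a4 := hKp 2 4 (by norm_num) H (by linarith)
    have a5 : ‖A x‖ ^ 2 * (M' - sqGrad b (closure Ω) u x) + d2 (closure Ω) u x (A x) (A x)
        ≤ 3 * K ^ 4 * H := by linarith
    refine (mul_le_mul_of_nonneg_left a5 (sq_nonneg c)).trans ?_
    refine (mul_le_mul_of_nonneg_right a1 (by positivity)).trans (le_of_eq (by ring))
  have hYY : |Y x τ - Y x₀ e| ≤ 24 * K ^ 5 * H * t := by
    have hd1 : ‖d1 (closure Ω) u x - d1 (closure Ω) u x₀‖ ≤ H * K * t := by
      rw [ht]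
      refine (h.norm_d1_sub_le P.regular P.d2_le hx₀ hx hxf).trans ?_
      gcongr
    have hA := h.norm_A_sub_le hx
    rw [← ht] at hA
    have hA' : ‖fderiv ℝ A x - fderiv ℝ A x₀‖ ≤ K * H * t := by
      rw [ht]; exact norm_fderiv_sub_le h.A_contDiffAt h.A_bound₂ hx
    have hβ' : ‖fderiv ℝ β x - fderiv ℝ β x₀‖ ≤ K * H * t := by
      rw [ht]; exact norm_fderiv_sub_le h.β_contDiffAt h.β_bound₂ hx
    have hQQ : |sqGrad b (closure Ω) u x - sqGrad b (closure Ω) u x₀| ≤ 2 * K ^ 2 * H * t := by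
      rw [sqGrad_eq_norm_sq, sqGrad_eq_norm_sq, sq_sub_sq, abs_mul]
      have a1 : |‖d1 (closure Ω) u x‖ + ‖d1 (closure Ω) u x₀‖| ≤ 2 * K := by
        rw [abs_of_nonneg (by positivity)]
        linarith [P.d1_le x hxS, P.d1_le x₀ hx₀S]
      have a2 := (abs_norm_sub_norm_le (d1 (closure Ω) u x) (d1 (closure Ω) u x₀)).trans hd1
      exact (mul_le_mul a1 a2 (abs_nonneg _) (by positivity)).trans (le_of_eq (by ring))
    have a1 : |(inner ℝ e (A x - A x₀) : ℝ) * (M' - sqGrad b (closure Ω) u x)|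
        ≤ K * t * (2 * K ^ 2 * H) := by
      rw [abs_mul]
      exact mul_le_mul ((hinner _).trans hA) (hMQ x hxS) (abs_nonneg _) (by positivity)
    have a2 : |(inner ℝ e (A x₀) : ℝ)
        * (sqGrad b (closure Ω) u x - sqGrad b (closure Ω) u x₀)| ≤ K * (2 * K ^ 2 * H * t) := by
      rw [abs_mul]
      exact mul_le_mul ((hinner _).trans (h.A_bound₀ x₀ hx0)) hQQ (abs_nonneg _) hK0.le
    have a3 := abs_apply_le _ hd1 (norm_apply_le _ (h.A_bound₁ x hx) hτn)
    have a4 := abs_apply_le _ (P.d1_le x₀ hx₀S) (norm_apply_le _ hA' hτn)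
    have a5 := abs_apply_le _ (P.d1_le x₀ hx₀S) (norm_apply_le _ (h.A_bound₁ x₀ hx0) hτe)
    have a6 := abs_apply_le _ hβ' hτn
    have a7 := abs_apply_le _ (h.β_bound₁ x₀ hx0) hτe
    have key : Y x τ - Y x₀ e = -2 * ((inner ℝ e (A x - A x₀) : ℝ)
          * (M' - sqGrad b (closure Ω) u x))
        + 2 * ((inner ℝ e (A x₀) : ℝ)
          * (sqGrad b (closure Ω) u x - sqGrad b (closure Ω) u x₀))
        - 2 * ((d1 (closure Ω) u x - d1 (closure Ω) u x₀) (fderiv ℝ A x τ)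
          + d1 (closure Ω) u x₀ ((fderiv ℝ A x - fderiv ℝ A x₀) τ)
          + d1 (closure Ω) u x₀ (fderiv ℝ A x₀ (τ - e))
          + (fderiv ℝ β x - fderiv ℝ β x₀) τ + fderiv ℝ β x₀ (τ - e)) := by
      simp only [Y, w, inner_sub_right, sub_apply, map_sub]
      ring
    rw [key]
    have hHt : 0 ≤ H * t := by positivity
    have htH : t ≤ H * t := le_mul_of_one_le_left ht0 hH1
    have p1 := hKp 3 5 (by norm_num) _ hHt
    have p2 := hKp 4 5 (by norm_num) _ hHt
    have p3 : K ^ 5 * t ≤ K ^ 5 * (H * t) := mul_le_mul_of_nonneg_left htH (by positivity)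
    have p4 : K ^ 4 * t ≤ K ^ 4 * (H * t) := mul_le_mul_of_nonneg_left htH (by positivity)
    have b1 := abs_le.1 a1
    have b2 := abs_le.1 a2
    have b3 := abs_le.1 a3
    have b4 := abs_le.1 a4
    have b5 := abs_le.1 a5
    have b6 := abs_le.1 a6
    have b7 := abs_le.1 a7
    rw [abs_le]
    constructor <;> linarith
  -- As c = ℓ + O(t²) with c = O(t), and Y varies by O((1+m)t), the product cY is linear up to
  -- O((1+m)t²).
  have hcY : c * Y x τ - ℓ (x - x₀) * Y x₀ e ≤ 48 * K ^ 8 * H * t ^ 2 := by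
    have a1 : |(c - ℓ (x - x₀)) * Y x₀ e| ≤ 3 * K ^ 5 * t ^ 2 * (8 * K ^ 3 * H) := by
      rw [abs_mul]; exact mul_le_mul hc2 hY₀ (abs_nonneg _) (by positivity)
    have a2 : |c * (Y x τ - Y x₀ e)| ≤ K ^ 2 * t * (24 * K ^ 5 * H * t) := by
      rw [abs_mul]; exact mul_le_mul hc1 hYY (abs_nonneg _) (by positivity)
    have a3 := hKp 7 8 (by norm_num) (H * t ^ 2) (by positivity)
    have b1 := abs_le.1 a1
    have b2 := abs_le.1 a2
    linarith
  rw [smul_apply, smul_eq_mul]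
  linarith

/-- The third derivative `u_{Aee}` at a boundary point, for tangential `e`. -/
theorem Problem.abs_d3_le {b : OrthonormalBasis ι ℝ E} {lam m : ℝ}
    (P : Problem Ω u b r lam K m) (hr : 0 < r) (hK : 1 ≤ K)
    (hx₀ : x₀ ∈ frontier Ω) (he : ‖e‖ = 1) (h0 : fderiv ℝ ρ x₀ e = 0)
    (h : ObliqueData Ω u x₀ r K (1 + m) ρ π A β) :
    |d3 (closure Ω) u x₀ (A x₀) e e| ≤ 5 * K ^ 2 * (1 + m) := by
  have hm0 := P.m_nonneg
  have hx0 := Metric.mem_ball_self (x := x₀) hr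
  have hx₀S := frontier_subset_closure hx₀
  have hA := h.A_bound₀ x₀ hx0
  have key := h.differentiate_twice P.regular hx₀ hr h0
  rw [P.regular.d3_cycle hx₀S]
  have a1 := abs_le.1 (abs_apply₂_le _ (P.d2_le x₀ hx₀S) (norm_apply_le _ (norm_apply_le _
    (h.patch.π_bound₂ x₀ hx0) he.le) he.le) hA)
  have a2 := abs_le.1 (abs_apply₂_le _ (P.d2_le x₀ hx₀S) he.le
    (norm_apply_le _ (h.A_bound₁ x₀ hx0) he.le))
  have a3 := abs_le.1 (abs_apply_le _ (P.d1_le x₀ hx₀S) (norm_apply_le _ (norm_apply_le _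
    (h.A_bound₂ x₀ hx0) he.le) he.le))
  have a4 := abs_le.1 (abs_apply₂_le _ (h.β_bound₂ x₀ hx0) he.le he.le)
  have p0 : K ≤ K ^ 2 := by nlinarith
  have p1 : K * (1 + m) ≤ K ^ 2 * (1 + m) := mul_le_mul_of_nonneg_right p0 (by linarith)
  have p2 : K * m ≤ K ^ 2 * (1 + m) := mul_le_mul p0 (by linarith) hm0 (by positivity)
  have p3 : K ^ 2 * m ≤ K ^ 2 * (1 + m) := mul_le_mul_of_nonneg_left (by linarith) (by positivity)
  rw [abs_le]
  constructor <;> linarith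

/-- This gives compactness of the unit tangent bundle of ∂Ω, so the maximum over tangential
directions is attained. -/
theorem isClosed_tangent (hΩ : IsOpen Ω) (hp : ∀ x ∈ frontier Ω, ∃ r P ρ π, 0 < r ∧
    Patch Ω (Metric.ball x r) P ρ π) :
    IsClosed {p : E × E | p.1 ∈ frontier Ω ∧ ‖p.2‖ = 1 ∧ IsTangent Ω p.1 p.2} := by
  refine isClosed_of_closure_subset ?_
  rintro ⟨x, τ⟩ hx
  have h1 : IsClosed {p : E × E | p.1 ∈ frontier Ω ∧ ‖p.2‖ = 1} :=
    (isClosed_frontier.preimage continuous_fst).inter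
      (isClosed_eq continuous_snd.norm continuous_const)
  have hsub : {p : E × E | p.1 ∈ frontier Ω ∧ ‖p.2‖ = 1 ∧ IsTangent Ω p.1 p.2}
      ⊆ {p : E × E | p.1 ∈ frontier Ω ∧ ‖p.2‖ = 1} := fun p hp => ⟨hp.1, hp.2.1⟩
  have h2 := h1.closure_subset_iff.2 hsub hx
  refine ⟨h2.1, h2.2, ?_⟩
  obtain ⟨r, P, ρ, π, hr, h⟩ := hp x h2.1
  have hxr := Metric.mem_ball_self (x := x) hr
  refine h.isTangent hΩ Metric.isOpen_ball hxr h2.1 ?_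
  by_contra hne
  have hc : ContinuousAt (fun p : E × E => fderiv ℝ ρ p.1 p.2) (x, τ) := by
    have : ContinuousAt (fderiv ℝ ρ) x :=
      ((h.ρ_contDiffAt x hxr).fderiv_right (m := 3) (by norm_num)).continuousAt
    exact (ContinuousAt.comp (f := Prod.fst) this continuousAt_fst).clm_apply continuousAt_snd
  have hev := (hc.eventually_ne hne).and
    (continuousAt_fst.eventually (Metric.isOpen_ball.mem_nhds hxr))
  obtain ⟨p, hp1, hp2⟩ := (mem_closure_iff_frequently.1 hx).and_eventually hev |>.exists
  exact hp2.1 (hp1.2.2 _ _ _ _ Metric.isOpen_ball hp2.2 h)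

end Tangential

/-- Growth like the square root of H is turned into an arbitrarily small multiple of H plus a
constant. -/
theorem le_of_sq_le_mul {lam C H X ε : ℝ} (hlam : 0 < lam) (hε : 0 < ε) (hH : 0 < H) (hC : 0 ≤ C)
    (h : lam * X ^ 2 ≤ C * H) : X ≤ ε * H + C / (lam * ε) := by
  by_contra hn
  push Not at hn
  set D := C / (lam * ε) with hD
  have hD0 : 0 ≤ D := by positivity
  have hDC : D * (lam * ε) = C := by rw [hD]; field_simp
  have h1 : (ε * H + D) ^ 2 < X ^ 2 := pow_lt_pow_left₀ hn (by positivity) (by norm_num)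
  have h2 := mul_lt_mul_of_pos_left h1 hlam
  have h3 : C * H = lam * (ε * H * D) := by rw [← hDC]; ring
  have h4 : 0 ≤ lam * (ε * H * D) := by positivity
  have h5 : 0 ≤ lam * ((ε * H) ^ 2 + D ^ 2) := by positivity
  nlinarith

/-! ### Upper bounds for second derivatives of the form ε(1 + m) + C. -/

section Estimates

set_option maxHeartbeats 1000000 in
/-- Second derivatives at the boundary, in tangential directions. -/
theorem exists_tangential_estimate (E : Type*) [NormedAddCommGroup E] [InnerProductSpace ℝ E]
    [FiniteDimensional ℝ E] (ι : Type*) [Fintype ι] {r lam K ε : ℝ} (hr : 0 < r) (hr1 : r ≤ 1)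
    (hlam : 0 < lam) (hK : 1 ≤ K) (hε : 0 < ε) :
    ∃ C, 0 ≤ C ∧ ∀ (Ω : Set E) (u : E → ℝ) (b : OrthonormalBasis ι ℝ E) (m : ℝ),
      Problem Ω u b r lam K m → ∀ x ∈ frontier Ω, ∀ τ, ‖τ‖ = 1 → IsTangent Ω x τ →
          d2 (closure Ω) u x τ τ ≤ ε * (1 + m) + C := by
  set n : ℝ := (Fintype.card ι : ℝ) with hn
  have hn0 : 0 ≤ n := by positivity
  have hK0 : 0 < K := by linarith
  set C₁ : ℝ := 51 * K ^ 8 with hC₁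
  have hC₁0 : 0 ≤ C₁ := by positivity
  -- Since s(A) ≥ 1/K, a slope K₁(1+m) of the barrier outweighs u_Aee, the derivative of |Du|² and
  -- κ(A) by at least 1 + m.
  set K₁ : ℝ := K * (5 * K ^ 2 + 2 * n * K ^ 2 + C₁ * K + 1) with hK₁
  have hK₁0 : 0 ≤ K₁ := by positivity
  set r' : ℝ := r / 2 with hr'
  have hr'0 : 0 < r' := by positivity
  have hr'r : r' < r := by linarith
  have hr'1 : r' ≤ 1 := by linarith
  -- With this N, K₁(t - N t²) ≤ ε/4 for all t, so the steep barrier raises the maximum only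
  -- slightly.
  set N : ℝ := K₁ / ε with hN
  have hN0 : 0 ≤ N := by positivity
  have hNε : N * ε = K₁ := by rw [hN]; field_simp
  -- The summands serve in turn the sign on ∂Ω, the sign on the sphere, and the bound C₁t - Q₁t² ≤
  -- ε/4.
  set Q₁ : ℝ := C₁ + K₁ * K + (2 + K ^ 2 + C₁ + K₁ * K) / r' ^ 2 + C₁ ^ 2 / ε with hQ₁
  have hQ₁0 : 0 ≤ Q₁ := by positivity
  have hQ₁a : C₁ + K₁ * K ≤ Q₁ := by
    have : 0 ≤ (2 + K ^ 2 + C₁ + K₁ * K) / r' ^ 2 := by positivity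
    have : 0 ≤ C₁ ^ 2 / ε := by positivity
    linarith
  have hQ₁b : 2 + K ^ 2 + C₁ + K₁ * K ≤ Q₁ * r' ^ 2 := by
    rw [← div_le_iff₀ (by positivity)]
    have : 0 ≤ C₁ ^ 2 / ε := by positivity
    have : 0 ≤ K₁ * K := by positivity
    linarith
  have hQ₁c : C₁ ^ 2 ≤ Q₁ * ε := by
    rw [← div_le_iff₀ hε]
    have : 0 ≤ (2 + K ^ 2 + C₁ + K₁ * K) / r' ^ 2 := by positivity
    have : 0 ≤ K₁ * K := by positivity
    linarith
  set C₃ : ℝ := K + 2 * n * K ^ 2 + 2 * Q₁ * n * K + 2 * K₁ * N * (K * K ^ 2) with hC₃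
  have hC₃0 : 0 ≤ C₃ := by positivity
  refine ⟨K ^ 2 + C₃ / (2 * lam * (ε / 2)), by positivity, ?_⟩
  clear_value n K₁ N Q₁ C₃ r' C₁
  intro Ω u b m P x₁ hx₁ τ₁ hτ₁ hτ₁t
  have hm0 := P.m_nonneg
  have hfc : IsCompact (frontier Ω) :=
    Metric.isCompact_of_isClosed_isBounded isClosed_frontier
      (P.bounded.closure.subset frontier_subset_closure)
  set T := {p : E × E | p.1 ∈ frontier Ω ∧ ‖p.2‖ = 1 ∧ IsTangent Ω p.1 p.2} with hT
  have hTc : IsCompact T := by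
    refine (hfc.prod (isCompact_sphere (0 : E) 1)).of_isClosed_subset
      (isClosed_tangent P.regular.isOpen fun x hx => ?_) fun p hp => ⟨hp.1, by simpa using hp.2.1⟩
    obtain ⟨ρ, π, A, β, h⟩ := P.boundary x hx
    exact ⟨r, K, ρ, π, hr, h.patch⟩
  have hTcont : ContinuousOn (fun p : E × E => d2 (closure Ω) u p.1 p.2 p.2
      + sqGrad b (closure Ω) u p.1) T := by
    have hmaps : MapsTo (Prod.fst : E × E → E) T (closure Ω) := fun p hp =>
      frontier_subset_closure hp.1
    have k1 : ContinuousOn (fun p : E × E => d2 (closure Ω) u p.1) T :=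
      P.regular.c2.continuousOn.comp continuousOn_fst hmaps
    exact ((k1.clm_apply continuousOn_snd).clm_apply continuousOn_snd).add
      ((P.regular.continuousOn_sqGrad b).comp continuousOn_fst hmaps)
  obtain ⟨⟨x₀, e⟩, ⟨hx₀, he, het⟩, hmaxT⟩ := hTc.exists_isMaxOn ⟨(x₁, τ₁), hx₁, hτ₁, hτ₁t⟩ hTcont
  simp only at hx₀ he het
  set M' := d2 (closure Ω) u x₀ e e + sqGrad b (closure Ω) u x₀ with hM'
  have hle : ∀ x ∈ frontier Ω, ∀ τ, ‖τ‖ = 1 → IsTangent Ω x τ →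
      d2 (closure Ω) u x τ τ + sqGrad b (closure Ω) u x ≤ M' := fun x hx τ h1 h2 =>
    hmaxT (show (x, τ) ∈ T from ⟨hx, h1, h2⟩)
  have hQ0 : ∀ y, 0 ≤ sqGrad b (closure Ω) u y := fun y => by
    rw [sqGrad_eq_norm_sq]; positivity
  have hQ1 : ∀ y ∈ closure Ω, sqGrad b (closure Ω) u y ≤ K ^ 2 := fun y hy => by
    rw [sqGrad_eq_norm_sq]
    exact pow_le_pow_left₀ (norm_nonneg _) (P.d1_le y hy) 2
  have hd2 : ∀ y ∈ closure Ω, |d2 (closure Ω) u y e e| ≤ m := fun y hy => by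
    simpa using abs_apply₂_le _ (P.d2_le y hy) he.le he.le
  suffices hM'le : M' ≤ ε * (1 + m) + (K ^ 2 + C₃ / (2 * lam * (ε / 2))) by
    have := hle x₁ hx₁ τ₁ hτ₁ hτ₁t
    linarith [hQ0 x₁]
  obtain ⟨ρ, π, A, β, h⟩ := P.boundary x₀ hx₀
  obtain ⟨κ, hκ, hexp⟩ := P.tangential_expansion hr hr1 hK hle hx₀ he het hM'.symm h
  have hx0 := Metric.mem_ball_self (x := x₀) hr
  have hx₀S := frontier_subset_closure hx₀
  have h0 : fderiv ℝ ρ x₀ e = 0 := het _ _ _ _ Metric.isOpen_ball hx0 h.patch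
  have hd3 := P.abs_d3_le hr hK hx₀ he h0 h
  have hA := h.A_bound₀ x₀ hx0
  have hob := h.oblique x₀ hx0 hx₀
  rw [← hC₁] at hκ hexp
  have hM'm : -m ≤ M' := by
    have := (abs_le.1 (hd2 x₀ hx₀S)).1
    linarith [hQ0 x₀]
  clear_value M'
  set H := 1 + m with hH
  have hH1 : 1 ≤ H := by linarith
  have hH0 : 0 ≤ H := by linarith
  have hmH : m = H - 1 := by linarith
  clear_value H
  set s := fderiv ℝ ρ x₀ with hs
  have hsn : ‖s‖ ≤ K := h.patch.ρ_bound₁ x₀ hx0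
  set W := testFun b (closure Ω) u 1 1 e 0 x₀ (-κ + (K₁ * H) • s) s (-M') (Q₁ * H)
    (-(K₁ * H * N)) with hW
  have hWx : ∀ y, W y = d2 (closure Ω) u y e e + sqGrad b (closure Ω) u y - M' - κ (y - x₀)
      + K₁ * H * (s (y - x₀) - N * (s (y - x₀)) ^ 2) - Q₁ * H * ‖y - x₀‖ ^ 2 := by
    intro y
    simp only [hW, testFun, add_apply, neg_apply, smul_apply, smul_eq_mul, map_zero]
    ring
  have hball : ∀ y, ‖y - x₀‖ ≤ r' → y ∈ Metric.ball x₀ r := fun y hy =>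
    mem_ball_iff_norm.2 (hy.trans_lt hr'r)
  have hK₁H : 0 ≤ K₁ * H := by positivity
  have hbar : ∀ y, K₁ * H * (s (y - x₀) - N * (s (y - x₀)) ^ 2) ≤ K₁ * H * s (y - x₀) := fun y => by
    have : 0 ≤ N * (s (y - x₀)) ^ 2 := by positivity
    exact mul_le_mul_of_nonneg_left (by linarith) hK₁H
  have hdich := exists_isLocalMax_or_le (W := W) (x₀ := x₀) (r := r') P.regular.isOpen
    (P.regular.continuousOn_testFun b _ _ _ _ _ _ _ _ _ _) (by
      intro y hy hyr
      rw [hWx]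
      have h1 := hexp y hy (hball y hyr)
      have h2 := mul_le_mul_of_nonneg_left (h.patch.linear_le hx₀ (hball y hyr) hy) hK₁H
      have h3 := hbar y
      have h4 := mul_le_mul_of_nonneg_right hQ₁a (show 0 ≤ H * ‖y - x₀‖ ^ 2 by positivity)
      linarith) (by
      intro y hy hyr
      rw [hWx]
      have hyS := subset_closure hy
      have h1 := (abs_le.1 (hd2 y hyS)).2
      have h2 := hQ1 y hyS
      have h3 := hbar y
      have h4 := (abs_le.1 (abs_apply_le κ hκ (hyr.le.trans hr'1))).1
      have h5 := mul_le_mul_of_nonneg_left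
        (abs_le.1 (abs_apply_le s hsn (hyr.le.trans hr'1))).2 hK₁H
      have h6 := mul_le_mul_of_nonneg_right hQ₁b hH0
      have h7 : K ^ 2 ≤ K ^ 2 * H := le_mul_of_one_le_right (by positivity) hH1
      rw [hyr]
      linarith)
  -- At an interior positive maximum y, the good term bounds u_ee(y), and positivity of W bounds M'
  -- by u_ee(y) + |Du|² plus two small corrections. Otherwise W ≤ 0 near x₀ contradicts the bound
  -- for u_Aee.
  rcases hdich with ⟨y, hy, hyr, hmax, hpos⟩ | hneg
  · have hyS := subset_closure hy
    obtain ⟨T', -, hT1, hT2⟩ := P.elliptic.testFun_le hlam P.regular b zero_le_one zero_le_one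
      (mul_nonneg hQ₁0 hH0) hy (P.d1_le y hyS) hmax he
    have hT3 : K₁ * H * N * T' ≤ K₁ * H * N * (K * K ^ 2) := by
      refine mul_le_mul_of_nonneg_left (hT1.trans ?_) (by positivity)
      exact mul_le_mul_of_nonneg_left (pow_le_pow_left₀ (norm_nonneg _) hsn 2) hK0.le
    rw [← hn, ← hH, he, norm_zero] at hT2
    have hnK : 2 * n * K ^ 2 ≤ 2 * n * K ^ 2 * H := le_mul_of_one_le_right (by positivity) hH1
    have hsq : 2 * lam * (d2 (closure Ω) u y e e) ^ 2 ≤ C₃ * H := by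
      rw [hC₃]; linarith
    have hX := le_of_sq_le_mul (by positivity) (half_pos hε) (by linarith) hC₃0 hsq
    rw [hWx] at hpos
    have h1 := hQ1 y hyS
    have h2 : -κ (y - x₀) - Q₁ * H * ‖y - x₀‖ ^ 2 ≤ ε / 4 * H := by
      have a1 := (abs_le.1 (abs_apply_le κ hκ (le_refl ‖y - x₀‖))).1
      have a2 : C₁ * ‖y - x₀‖ - Q₁ * ‖y - x₀‖ ^ 2 ≤ ε / 4 := by
        set t := ‖y - x₀‖
        have b1 : C₁ ^ 2 * t ^ 2 ≤ Q₁ * ε * t ^ 2 := mul_le_mul_of_nonneg_right hQ₁c (sq_nonneg t)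
        have b2 : ε * (C₁ * t - Q₁ * t ^ 2) ≤ ε * (ε / 4) := by
          nlinarith [sq_nonneg (C₁ * t - ε / 2)]
        exact le_of_mul_le_mul_left b2 hε
      have a3 := mul_le_mul_of_nonneg_right a2 hH0
      linarith
    have h3 : K₁ * H * (s (y - x₀) - N * (s (y - x₀)) ^ 2) ≤ ε / 4 * H := by
      set t := s (y - x₀)
      have a1 : K₁ * (t - N * t ^ 2) ≤ ε / 4 := by
        rw [← hNε]
        nlinarith [mul_nonneg hε.le (sq_nonneg (N * t - 1 / 2))]
      have := mul_le_mul_of_nonneg_right a1 hH0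
      linarith
    linarith
  · exfalso
    have hW0 : W x₀ = 0 := by
      rw [hWx, sub_self, map_zero, map_zero, norm_zero]
      linarith
    have hray := h.ray_inequality P.regular hx₀ hr hK hr'0 b hW0 hneg
    simp only [one_mul, map_zero, add_apply, neg_apply, smul_apply, smul_eq_mul] at hray
    have h1 := (abs_le.1 hd3).1
    have h2 := (abs_le.1 (abs_apply_le κ hκ hA)).2
    have h3 : -(2 * n * K ^ 2 * H) ≤ ∑ j, 2 * d1 (closure Ω) u x₀ (b j)
        * d2 (closure Ω) u x₀ (A x₀) (b j) := by
      have a1 : ∀ j, -(2 * K ^ 2 * H) ≤ 2 * d1 (closure Ω) u x₀ (b j)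
          * d2 (closure Ω) u x₀ (A x₀) (b j) := fun j => by
        have c1 := abs_apply_le _ (P.d1_le x₀ hx₀S) (b.orthonormal.1 j).le
        have c2 := abs_apply₂_le _ (P.d2_le x₀ hx₀S) hA (b.orthonormal.1 j).le
        have c3 : |d1 (closure Ω) u x₀ (b j) * d2 (closure Ω) u x₀ (A x₀) (b j)| ≤
            K * 1 * (m * K * 1) := by
          rw [abs_mul]; exact mul_le_mul c1 c2 (abs_nonneg _) (by positivity)
        have c4 := (abs_le.1 c3).1
        have c5 : K ^ 2 * m ≤ K ^ 2 * H := mul_le_mul_of_nonneg_left (by linarith) (by positivity)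
        linarith
      calc -(2 * n * K ^ 2 * H) = ∑ _j : ι, -(2 * K ^ 2 * H) := by
            rw [Finset.sum_const, Finset.card_univ, nsmul_eq_mul, hn]; ring
        _ ≤ _ := Finset.sum_le_sum fun j _ => a1 j
    have h4 : (5 * K ^ 2 + 2 * n * K ^ 2 + C₁ * K + 1) * H ≤ K₁ * H * s (A x₀) := by
      have a1 : 0 ≤ (5 * K ^ 2 + 2 * n * K ^ 2 + C₁ * K + 1) * H := by positivity
      have a2 := mul_le_mul_of_nonneg_left hob a1
      rw [hK₁]
      linarith
    linarith

/-- Second derivatives at the boundary. -/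
theorem exists_boundary_estimate (E : Type*) [NormedAddCommGroup E] [InnerProductSpace ℝ E]
    [FiniteDimensional ℝ E] (ι : Type*) [Fintype ι] {r lam K ε : ℝ} (hr : 0 < r) (hr1 : r ≤ 1)
    (hlam : 0 < lam) (hK : 1 ≤ K) (hε : 0 < ε) :
    ∃ C, 0 ≤ C ∧ ∀ (Ω : Set E) (u : E → ℝ) (b : OrthonormalBasis ι ℝ E) (m : ℝ),
      Problem Ω u b r lam K m → ∀ x ∈ frontier Ω, ∀ ξ, ‖ξ‖ = 1 →
          d2 (closure Ω) u x ξ ξ ≤ ε * (1 + m) + C := by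
  have hK0 : 0 < K := by linarith
  -- In ξ = τ + cA one has |τ|² ≤ 4K⁶ and c² ≤ K⁴, so the two pure terms together cost at most
  -- 8K⁶δ(1+m).
  set δ : ℝ := ε / (8 * K ^ 6) with hδ
  have hδ0 : 0 < δ := by positivity
  obtain ⟨C₁, hC₁, h₁⟩ := exists_tangential_estimate E ι hr hr1 hlam hK hδ0
  obtain ⟨C₂, hC₂, h₂⟩ := exists_normal_estimate E ι hr hr1 hlam hK hδ0
  refine ⟨4 * K ^ 6 * C₁ + K ^ 4 * C₂ + 8 * K ^ 7, by positivity, ?_⟩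
  intro Ω u b m P x hx ξ hξ
  obtain ⟨ρ, π, A, β, h⟩ := P.boundary x hx
  have hm0 := P.m_nonneg
  have hxr := Metric.mem_ball_self (x := x) hr
  have hxS := frontier_subset_closure hx
  have hc := h.abs_obliqueCoeff_le hK hxr hx hξ.le
  have hτ0 := h.fderiv_sub_obliqueCoeff_smul (e := ξ) hK hxr hx
  set c := obliqueCoeff ρ A ξ x
  set τ := ξ - c • A x with hτ
  have hAx := h.A_bound₀ x hxr
  have hτn : ‖τ‖ ≤ 2 * K ^ 3 := by
    have a1 : ‖c • A x‖ ≤ K ^ 2 * K := by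
      rw [norm_smul, Real.norm_eq_abs]
      exact mul_le_mul hc hAx (norm_nonneg _) (by positivity)
    have a2 := norm_sub_le ξ (c • A x)
    have a3 : 1 ≤ K ^ 3 := one_le_pow₀ hK
    linarith
  have k1 := h.d2_tangent P.regular hxr hx hτ0
  have k2 : ξ = τ + c • A x := by rw [hτ]; abel
  have k3 : d2 (closure Ω) u x ξ ξ = d2 (closure Ω) u x τ τ + 2 * c * d2 (closure Ω) u x τ (A x)
      + c ^ 2 * d2 (closure Ω) u x (A x) (A x) := by
    have k4 := P.regular.d2_symm hxS (A x) τ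
    conv_lhs => rw [k2]
    simp only [map_add, add_apply, map_smul, smul_apply, smul_eq_mul, k4]
    ring
  have hδH : 0 ≤ δ * (1 + m) := by positivity
  have b1 : d2 (closure Ω) u x τ τ ≤ (δ * (1 + m) + C₁) * (4 * K ^ 6) := by
    have a1 := d2_self_le_of_unit (fun τ h1 h2 => h₁ Ω u b m P x hx τ h1 h2)
      (h.patch.isTangent P.regular.isOpen Metric.isOpen_ball hxr hx hτ0)
    refine a1.trans (mul_le_mul_of_nonneg_left ?_ (by positivity))
    exact (pow_le_pow_left₀ (norm_nonneg _) hτn 2).trans (le_of_eq (by ring))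
  have b2 : c ^ 2 * d2 (closure Ω) u x (A x) (A x) ≤ K ^ 4 * (δ * (1 + m) + C₂) := by
    have a1 := h₂ Ω u b m P x hx ρ π A β h
    refine (mul_le_mul_of_nonneg_left a1 (sq_nonneg c)).trans ?_
    refine mul_le_mul_of_nonneg_right ?_ (by positivity)
    rw [← sq_abs]
    exact (pow_le_pow_left₀ (abs_nonneg _) hc 2).trans (le_of_eq (by ring))
  have b3 : 2 * c * d2 (closure Ω) u x τ (A x) ≤ 8 * K ^ 7 := by
    have a1 := abs_apply_le _ (P.d1_le x hxS) (norm_apply_le _ (h.A_bound₁ x hxr) hτn)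
    have a2 := abs_apply_le _ (h.β_bound₁ x hxr) hτn
    have a3 : |d2 (closure Ω) u x τ (A x)| ≤ K * (K * (2 * K ^ 3)) + K * (2 * K ^ 3) := by
      rw [k1, abs_neg]
      exact (abs_add_le _ _).trans (add_le_add a1 a2)
    have a4 : |c * d2 (closure Ω) u x τ (A x)| ≤ K ^ 2 * (4 * K ^ 5) := by
      rw [abs_mul]
      refine mul_le_mul hc (a3.trans ?_) (abs_nonneg _) (by positivity)
      have : K ^ 4 ≤ K ^ 5 := pow_le_pow_right₀ hK (by norm_num)
      linarith
    have := (abs_le.1 a4).2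
    linarith
  have b4 : δ * (1 + m) * (4 * K ^ 6) + K ^ 4 * (δ * (1 + m)) ≤ ε * (1 + m) := by
    have a1 : K ^ 4 ≤ K ^ 6 := pow_le_pow_right₀ hK (by norm_num)
    have a2 := mul_le_mul_of_nonneg_right a1 hδH
    have a3 : δ * (8 * K ^ 6) = ε := by rw [hδ]; field_simp
    have a4 : ε * (1 + m) = δ * (1 + m) * (8 * K ^ 6) := by rw [← a3]; ring
    have : 0 ≤ δ * (1 + m) * K ^ 6 := by positivity
    rw [a4]; linarith
  rw [k3]
  linarith

/-- The global estimate for pure second derivatives. -/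
theorem exists_global_estimate (E : Type*) [NormedAddCommGroup E] [InnerProductSpace ℝ E]
    [FiniteDimensional ℝ E] (ι : Type*) [Fintype ι] {r lam K ε : ℝ} (hr : 0 < r) (hr1 : r ≤ 1)
    (hlam : 0 < lam) (hK : 1 ≤ K) (hε : 0 < ε) :
    ∃ C, 0 ≤ C ∧ ∀ (Ω : Set E) (u : E → ℝ) (b : OrthonormalBasis ι ℝ E) (m : ℝ),
      Problem Ω u b r lam K m → ∀ x ∈ closure Ω, ∀ ξ, ‖ξ‖ = 1 →
          d2 (closure Ω) u x ξ ξ ≤ ε * (1 + m) + C := by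
  have hK0 : 0 < K := by linarith
  obtain ⟨C₁, hC₁, h₁⟩ := exists_boundary_estimate E ι hr hr1 hlam hK hε
  set C₃ : ℝ := K + 2 * Fintype.card ι * K ^ 2 with hC₃
  have hC₃0 : 0 ≤ C₃ := by positivity
  refine ⟨C₁ + K ^ 2 + C₃ / (2 * lam * ε), by positivity, ?_⟩
  intro Ω u b m P x₁ hx₁ ξ₁ hξ₁
  have hm0 := P.m_nonneg
  have hQ0 : ∀ y, 0 ≤ sqGrad b (closure Ω) u y := fun y => by
    rw [sqGrad_eq_norm_sq]; positivity
  have hQ1 : ∀ y ∈ closure Ω, sqGrad b (closure Ω) u y ≤ K ^ 2 := fun y hy => by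
    rw [sqGrad_eq_norm_sq]
    exact pow_le_pow_left₀ (norm_nonneg _) (P.d1_le y hy) 2
  have hSc : IsCompact (closure Ω) := P.bounded.isCompact_closure
  have hcont : ContinuousOn (fun y => d2 (closure Ω) u y ξ₁ ξ₁ + sqGrad b (closure Ω) u y)
      (closure Ω) :=
    ((P.regular.c2.continuousOn.clm_apply continuousOn_const).clm_apply continuousOn_const).add
      (P.regular.continuousOn_sqGrad b)
  obtain ⟨x, hx, hmax⟩ := hSc.exists_isMaxOn ⟨x₁, hx₁⟩ hcont
  have h2 : d2 (closure Ω) u x₁ ξ₁ ξ₁ + sqGrad b (closure Ω) u x₁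
    ≤ d2 (closure Ω) u x ξ₁ ξ₁ + sqGrad b (closure Ω) u x := hmax hx₁
  have h3 := hQ0 x₁
  have h4 := hQ1 x hx
  suffices h5 : d2 (closure Ω) u x ξ₁ ξ₁ ≤ ε * (1 + m) + (C₁ + C₃ / (2 * lam * ε)) by linarith
  have h6 : 0 ≤ C₃ / (2 * lam * ε) := by positivity
  by_cases hxΩ : x ∈ Ω
  · have hloc : IsLocalMax (testFun b (closure Ω) u 1 1 ξ₁ 0 x 0 0 0 0 0) x := by
      filter_upwards [P.regular.isOpen.mem_nhds hxΩ] with y hy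
      have : d2 (closure Ω) u y ξ₁ ξ₁ + sqGrad b (closure Ω) u y
        ≤ d2 (closure Ω) u x ξ₁ ξ₁ + sqGrad b (closure Ω) u x := hmax (subset_closure hy)
      simpa [testFun] using this
    obtain ⟨T, -, -, hT⟩ := P.elliptic.testFun_le hlam P.regular b zero_le_one zero_le_one
      le_rfl hxΩ (P.d1_le x hx) hloc hξ₁
    rw [hξ₁, norm_zero] at hT
    have h7 : 2 * Fintype.card ι * K ^ 2 ≤ 2 * Fintype.card ι * K ^ 2 * (1 + m) :=
      le_mul_of_one_le_right (by positivity) (by linarith)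
    have hsq : 2 * lam * (d2 (closure Ω) u x ξ₁ ξ₁) ^ 2 ≤ C₃ * (1 + m) := by
      rw [hC₃]; linarith
    have := le_of_sq_le_mul (by positivity) hε (by linarith) hC₃0 hsq
    linarith
  · have := h₁ Ω u b m P x (by rw [P.regular.isOpen.frontier_eq]; exact ⟨hx, hxΩ⟩) ξ₁ hξ₁
    linarith

end Estimates

/-! ### From one-sided bounds to the full Hessian. -/

section Global

variable {E : Type*} [NormedAddCommGroup E] [InnerProductSpace ℝ E] {ι : Type*} [Fintype ι]

theorem apply_self_le_of_unit {T : E →L[ℝ] E →L[ℝ] ℝ} {Z : ℝ} (hT : ∀ ξ, ‖ξ‖ = 1 → T ξ ξ ≤ Z)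
    (v : E) : T v v ≤ Z * ‖v‖ ^ 2 := by
  by_cases h0 : v = 0
  · simp [h0]
  have hn : 0 < ‖v‖ := norm_pos_iff.2 h0
  have := hT (‖v‖⁻¹ • v) (by rw [norm_smul, norm_inv, norm_norm, inv_mul_cancel₀ hn.ne'])
  simp only [map_smul, smul_apply, smul_eq_mul] at this
  have h2 := mul_le_mul_of_nonneg_right this (sq_nonneg ‖v‖)
  have e1 : ‖v‖⁻¹ * (‖v‖⁻¹ * T v v) * ‖v‖ ^ 2 = T v v := by field_simp
  linarith

/-- A symmetric form with nonnegative trace is controlled by its upper bound. -/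
theorem norm_le_of_apply_self_le (b : OrthonormalBasis ι ℝ E) {T : E →L[ℝ] E →L[ℝ] ℝ}
    (hsymm : ∀ v w, T v w = T w v) {Z : ℝ} (hZ : 0 ≤ Z) (hT : ∀ ξ, ‖ξ‖ = 1 → T ξ ξ ≤ Z)
    (htr : 0 ≤ ∑ i, T (b i) (b i)) :
    ‖T‖ ≤ (Fintype.card ι : ℝ) ^ 2 * ((Fintype.card ι + 2) * Z) := by
  set n : ℝ := (Fintype.card ι : ℝ) with hn
  have hn0 : 0 ≤ n := by positivity
  have hb : ∀ i, ‖b i‖ = 1 := b.orthonormal.1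
  -- The trace is nonnegative and the other diagonal entries are at most Z. Off-diagonal entries
  -- then follow by polarization.
  have hdiag : ∀ i, -(n * Z) ≤ T (b i) (b i) := fun i => by
    classical
    have h1 := Finset.add_sum_erase Finset.univ (fun j => T (b j) (b j)) (Finset.mem_univ i)
    have h2 : ∑ j ∈ Finset.univ.erase i, T (b j) (b j) ≤ ∑ _j ∈ Finset.univ.erase i, Z :=
      Finset.sum_le_sum fun j _ => hT _ (hb j)
    have h3 : ∑ _j ∈ Finset.univ.erase i, Z ≤ ∑ _j : ι, Z :=
      Finset.sum_le_sum_of_subset_of_nonneg (Finset.subset_univ _) fun _ _ _ => hZ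
    have h4 : ∑ _j : ι, Z = n * Z := by rw [Finset.sum_const, Finset.card_univ, nsmul_eq_mul]
    linarith
  have hij : ∀ i j, |T (b i) (b j)| ≤ (n + 2) * Z := fun i j => by
    have h1 := hdiag i
    have h2 := hdiag j
    have h3 : ∀ v : E, ‖v‖ ≤ 2 → T v v ≤ 4 * Z := fun v hv => by
      have h4 := apply_self_le_of_unit hT v
      have h5 : ‖v‖ ^ 2 ≤ 2 ^ 2 := pow_le_pow_left₀ (norm_nonneg _) hv 2
      nlinarith
    have h4 := h3 (b i + b j) ((norm_add_le _ _).trans (by rw [hb, hb]; norm_num))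
    have h5 := h3 (b i - b j) ((norm_sub_le _ _).trans (by rw [hb, hb]; norm_num))
    simp only [map_add, map_sub, add_apply, sub_apply, hsymm (b j) (b i)] at h4 h5
    rw [abs_le]
    constructor <;> linarith
  have hcoord : ∀ (v : E) (i), |b.repr v i| ≤ ‖v‖ := fun v i => by
    rw [b.repr_apply_apply]
    have := abs_real_inner_le_norm (b i) v
    rwa [hb, one_mul] at this
  refine ContinuousLinearMap.opNorm_le_bound₂ _ (by positivity) fun v w => ?_
  have hvw : T v w = ∑ i, ∑ j, b.repr v i * (b.repr w j * T (b i) (b j)) := by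
    conv_lhs => rw [← b.sum_repr v, ← b.sum_repr w]
    simp only [map_sum, map_smul, sum_apply, smul_apply, smul_eq_mul, Finset.mul_sum]
    rw [Finset.sum_comm]
    refine Finset.sum_congr rfl fun i _ => Finset.sum_congr rfl fun j _ => by ring
  rw [hvw, Real.norm_eq_abs]
  refine (Finset.abs_sum_le_sum_abs _ _).trans ?_
  calc ∑ i, |∑ j, b.repr v i * (b.repr w j * T (b i) (b j))|
      ≤ ∑ _i : ι, ∑ _j : ι, ‖v‖ * (‖w‖ * ((n + 2) * Z)) := by
        refine Finset.sum_le_sum fun i _ => (Finset.abs_sum_le_sum_abs _ _).trans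
          (Finset.sum_le_sum fun j _ => ?_)
        rw [abs_mul, abs_mul]
        exact mul_le_mul (hcoord v i) (mul_le_mul (hcoord w j) (hij i j) (abs_nonneg _)
          (norm_nonneg _)) (by positivity) (norm_nonneg _)
    _ = n ^ 2 * ((n + 2) * Z) * ‖v‖ * ‖w‖ := by
        simp only [Finset.sum_const, Finset.card_univ, nsmul_eq_mul, ← hn]; ring

/-- The second derivative bound, when `m` is attained. -/
theorem exists_second_derivative_bound (E : Type*) [NormedAddCommGroup E] [InnerProductSpace ℝ E]
    [FiniteDimensional ℝ E] (ι : Type*) [Fintype ι] {r lam K : ℝ} (hr : 0 < r) (hr1 : r ≤ 1)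
    (hlam : 0 < lam) (hK : 1 ≤ K) :
    ∃ C, 0 ≤ C ∧ ∀ (Ω : Set E) (u : E → ℝ) (b : OrthonormalBasis ι ℝ E) (m : ℝ),
      Problem Ω u b r lam K m → (∃ x ∈ closure Ω, ‖d2 (closure Ω) u x‖ = m) → m ≤ C := by
  set D : ℝ := (Fintype.card ι : ℝ) ^ 2 * (Fintype.card ι + 2) with hD
  have hD0 : 0 ≤ D := by positivity
  -- With Dε ≤ 1/2, the inequality m ≤ Dε(1+m) + DC₁ can be absorbed.
  set ε : ℝ := 1 / (2 * (D + 1)) with hε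
  have hε0 : 0 < ε := by positivity
  have hDε : D * ε ≤ 1 / 2 := by
    rw [hε, mul_one_div, div_le_iff₀ (by positivity)]
    linarith
  obtain ⟨C₁, hC₁, h₁⟩ := exists_global_estimate E ι hr hr1 hlam hK hε0
  refine ⟨1 + 2 * D * C₁, by positivity, ?_⟩
  rintro Ω u b m P ⟨x, hx, hxm⟩
  have hm0 := P.m_nonneg
  have htr : 0 ≤ ∑ i, d2 (closure Ω) u x (b i) (b i) := by
    have hc : ContinuousOn (fun y => ∑ i, d2 (closure Ω) u y (b i) (b i)) (closure Ω) :=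
      continuousOn_finsetSum _ fun i _ =>
        (P.regular.c2.continuousOn.clm_apply continuousOn_const).clm_apply continuousOn_const
    have := hc.image_closure
    have h2 : closure ((fun y => ∑ i, d2 (closure Ω) u y (b i) (b i)) '' Ω) ⊆ Ici 0 :=
      closure_minimal (by rintro _ ⟨y, hy, rfl⟩; exact P.laplace_nonneg y hy) isClosed_Ici
    exact h2 (this ⟨x, hx, rfl⟩)
  have hZ : 0 ≤ ε * (1 + m) + C₁ := by positivity
  have h2 := norm_le_of_apply_self_le b (P.regular.d2_symm hx) hZ
    (fun ξ hξ => h₁ Ω u b m P x hx ξ hξ) htr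
  rw [hxm] at h2
  have h3 : m ≤ D * ε * (1 + m) + D * C₁ := by rw [hD]; linarith
  have h4 := mul_le_mul_of_nonneg_right hDε (show 0 ≤ 1 + m by linarith)
  linarith

end Global

theorem sum_apply_self_eq {E ι κ : Type*} [NormedAddCommGroup E] [InnerProductSpace ℝ E]
    [Fintype ι] [Fintype κ] (b : OrthonormalBasis ι ℝ E) (c : OrthonormalBasis κ ℝ E)
    (T : E →L[ℝ] E →L[ℝ] ℝ) : ∑ i, T (b i) (b i) = ∑ j, T (c j) (c j) := by
  have h1 : ∀ i, T (b i) (b i) = ∑ j, (inner ℝ (c j) (b i) : ℝ) * T (c j) (b i) := fun i => by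
    have := congrArg (fun v => T v (b i)) (c.sum_repr' (b i))
    simpa using this.symm
  have h2 : ∀ j, T (c j) (c j) = ∑ i, (inner ℝ (b i) (c j) : ℝ) * T (c j) (b i) := fun j => by
    have := congrArg (T (c j)) (b.sum_repr' (c j))
    simpa using this.symm
  simp_rw [h1, h2]
  rw [Finset.sum_comm]
  exact Finset.sum_congr rfl fun j _ => Finset.sum_congr rfl fun i _ => by rw [real_inner_comm]

/-! ### The matrix formulation in terms of second derivatives. -/

section Hessian

variable {n : ℕ} {Ω : Set (EuclideanSpace ℝ (Fin n))} {u : EuclideanSpace ℝ (Fin n) → ℝ}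
  {x : EuclideanSpace ℝ (Fin n)}

theorem IsRegular.hessian_apply (h : IsRegular Ω u) (hx : x ∈ closure Ω) (i j : Fin n) :
    hessian Ω u x i j = d2 (closure Ω) u x (EuclideanSpace.single i 1)
      (EuclideanSpace.single j 1) := by
  rw [hessian, Matrix.of_apply, iteratedFDerivWithin_two_apply u h.uniqueDiffOn hx]
  rfl

theorem IsRegular.hessian_isHermitian (h : IsRegular Ω u) (hx : x ∈ closure Ω) :
    (hessian Ω u x).IsHermitian := by
  ext i j
  rw [Matrix.conjTranspose_apply, h.hessian_apply hx, h.hessian_apply hx, h.d2_symm hx]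
  rfl

theorem IsRegular.augmentedHessian_isHermitian (h : IsRegular Ω u) (hx : x ∈ closure Ω) (γ : ℝ) :
    (augmentedHessian Ω γ u x).IsHermitian := by
  refine Matrix.IsHermitian.sub ?_ (h.hessian_isHermitian hx)
  ext i j
  simp [Matrix.one_apply, eq_comm]

theorem IsRegular.trace_hessian (h : IsRegular Ω u) (hx : x ∈ closure Ω)
    (b : OrthonormalBasis (Fin n) ℝ (EuclideanSpace ℝ (Fin n))) :
    (hessian Ω u x).trace = ∑ i, d2 (closure Ω) u x (b i) (b i) := by
  rw [sum_apply_self_eq b (EuclideanSpace.basisFun (Fin n) ℝ)]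
  refine Finset.sum_congr rfl fun i _ => ?_
  rw [Matrix.diag_apply, h.hessian_apply hx]
  simp

theorem IsRegular.quadForm_hessian (h : IsRegular Ω u) (hx : x ∈ closure Ω)
    (v : EuclideanSpace ℝ (Fin n)) :
    quadForm (hessian Ω u x) v = d2 (closure Ω) u x v v := by
  have hv := (EuclideanSpace.basisFun (Fin n) ℝ).sum_repr v
  conv_rhs => rw [← hv]
  simp only [map_sum, map_smul, sum_apply, smul_apply, smul_eq_mul,
    EuclideanSpace.basisFun_repr, EuclideanSpace.basisFun_apply, quadForm, dotProduct,
    Matrix.mulVec, Finset.mul_sum, h.hessian_apply hx]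
  rw [Finset.sum_comm]
  refine Finset.sum_congr rfl fun i _ => Finset.sum_congr rfl fun j _ => by ring

theorem IsRegular.quadForm_augmentedHessian (h : IsRegular Ω u) (hx : x ∈ closure Ω) (γ : ℝ)
    {v : EuclideanSpace ℝ (Fin n)} (hv : ‖v‖ = 1) :
    quadForm (augmentedHessian Ω γ u x) v
      = γ * (hessian Ω u x).trace - d2 (closure Ω) u x v v := by
  have h1 : v.ofLp ⬝ᵥ v.ofLp = 1 := by
    have := EuclideanSpace.real_norm_sq_eq v
    rw [hv, one_pow] at this
    rw [dotProduct, this]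
    exact Finset.sum_congr rfl fun i _ => by ring
  rw [← h.quadForm_hessian hx, quadForm, augmentedHessian, Matrix.sub_mulVec, dotProduct_sub,
    Matrix.smul_mulVec, Matrix.one_mulVec, dotProduct_smul, h1, smul_eq_mul, mul_one, quadForm]

/-- The case i = 1 of admissibility is (γn - 1)Δu > 0. -/
theorem laplace_pos {k : ℕ} {γ : ℝ} (hk : 1 ≤ k) (hkn : k ≤ n) (hγ : 1 ≤ γ)
    (hkγ : k < n ∨ 1 < γ) (h : IsRegular Ω u) (hadm : IsAdmissible Ω γ k u) (hx : x ∈ Ω) :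
    0 < (hessian Ω u x).trace := by
  have h1 := hadm x hx 1 le_rfl hk
  have hH := h.augmentedHessian_isHermitian (subset_closure hx) γ
  rw [sigma_eq_esym 1 hH, esym_one] at h1
  have h2 := hH.trace_eq_sum_eigenvalues
  simp only [RCLike.ofReal_real_eq_id, id] at h2
  rw [← h2, augmentedHessian, Matrix.trace_sub, Matrix.trace_smul, Matrix.trace_one,
    Fintype.card_fin, smul_eq_mul] at h1
  have h3 : 0 < γ * n - 1 := by
    rcases hkγ with hlt | hlt
    · have : (2 : ℝ) ≤ n := by exact_mod_cast (by omega : 2 ≤ n)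
      nlinarith
    · have : (1 : ℝ) ≤ n := by exact_mod_cast (by omega : 1 ≤ n)
      nlinarith
  have h4 : 0 < (γ * n - 1) * (hessian Ω u x).trace := by linarith
  exact (pos_iff_pos_of_mul_pos h4).1 h3

end Hessian

/-! ### Uniform ellipticity of the differentiated equation. -/

section Nonlinearity

variable {n : ℕ} {Ω : Set (EuclideanSpace ℝ (Fin n))} {u : EuclideanSpace ℝ (Fin n) → ℝ}
  {x : EuclideanSpace ℝ (Fin n)} {φ : EuclideanSpace ℝ (Fin n) × ℝ → ℝ} {M Kf m : ℝ}

/-- The right-hand side `x ↦ φ(x, u(x))` is `C^{1,1}`, with constants depending on `D²u`. -/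
theorem IsRegular.exists_quadratic_remainder (h : IsRegular Ω u) (hφ : IsC11 Ω φ)
    (hφK : C11NormLE Ω M φ Kf) (hu : ∀ y ∈ closure Ω, |u y| ≤ M) (hM : 0 ≤ M)
    (hd1 : ∀ y ∈ closure Ω, ‖d1 (closure Ω) u y‖ ≤ M)
    (hd2 : ∀ y ∈ closure Ω, ‖d2 (closure Ω) u y‖ ≤ m) (hx : x ∈ Ω) :
    ∃ L : EuclideanSpace ℝ (Fin n) →L[ℝ] ℝ, ‖L‖ ≤ Kf * (1 + M) ∧
      ∀ᶠ y in 𝓝 x, |φ (y, u y) - φ (x, u x) - L (y - x)|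
        ≤ Kf * (1 + M) ^ 2 * (1 + m) * ‖y - x‖ ^ 2 := by
  set S := closure Ω with hS
  set Φ := fderivWithin ℝ φ (S ×ˢ univ) with hΦ
  let L : EuclideanSpace ℝ (Fin n) → EuclideanSpace ℝ (Fin n) →L[ℝ] ℝ := fun y =>
    (Φ (y, u y)).comp ((ContinuousLinearMap.id ℝ _).prod (d1 S u y))
  have hmem : ∀ y ∈ S, (y, u y) ∈ S ×ˢ Icc (-M) M := fun y hy =>
    ⟨hy, abs_le.1 (hu y hy)⟩
  have hm0 : 0 ≤ m := (norm_nonneg _).trans (hd2 x (subset_closure hx))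
  have hKf : 0 ≤ Kf := (abs_nonneg _).trans (hφK.1 _ (hmem x (subset_closure hx))).1
  have hprod : ∀ y ∈ S, ‖(ContinuousLinearMap.id ℝ (EuclideanSpace ℝ (Fin n))).prod (d1 S u y)‖
      ≤ 1 + M := fun y hy => by
    rw [ContinuousLinearMap.opNorm_prod]
    exact max_le (ContinuousLinearMap.norm_id_le.trans (by linarith))
      ((hd1 y hy).trans (by linarith))
  have hL : ∀ y ∈ S, ‖L y‖ ≤ Kf * (1 + M) := fun y hy =>
    (ContinuousLinearMap.opNorm_comp_le _ _).trans
      (mul_le_mul (hφK.1 _ (hmem y hy)).2 (hprod y hy) (norm_nonneg _) hKf)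
  refine ⟨L x, hL x (subset_closure hx), ?_⟩
  have hder : ∀ y ∈ Ω, HasFDerivAt (fun z => φ (z, u z)) (L y) y := fun y hy => by
    have hyS := subset_closure hy
    have k1 : S ×ˢ (univ : Set ℝ) ∈ 𝓝 (y, u y) := prod_mem_nhds (h.mem_nhds hy) univ_mem
    have k2 : HasFDerivAt φ (Φ (y, u y)) (y, u y) :=
      ((hφ.1.differentiableOn (by norm_num)) _ ⟨hyS, mem_univ _⟩).hasFDerivWithinAt.hasFDerivAt k1
    exact k2.comp y ((hasFDerivAt_id y).prodMk (h.hasFDerivAt_u hy))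
  obtain ⟨ε, hε, hball⟩ := Metric.isOpen_iff.1 h.isOpen x hx
  have hballS : ∀ y ∈ Metric.ball x ε, y ∈ S := fun y hy => subset_closure (hball hy)
  have hxS := subset_closure hx
  have hLip : ∀ y ∈ Metric.ball x ε, ‖L y - L x‖ ≤ Kf * (1 + M) ^ 2 * (1 + m) * ‖y - x‖ := by
    intro y hy
    have hyS := hballS y hy
    have a1 : ‖u y - u x‖ ≤ M * ‖y - x‖ := norm_sub_le_of_fderiv_le
      (fun z hz => (h.hasFDerivAt_u (hball hz)).differentiableAt)
      (fun z hz => by rw [(h.hasFDerivAt_u (hball hz)).fderiv]; exact hd1 z (hballS z hz)) hy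
    have a2 : ‖d1 S u y - d1 S u x‖ ≤ m * ‖y - x‖ := norm_sub_le_of_fderiv_le
      (fun z hz => (h.hasFDerivAt_d1 (hball hz)).differentiableAt)
      (fun z hz => by rw [(h.hasFDerivAt_d1 (hball hz)).fderiv]; exact hd2 z (hballS z hz)) hy
    have a3 : ‖(y, u y) - (x, u x)‖ ≤ (1 + M) * ‖y - x‖ := by
      rw [Prod.mk_sub_mk, Prod.norm_mk]
      have : 0 ≤ M * ‖y - x‖ := by positivity
      exact max_le (by linarith) (a1.trans (by linarith [norm_nonneg (y - x)]))
    have a4 : ‖Φ (y, u y) - Φ (x, u x)‖ ≤ Kf * ((1 + M) * ‖y - x‖) :=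
      (hφK.2 _ (hmem y hyS) _ (hmem x hxS)).trans (mul_le_mul_of_nonneg_left a3 hKf)
    -- Product rule: the first part uses the Lipschitz bound of Dφ, the second is φ_z times the
    -- increment of Du and is the only source of the factor m.
    have a5 : L y - L x = (Φ (y, u y) - Φ (x, u x)).comp
        ((ContinuousLinearMap.id ℝ _).prod (d1 S u y))
        + (Φ (x, u x)).comp ((ContinuousLinearMap.inr ℝ (EuclideanSpace ℝ (Fin n)) ℝ).comp
          (d1 S u y - d1 S u x)) := by
      ext v
      have : Φ (x, u x) (v, d1 S u y v) - Φ (x, u x) (v, d1 S u x v)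
          = Φ (x, u x) (0, d1 S u y v - d1 S u x v) := by
        rw [← map_sub, Prod.mk_sub_mk, sub_self]
      simp only [L, sub_apply, add_apply, ContinuousLinearMap.comp_apply,
        ContinuousLinearMap.prod_apply, ContinuousLinearMap.inr_apply, ContinuousLinearMap.id_apply]
      linarith
    have a6 : ‖(ContinuousLinearMap.inr ℝ (EuclideanSpace ℝ (Fin n)) ℝ).comp
        (d1 S u y - d1 S u x)‖ ≤ m * ‖y - x‖ := by
      refine ContinuousLinearMap.opNorm_le_bound _ (by positivity) fun v => ?_
      have : ‖(d1 S u y - d1 S u x) v‖ ≤ m * ‖y - x‖ * ‖v‖ := norm_apply_le _ a2 le_rfl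
      simpa [Prod.norm_mk] using this
    rw [a5]
    refine (norm_add_le _ _).trans ?_
    have b1 := (ContinuousLinearMap.opNorm_comp_le (Φ (y, u y) - Φ (x, u x))
        ((ContinuousLinearMap.id ℝ _).prod (d1 S u y))).trans
      (mul_le_mul a4 (hprod y hyS) (norm_nonneg _) (by positivity))
    have b2 := (ContinuousLinearMap.opNorm_comp_le (Φ (x, u x))
        ((ContinuousLinearMap.inr ℝ (EuclideanSpace ℝ (Fin n)) ℝ).comp
          (d1 S u y - d1 S u x))).trans
      (mul_le_mul (hφK.1 _ (hmem x hxS)).2 a6 (norm_nonneg _) hKf)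
    have b3 : Kf * (m * ‖y - x‖) ≤ Kf * (1 + M) ^ 2 * m * ‖y - x‖ := by
      have : 1 ≤ (1 + M) ^ 2 := one_le_pow₀ (by linarith)
      have := mul_le_mul_of_nonneg_right this (show 0 ≤ Kf * (m * ‖y - x‖) by positivity)
      linarith
    linarith
  filter_upwards [Metric.ball_mem_nhds x hε] with y hy
  have hsub : Metric.closedBall x ‖y - x‖ ⊆ Metric.ball x ε :=
    Metric.closedBall_subset_ball (mem_ball_iff_norm.1 hy)
  have hmv := (convex_closedBall x ‖y - x‖).norm_image_sub_le_of_norm_hasFDerivWithin_le'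
    (f := fun z => φ (z, u z)) (f' := L) (φ := L x)
    (C := Kf * (1 + M) ^ 2 * (1 + m) * ‖y - x‖)
    (fun z hz => (hder z (hball (hsub hz))).hasFDerivWithinAt)
    (fun z hz => (hLip z (hsub hz)).trans (by
      have := mem_closedBall_iff_norm.1 hz
      gcongr))
    (Metric.mem_closedBall_self (norm_nonneg _)) (mem_closedBall_iff_norm.2 le_rfl)
  rw [Real.norm_eq_abs] at hmv
  exact hmv.trans (le_of_eq (by ring))

/-- The differentiated equation. -/
theorem exists_isElliptic (n k l : ℕ) (hlk : l < k) (hkn : k ≤ n) (γ : ℝ) (hγ : 1 ≤ γ)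
    (hkγ : k < n ∨ 1 < γ) (M Kf : ℝ) (hM : 0 ≤ M) :
    ∃ lam K₀ : ℝ, 0 < lam ∧ ∀ K, K₀ ≤ K → ∀ (Ω : Set (EuclideanSpace ℝ (Fin n)))
      (f : EuclideanSpace ℝ (Fin n) × ℝ → ℝ) (u : EuclideanSpace ℝ (Fin n) → ℝ) (m : ℝ),
      IsRegular Ω u → IsC11 Ω (fun y => f y ^ (1 / ((k : ℝ) - (l : ℝ)))) →
      C11NormLE Ω M (fun y => f y ^ (1 / ((k : ℝ) - (l : ℝ)))) Kf →
      IsAdmissible Ω γ k u →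
      (∀ x ∈ Ω, sigma k (augmentedHessian Ω γ u x) / sigma l (augmentedHessian Ω γ u x)
        = f (x, u x)) →
      (∀ x ∈ closure Ω, |u x| ≤ M) → (∀ x ∈ closure Ω, ‖d1 (closure Ω) u x‖ ≤ M) →
      (∀ x ∈ closure Ω, ‖d2 (closure Ω) u x‖ ≤ m) →
      IsElliptic (Fin n) Ω u lam K (1 + m) := by
  obtain ⟨c₀, lam, hc₀, hlam, hsupp⟩ := exists_elliptic_support n k l hlk hkn γ hγ hkγ
  refine ⟨lam, γ + 2 * |Kf| * (1 + M) ^ 2 / c₀, hlam, ?_⟩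
  intro K hK Ω f u m h hφ hφK hadm heq hu hd1 hd2 x hx
  have hxS := subset_closure hx
  have hm0 : 0 ≤ m := (norm_nonneg _).trans (hd2 x hxS)
  have hherm := fun y (hy : y ∈ Ω) => h.augmentedHessian_isHermitian (subset_closure hy) γ
  obtain ⟨b, p, hp0, hpc, hpl, hpx, hpy⟩ := hsupp _ (hherm x hx) (hadm x hx)
  obtain ⟨L, hL, hrem⟩ := h.exists_quadratic_remainder hφ hφK hu hM hd1 hd2 hx
  -- Dividing by s gives coefficients γ - p_i/s in [lam, γ], and s ≥ c₀ bounds the factor 1/s on the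
  -- right-hand side. No lower bound of f is needed.
  set s := ∑ i, p i with hs
  have hs0 : 0 < s := hc₀.trans_le hpc
  have hKf : 0 ≤ Kf := (abs_nonneg _).trans (hφK.1 (x, u x) ⟨hxS, abs_le.1 (hu x hxS)⟩).1
  rw [abs_of_nonneg hKf] at hK
  have hquad : ∀ y ∈ Ω, ∑ i, p i * quadForm (augmentedHessian Ω γ u y) (b i)
      = s * ∑ i, ((γ * s - p i) / s) * d2 (closure Ω) u y (b i) (b i) := fun y hy => by
    have h1 : ∀ i, p i * quadForm (augmentedHessian Ω γ u y) (b i)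
        = p i * (γ * (hessian Ω u y).trace) - p i * d2 (closure Ω) u y (b i) (b i) := fun i => by
      rw [h.quadForm_augmentedHessian (subset_closure hy) γ (b.orthonormal.1 i)]; ring
    simp_rw [h1]
    rw [Finset.sum_sub_distrib, ← Finset.sum_mul, ← hs, h.trace_hessian (subset_closure hy) b,
      Finset.mul_sum, Finset.mul_sum, Finset.mul_sum, ← Finset.sum_sub_distrib]
    refine Finset.sum_congr rfl fun i _ => ?_
    field_simp
  have hθ : 0 ≤ 1 / s := by positivity
  have hθc : 1 / s ≤ 1 / c₀ := one_div_le_one_div_of_le hc₀ hpc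
  have hrpow : ∀ y ∈ Ω, (sigma k (augmentedHessian Ω γ u y) / sigma l (augmentedHessian Ω γ u y))
      ^ (1 / ((k : ℝ) - (l : ℝ))) = f (y, u y) ^ (1 / ((k : ℝ) - (l : ℝ))) := fun y hy => by
    rw [heq y hy]
  have key := fun e => h.differentiate_equation hx b (fun i => (γ * s - p i) / s) hθ
    (g := fun y => f (y, u y) ^ (1 / ((k : ℝ) - (l : ℝ)))) hrem
    (fun y hy => by
      have := hpy _ (hherm y hy) (hadm y hy)
      rw [hrpow y hy, hquad y hy] at this
      rw [one_div_mul_eq_div, div_le_iff₀ hs0]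
      linarith)
    (by
      rw [hrpow x hx, hquad x hx] at hpx
      rw [hpx, one_div_mul_eq_div, mul_div_cancel_left₀ _ hs0.ne']) e
  have hM1 : 1 + M ≤ (1 + M) ^ 2 := le_self_pow₀ (by linarith) (by norm_num)
  refine ⟨b, fun i => (γ * s - p i) / s, (1 / s) • L, fun i => ⟨?_, ?_⟩, ?_, fun e => (key e).1,
    fun e => ?_⟩
  · rw [le_div_iff₀ hs0]; exact hpl i
  · rw [div_le_iff₀ hs0]
    have : 0 ≤ 2 * Kf * (1 + M) ^ 2 / c₀ := by positivity
    have h2 : γ ≤ K := by linarith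
    have := mul_le_mul_of_nonneg_right h2 hs0.le
    linarith [hp0 i]
  · rw [norm_smul, Real.norm_of_nonneg hθ]
    have h1 : 1 / s * ‖L‖ ≤ 1 / c₀ * (Kf * (1 + M) ^ 2) :=
      mul_le_mul hθc (hL.trans (mul_le_mul_of_nonneg_left hM1 hKf)) (norm_nonneg _) (by positivity)
    have h2 : 1 / c₀ * (Kf * (1 + M) ^ 2) = Kf * (1 + M) ^ 2 / c₀ := by ring
    have h3 : 2 * Kf * (1 + M) ^ 2 / c₀ = 2 * (Kf * (1 + M) ^ 2 / c₀) := by ring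
    have h4 : 0 ≤ Kf * (1 + M) ^ 2 / c₀ := by positivity
    linarith
  · refine le_trans ?_ (key e).2
    have h1 : 2 * (1 / s) * (Kf * (1 + M) ^ 2 * (1 + m)) ≤ K * (1 + m) := by
      have h2 : 2 * (1 / s) * (Kf * (1 + M) ^ 2) ≤ K := by
        have := mul_le_mul_of_nonneg_right hθc (show 0 ≤ 2 * Kf * (1 + M) ^ 2 by positivity)
        have h3 : 1 / c₀ * (2 * Kf * (1 + M) ^ 2) = 2 * Kf * (1 + M) ^ 2 / c₀ := by ring
        linarith
      have := mul_le_mul_of_nonneg_right h2 (show 0 ≤ 1 + m by linarith)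
      linarith
    have := mul_le_mul_of_nonneg_right h1 (sq_nonneg ‖e‖)
    linarith

end Nonlinearity

/-! ### Second-order chain rule bounds. -/

section ChainRule

variable {E F G : Type*} [NormedAddCommGroup E] [NormedSpace ℝ E] [NormedAddCommGroup F]
  [NormedSpace ℝ F] [NormedAddCommGroup G] [NormedSpace ℝ G] {x : E}

/-- The outer derivative enters as a function of the base point, so the bound also covers u ∘ π,
where u is differentiable only within the closure of Ω. -/
theorem norm_fderiv_fderiv_comp_le {f' : E → E →L[ℝ] F} {f'' : E →L[ℝ] E →L[ℝ] F}
    {g' : E → F →L[ℝ] G} {g'' : F →L[ℝ] F →L[ℝ] G} {ψ : E → G} (hf' : HasFDerivAt f' f'' x)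
    (hψ : ∀ᶠ y in 𝓝 x, HasFDerivAt ψ ((g' y).comp (f' y)) y)
    (hg' : HasFDerivAt g' (g''.comp (f' x)) x) :
    ‖fderiv ℝ (fderiv ℝ ψ) x‖ ≤ ‖g''‖ * ‖f' x‖ ^ 2 + ‖g' x‖ * ‖f''‖ := by
  have h1 : fderiv ℝ ψ =ᶠ[𝓝 x] fun y => (g' y).comp (f' y) := by
    filter_upwards [hψ] with y hy using hy.fderiv
  rw [h1.fderiv_eq, (hg'.clm_comp hf').fderiv]
  refine ContinuousLinearMap.opNorm_le_bound _ (by positivity) fun v => ?_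
  have e1 : ((ContinuousLinearMap.compL ℝ E F G (g' x)).comp f''
      + ((ContinuousLinearMap.compL ℝ E F G).flip (f' x)).comp (g''.comp (f' x))) v
      = (g' x).comp (f'' v) + (g'' (f' x v)).comp (f' x) := rfl
  rw [e1]
  have a1 := (ContinuousLinearMap.opNorm_comp_le (g' x) (f'' v)).trans
    (mul_le_mul_of_nonneg_left (f''.le_opNorm v) (norm_nonneg _))
  have a2 := (ContinuousLinearMap.opNorm_comp_le (g'' (f' x v)) (f' x)).trans
    (mul_le_mul_of_nonneg_right (norm_apply_le g'' le_rfl ((f' x).le_opNorm v)) (norm_nonneg _))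
  refine (norm_add_le _ _).trans ?_
  linarith

/-- Bounds for the first two derivatives of a `C²` map at a point. -/
structure HasC2Bound (f : E → F) (x : E) (a b : ℝ) : Prop where
  contDiffAt : ContDiffAt ℝ 2 f x
  fderiv_le : ‖fderiv ℝ f x‖ ≤ a
  fderiv_fderiv_le : ‖fderiv ℝ (fderiv ℝ f) x‖ ≤ b

theorem _root_.ContDiffAt.hasFDerivAt_fderiv {f : E → F} (hf : ContDiffAt ℝ 2 f x) :
    HasFDerivAt (fderiv ℝ f) (fderiv ℝ (fderiv ℝ f) x) x :=
  ((hf.fderiv_right (m := 1) (by norm_num)).differentiableAt (by norm_num)).hasFDerivAt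

theorem _root_.ContDiffAt.eventually_hasFDerivAt {f : E → F} (hf : ContDiffAt ℝ 2 f x) :
    ∀ᶠ y in 𝓝 x, HasFDerivAt f (fderiv ℝ f y) y := by
  filter_upwards [hf.eventually (by norm_num)] with y hy
  exact (hy.differentiableAt (by norm_num)).hasFDerivAt

namespace HasC2Bound

variable {f g : E → F} {a b a' b' : ℝ}

theorem mono (h : HasC2Bound f x a b) (ha : a ≤ a') (hb : b ≤ b') : HasC2Bound f x a' b' :=
  ⟨h.1, h.2.trans ha, h.3.trans hb⟩

theorem const (c : F) : HasC2Bound (fun _ : E => c) x 0 0 := by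
  refine ⟨contDiffAt_const, by simp, ?_⟩
  have : fderiv ℝ (fun _ : E => c) = fun _ => 0 := by ext; simp
  simp [this]

theorem comp (h : HasC2Bound f x a b) {φ : F → G} (hφ : ContDiff ℝ 2 φ) {c d : ℝ}
    (hc : ‖fderiv ℝ φ (f x)‖ ≤ c) (hd : ‖fderiv ℝ (fderiv ℝ φ) (f x)‖ ≤ d) :
    HasC2Bound (fun y => φ (f y)) x (c * a) (d * a ^ 2 + c * b) := by
  have hc0 := (norm_nonneg _).trans hc
  have hd0 := (norm_nonneg _).trans hd
  have hψ : ∀ᶠ y in 𝓝 x, HasFDerivAt (fun y => φ (f y))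
      ((fderiv ℝ φ (f y)).comp (fderiv ℝ f y)) y := by
    filter_upwards [h.contDiffAt.eventually_hasFDerivAt] with y hy
    exact (hφ.differentiable (by norm_num) (f y)).hasFDerivAt.comp y hy
  refine ⟨hφ.contDiffAt.comp x h.contDiffAt, ?_, ?_⟩
  · rw [hψ.self_of_nhds.fderiv]
    exact (ContinuousLinearMap.opNorm_comp_le _ _).trans
      (mul_le_mul hc h.fderiv_le (norm_nonneg _) hc0)
  · refine (norm_fderiv_fderiv_comp_le h.contDiffAt.hasFDerivAt_fderiv hψ
      (hφ.contDiffAt.hasFDerivAt_fderiv.comp x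
        h.contDiffAt.eventually_hasFDerivAt.self_of_nhds)).trans ?_
    exact add_le_add (mul_le_mul hd (pow_le_pow_left₀ (norm_nonneg _) h.fderiv_le 2)
      (by positivity) hd0) (mul_le_mul hc h.fderiv_fderiv_le (norm_nonneg _) hc0)

theorem clm_comp (h : HasC2Bound f x a b) (L : F →L[ℝ] G) {c : ℝ} (hc : ‖L‖ ≤ c) :
    HasC2Bound (fun y => L (f y)) x (c * a) (c * b) := by
  have h1 : fderiv ℝ L = fun _ => L := funext fun _ => L.fderiv
  have h2 : fderiv ℝ (fderiv ℝ L) (f x) = 0 := by rw [h1]; simp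
  have := h.comp L.contDiff (c := c) (d := 0) (by rw [L.fderiv]; exact hc) (by rw [h2, norm_zero])
  simpa using this

theorem add (hf : HasC2Bound f x a b) (hg : HasC2Bound g x a' b') :
    HasC2Bound (fun y => f y + g y) x (a + a') (b + b') := by
  have h1 : fderiv ℝ (fun y => f y + g y) =ᶠ[𝓝 x] fun y => fderiv ℝ f y + fderiv ℝ g y := by
    filter_upwards [hf.contDiffAt.eventually_hasFDerivAt, hg.contDiffAt.eventually_hasFDerivAt]
      with y hy1 hy2
    exact (hy1.add hy2).fderiv
  refine ⟨hf.contDiffAt.add hg.contDiffAt, ?_, ?_⟩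
  · rw [h1.self_of_nhds]
    exact (norm_add_le _ _).trans (add_le_add hf.fderiv_le hg.fderiv_le)
  · rw [h1.fderiv_eq, (hf.contDiffAt.hasFDerivAt_fderiv.fun_add
      hg.contDiffAt.hasFDerivAt_fderiv).fderiv]
    exact (norm_add_le _ _).trans (add_le_add hf.fderiv_fderiv_le hg.fderiv_fderiv_le)

theorem sum {ι : Type*} (s : Finset ι) {f : ι → E → F} (h : ∀ i ∈ s, HasC2Bound (f i) x a b) :
    HasC2Bound (fun y => ∑ i ∈ s, f i y) x (s.card * a) (s.card * b) := by
  classical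
  induction s using Finset.induction_on with
  | empty => simpa using const (x := x) (0 : F)
  | insert i s hi ih =>
    have := (h i (Finset.mem_insert_self i s)).add
      (ih fun j hj => h j (Finset.mem_insert_of_mem hj))
    simp only [Finset.sum_insert hi, Finset.card_insert_of_notMem hi]
    push_cast
    exact this.mono (le_of_eq (by ring)) (le_of_eq (by ring))

end HasC2Bound

theorem norm_fderiv_fderiv_eq (f : E → F) (x : E) :
    ‖fderiv ℝ (fderiv ℝ f) x‖ = ‖iteratedFDeriv ℝ 2 f x‖ := by
  rw [← norm_iteratedFDeriv_fderiv, ← norm_iteratedFDeriv_fderiv, norm_iteratedFDeriv_zero]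

theorem norm_fderiv_eq (f : E → F) (x : E) : ‖fderiv ℝ f x‖ = ‖iteratedFDeriv ℝ 1 f x‖ := by
  rw [← norm_iteratedFDeriv_fderiv, norm_iteratedFDeriv_zero]

theorem eq_add_fderiv_of_iteratedFDeriv_two_eq_zero {g : E → F} (hg : ContDiff ℝ 2 g)
    (h : ∀ p, iteratedFDeriv ℝ 2 g p = 0) (p : E) : g p = g 0 + fderiv ℝ g 0 p := by
  have h1 : ∀ p, fderiv ℝ (fderiv ℝ g) p = 0 := fun p => by
    rw [← norm_eq_zero, norm_fderiv_fderiv_eq, h, norm_zero]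
  have h2 : ∀ p, fderiv ℝ g p = fderiv ℝ g 0 := fun p =>
    is_const_of_fderiv_eq_zero ((hg.fderiv_right (m := 1) (by norm_num)).differentiable
      (by norm_num)) h1 p 0
  have hd := hg.differentiable (by norm_num)
  have h3 : ∀ q, HasFDerivAt (fun q => g q - fderiv ℝ g 0 q) (0 : E →L[ℝ] F) q := fun q =>
    ((hd q).hasFDerivAt.sub (fderiv ℝ g 0).hasFDerivAt).congr_fderiv (by rw [h2 q, sub_self])
  have h4 := is_const_of_fderiv_eq_zero (fun q => (h3 q).differentiableAt)
    (fun q => (h3 q).fderiv) p 0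
  simp only [map_zero, sub_zero] at h4
  rw [← h4, sub_add_cancel]

end ChainRule

/-! ### Construction of the extended oblique boundary condition. -/

section BoundaryData

theorem IsRegular.hasC2Bound_comp {E : Type*} [NormedAddCommGroup E] [NormedSpace ℝ E]
    {Ω V : Set E} {u : E → ℝ} {x : E} {P M m : ℝ} {ρ : E → ℝ} {π : E → E}
    (h : IsRegular Ω u) (hp : Patch Ω V P ρ π) (hV : IsOpen V) (hx : x ∈ V)
    (hd1 : ∀ y ∈ closure Ω, ‖d1 (closure Ω) u y‖ ≤ M)
    (hd2 : ∀ y ∈ closure Ω, ‖d2 (closure Ω) u y‖ ≤ m) :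
    HasC2Bound (fun y => u (π y)) x (M * P) (m * P ^ 2 + M * P) := by
  have hmaps : MapsTo π V (closure Ω) := fun y hy => frontier_subset_closure (hp.π_mem y hy)
  have hπ : ∀ y ∈ V, HasFDerivAt π (fderiv ℝ π y) y := fun y hy =>
    ((hp.π_contDiffAt y hy).differentiableAt (by norm_num)).hasFDerivAt
  have hM := (norm_nonneg _).trans (hd1 _ (hmaps hx))
  have hm := (norm_nonneg _).trans (hd2 _ (hmaps hx))
  have hψ : ∀ y ∈ V, HasFDerivAt (fun y => u (π y))
      ((d1 (closure Ω) u (π y)).comp (fderiv ℝ π y)) y := fun y hy =>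
    HasFDerivWithinAt.comp_of_mapsTo (h.hasFDerivWithinAt_u (hmaps hy)) (hπ y hy)
      (hV.mem_nhds hy) hmaps
  refine ⟨?_, ?_, ?_⟩
  · have : ContDiffOn ℝ 2 (fun y => u (π y)) V :=
      (h.contDiffOn.of_le (by norm_num)).comp
        (fun y hy => ((hp.π_contDiffAt y hy).of_le (by norm_num)).contDiffWithinAt) hmaps
    exact this.contDiffAt (hV.mem_nhds hx)
  · rw [(hψ x hx).fderiv]
    exact (ContinuousLinearMap.opNorm_comp_le _ _).trans
      (mul_le_mul (hd1 _ (hmaps hx)) (hp.π_bound₁ x hx) (norm_nonneg _) hM)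
  · refine (norm_fderiv_fderiv_comp_le (f' := fderiv ℝ π) (g' := fun y => d1 (closure Ω) u (π y))
      ((hp.π_contDiffAt x hx).of_le (by norm_num : (2 : WithTop ℕ∞) ≤ _)).hasFDerivAt_fderiv
      (by filter_upwards [hV.mem_nhds hx] with y hy using hψ y hy)
      (HasFDerivWithinAt.comp_of_mapsTo (h.hasFDerivWithinAt_d1 (hmaps hx)) (hπ x hx)
        (hV.mem_nhds hx) hmaps)).trans ?_
    exact add_le_add (mul_le_mul (hd2 _ (hmaps hx)) (pow_le_pow_left₀ (norm_nonneg _)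
      (hp.π_bound₁ x hx) 2) (by positivity) hm)
      (mul_le_mul (hd1 _ (hmaps hx)) (hp.π_bound₂ x hx) (norm_nonneg _) hM)

variable {n : ℕ} {Ω V : Set (EuclideanSpace ℝ (Fin n))} {u : EuclideanSpace ℝ (Fin n) → ℝ}
  {x : EuclideanSpace ℝ (Fin n)} {P M m KG : ℝ}
  {H : EuclideanSpace ℝ (Fin n) × ℝ × EuclideanSpace ℝ (Fin n) → ℝ}

/-- With p = q frozen, only u ∘ π and not Du enters, so the second derivatives grow just linearly in
m. -/
theorem IsRegular.hasC2Bound_boundary {ρ : EuclideanSpace ℝ (Fin n) → ℝ}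
    {π : EuclideanSpace ℝ (Fin n) → EuclideanSpace ℝ (Fin n)}
    (h : IsRegular Ω u) (hp : Patch Ω V P ρ π) (hV : IsOpen V) (hx : x ∈ V)
    (hu : ∀ y ∈ closure Ω, |u y| ≤ M)
    (hd1 : ∀ y ∈ closure Ω, ‖d1 (closure Ω) u y‖ ≤ M)
    (hd2 : ∀ y ∈ closure Ω, ‖d2 (closure Ω) u y‖ ≤ m) (hH : ContDiff ℝ 2 H)
    (hHK : ∀ x ∈ frontier Ω, ∀ z p, |z| ≤ M → ‖p‖ ≤ M →
      ∀ j : ℕ, j ≤ 2 → ‖iteratedFDeriv ℝ j H (x, z, p)‖ ≤ KG)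
    {q : EuclideanSpace ℝ (Fin n)} (hq : ‖q‖ ≤ M) :
    HasC2Bound (fun y => H (π y, u (π y), q)) x (KG * (P + M * P))
      (KG * (P + M * P) ^ 2 + KG * (P + (m * P ^ 2 + M * P))) := by
  have hπx := hp.π_mem x hx
  have hb := hHK (π x) hπx (u (π x)) q (hu _ (frontier_subset_closure hπx)) hq
  have hπ : HasC2Bound π x P P :=
    ⟨(hp.π_contDiffAt x hx).of_le (by norm_num), hp.π_bound₁ x hx, hp.π_bound₂ x hx⟩
  have h1 := hπ.clm_comp (c := 1)
    (ContinuousLinearMap.inl ℝ (EuclideanSpace ℝ (Fin n)) (ℝ × EuclideanSpace ℝ (Fin n)))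
    (ContinuousLinearMap.opNorm_le_bound _ zero_le_one fun v => by simp [Prod.norm_mk])
  have h2 := (h.hasC2Bound_comp hp hV hx hd1 hd2).clm_comp (c := 1)
    ((ContinuousLinearMap.inr ℝ (EuclideanSpace ℝ (Fin n)) (ℝ × EuclideanSpace ℝ (Fin n))).comp
      (ContinuousLinearMap.inl ℝ ℝ (EuclideanSpace ℝ (Fin n))))
    (ContinuousLinearMap.opNorm_le_bound _ zero_le_one fun v => by simp [Prod.norm_mk])
  have h3 : HasC2Bound (fun y => (π y, u (π y), q)) x (P + M * P) (P + (m * P ^ 2 + M * P)) := by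
    have := (h1.add h2).add (HasC2Bound.const ((0 : EuclideanSpace ℝ (Fin n)), (0 : ℝ), q))
    simpa using this
  exact h3.comp hH (by rw [norm_fderiv_eq]; exact hb 1 (by norm_num))
    (by rw [norm_fderiv_fderiv_eq]; exact hb 2 le_rfl)

/-- The oblique boundary condition, extended to uniform neighbourhoods of boundary points. -/
theorem exists_obliqueData (n : ℕ) {M KG β₀ P : ℝ} (hM : 0 < M) (hβ₀ : 0 < β₀) (hP : 1 ≤ P) :
    ∃ K₀ : ℝ, ∀ K, K₀ ≤ K → ∀ (Ω : Set (EuclideanSpace ℝ (Fin n)))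
      (G : EuclideanSpace ℝ (Fin n) × ℝ × EuclideanSpace ℝ (Fin n) → ℝ)
      (u : EuclideanSpace ℝ (Fin n) → ℝ) (m r : ℝ), 0 < r →
      IsRegular Ω u → IsC2BoundaryWithNormLE Ω M G KG → IsStrictlyOblique Ω G β₀ →
      GppEqZero Ω G →
      (∀ x ∈ frontier Ω, G (x, u x, gradientWithin u (closure Ω) x) = 0) →
      (∀ x ∈ closure Ω, |u x| ≤ M) → (∀ x ∈ closure Ω, ‖d1 (closure Ω) u x‖ ≤ M) →
      (∀ x ∈ closure Ω, ‖d2 (closure Ω) u x‖ ≤ m) →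
      ∀ x₀ ∈ frontier Ω, ∀ ρ π, Patch Ω (Metric.ball x₀ r) P ρ π →
        ∃ A β, ObliqueData Ω u x₀ r K (1 + m) ρ π A β := by
  set E := EuclideanSpace ℝ (Fin n)
  set t : ℝ := (P + M * P) + (P + M * P) ^ 2 + (P + P ^ 2 + M * P) with ht
  have ht0 : 0 ≤ t := by positivity
  set k₁ : ℝ := |KG| * t with hk₁
  have hk₁0 : 0 ≤ k₁ := by positivity
  refine ⟨P + k₁ + n * (M⁻¹ * (2 * (|KG| + k₁))) + P / β₀, ?_⟩
  intro K hK Ω G u m r hr h hC2 hobl hpp hbd hu hd1 hd2 x₀ hx₀ ρ π hp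
  obtain ⟨H, hH, hHG, hHK⟩ := hC2
  have hm0 : 0 ≤ m := (norm_nonneg _).trans (hd2 x₀ (frontier_subset_closure hx₀))
  have hV := Metric.isOpen_ball (x := x₀) (ε := r)
  have hKG : 0 ≤ KG := (norm_nonneg _).trans (hHK x₀ hx₀ 0 0 (by simpa using hM.le)
    (by simpa using hM.le) 0 (by norm_num))
  have hKG' : |KG| = KG := abs_of_nonneg hKG
  rw [hKG'] at hK hk₁
  have q0 : 0 ≤ n * (M⁻¹ * (2 * (KG + k₁))) := by positivity
  have q1 : 0 ≤ P / β₀ := by positivity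
  have hKP : P ≤ K := by linarith
  have hKk : k₁ ≤ K := by linarith
  have hKA : n * (M⁻¹ * (2 * (KG + k₁))) ≤ K := by linarith
  have hKβ : P / β₀ ≤ K := by linarith
  have hK0 : 0 ≤ K := by linarith
  have hM0 : ‖(0 : E)‖ ≤ M := by simpa using hM.le
  have hMe : ∀ i : Fin n, ‖M • (EuclideanSpace.single i 1 : E)‖ ≤ M := fun i => by
    rw [norm_smul, PiLp.norm_single, norm_one, mul_one, Real.norm_of_nonneg hM.le]
  let ψ : E → E → ℝ := fun q y => H (π y, u (π y), q)
  have hψ : ∀ q, ‖q‖ ≤ M → ∀ x ∈ Metric.ball x₀ r, HasC2Bound (ψ q) x k₁ (k₁ * (1 + m)) := by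
    intro q hq x hx
    refine (h.hasC2Bound_boundary hp hV hx hu hd1 hd2 hH hHK hq).mono ?_ ?_
    · rw [hk₁]
      refine mul_le_mul_of_nonneg_left ?_ hKG
      have : 0 ≤ (P + M * P) ^ 2 + (P + P ^ 2 + M * P) := by positivity
      linarith
    · rw [hk₁, ← mul_add, mul_assoc]
      refine mul_le_mul_of_nonneg_left ?_ hKG
      have : 0 ≤ P ^ 2 + (P + M * P) + m * ((P + M * P) + (P + M * P) ^ 2 + (P + M * P)) := by
        positivity
      rw [ht]
      linarith
  have hψ0 : ∀ q, ‖q‖ ≤ M → ∀ x ∈ Metric.ball x₀ r, |ψ q x| ≤ KG := by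
    intro q hq x hx
    have hπx := hp.π_mem x hx
    have := hHK (π x) hπx (u (π x)) q (hu _ (frontier_subset_closure hπx)) hq 0 (by norm_num)
    rwa [norm_iteratedFDeriv_zero, Real.norm_eq_abs] at this
  let L : Fin n → ℝ →L[ℝ] E := fun i =>
    M⁻¹ • ContinuousLinearMap.toSpanSingleton ℝ (EuclideanSpace.single i 1 : E)
  have hL : ∀ i, ‖L i‖ ≤ M⁻¹ := fun i => by
    rw [norm_smul, ContinuousLinearMap.norm_toSpanSingleton, PiLp.norm_single, norm_one,
      mul_one, Real.norm_of_nonneg (by positivity)]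
  -- G_p is written as difference quotients of H between p = 0 and p = M e_i, which are exact
  -- because G is affine in p. In this way A is C² although H is only C², and just the range |p| ≤ M
  -- is used, where the norm of H is controlled.
  let A : E → E := fun x =>
    ∑ i, L i (ψ (M • EuclideanSpace.single i 1) x + (-ContinuousLinearMap.id ℝ ℝ) (ψ 0 x))
  have hAb : ∀ x ∈ Metric.ball x₀ r, HasC2Bound A x K (K * (1 + m)) := by
    intro x hx
    have h1 := HasC2Bound.sum Finset.univ fun i _ => ((hψ _ (hMe i) x hx).add
      ((hψ 0 hM0 x hx).clm_comp (-ContinuousLinearMap.id ℝ ℝ) (c := 1)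
        (by rw [norm_neg]; exact ContinuousLinearMap.norm_id_le))).clm_comp (L i) (hL i)
    have h2 : n * (M⁻¹ * (2 * k₁)) ≤ K := by
      refine le_trans ?_ hKA
      gcongr
      linarith
    rw [Finset.card_univ, Fintype.card_fin] at h1
    refine h1.mono ?_ ?_
    · linarith
    · have := mul_le_mul_of_nonneg_right h2 (show 0 ≤ 1 + m by linarith)
      linarith
  have hA0 : ∀ x ∈ Metric.ball x₀ r, ‖A x‖ ≤ K := by
    intro x hx
    refine le_trans ?_ hKA
    refine (norm_sum_le _ _).trans ?_
    calc ∑ i, ‖L i (ψ (M • EuclideanSpace.single i 1) x + (-ContinuousLinearMap.id ℝ ℝ) (ψ 0 x))‖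
        ≤ ∑ _i : Fin n, M⁻¹ * (2 * (KG + k₁)) := by
          refine Finset.sum_le_sum fun i _ => norm_apply_le _ (hL i) ?_
          have a1 := hψ0 _ (hMe i) x hx
          have a2 := hψ0 0 hM0 x hx
          rw [neg_apply, ContinuousLinearMap.id_apply, ← sub_eq_add_neg, Real.norm_eq_abs]
          refine (abs_sub _ _).trans ?_
          linarith
      _ = _ := by simp
  have hAgrad : ∀ x ∈ Metric.ball x₀ r, A x = gradient (fun q => G (π x, u (π x), q)) 0 ∧
      ∀ q, G (π x, u (π x), q)
        = G (π x, u (π x), 0) + fderiv ℝ (fun q => G (π x, u (π x), q)) 0 q := by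
    intro x hx
    have hπx := hp.π_mem x hx
    set g : E → ℝ := fun q => G (π x, u (π x), q) with hg
    have hgH : g = fun q => H (π x, u (π x), q) := funext fun q => (hHG _ hπx _ _).symm
    have hgc : ContDiff ℝ 2 g := by
      rw [hgH]
      exact hH.comp (contDiff_const.prodMk (contDiff_const.prodMk contDiff_id))
    have haff := eq_add_fderiv_of_iteratedFDeriv_two_eq_zero hgc (hpp _ hπx _)
    refine ⟨?_, haff⟩
    rw [← (EuclideanSpace.basisFun (Fin n) ℝ).sum_repr' (gradient g 0)]
    refine Finset.sum_congr rfl fun i _ => ?_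
    have e1 : ∀ q, ψ q x = g q := fun q => by rw [hgH]
    have e2 : ψ (M • EuclideanSpace.single i 1) x - ψ 0 x
        = M * fderiv ℝ g 0 (EuclideanSpace.single i 1) := by
      rw [e1, e1, haff, map_smul, smul_eq_mul]; ring
    rw [neg_apply, ContinuousLinearMap.id_apply, ← sub_eq_add_neg, e2, real_inner_comm, gradient,
      InnerProductSpace.toDual_symm_apply, EuclideanSpace.basisFun_apply]
    simp only [L, smul_apply, ContinuousLinearMap.toSpanSingleton_apply, smul_smul]
    rw [inv_mul_cancel_left₀ hM.ne']
  -- Here β is G(·, u, 0), evaluated along π.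
  refine ⟨A, ψ 0, ?_⟩
  refine ⟨hp.mono Subset.rfl hKP, fun x hx => (hAb x hx).contDiffAt,
    fun x hx => (hψ 0 hM0 x hx).contDiffAt, hA0, fun x hx => (hAb x hx).fderiv_le,
    fun x hx => (hAb x hx).fderiv_fderiv_le, fun x hx => (hψ 0 hM0 x hx).fderiv_le.trans hKk,
    fun x hx => (hψ 0 hM0 x hx).fderiv_fderiv_le.trans
      (mul_le_mul_of_nonneg_right hKk (by linarith)), ?_, ?_⟩
  · intro x hx
    have hπx := hp.π_mem x hx
    obtain ⟨h1, h2⟩ := hAgrad x hx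
    have h3 := hbd (π x) hπx
    rw [h2, ← InnerProductSpace.toDual_symm_apply, ← gradient, ← h1, real_inner_comm,
      gradientWithin, InnerProductSpace.toDual_symm_apply] at h3
    have h4 : ψ 0 x = G (π x, u (π x), 0) := hHG _ hπx _ _
    rw [h4]
    rw [d1]
    linarith
  · intro x hx hxf
    obtain ⟨h1, -⟩ := hAgrad x hx
    rw [hp.π_eq x hx hxf] at h1
    have h2 := hobl x hxf _ ⟨ρ, hp.isLocalDefiningFunction hV hx, rfl⟩ (u x) 0
    rw [← h1, real_inner_smul_right, real_inner_comm] at h2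
    have h3 : inner ℝ (gradient ρ x) (A x) = fderiv ℝ ρ x (A x) := by
      rw [gradient, InnerProductSpace.toDual_symm_apply]
    have h4 : ‖gradient ρ x‖ = ‖fderiv ℝ ρ x‖ := by
      rw [gradient, LinearIsometryEquiv.norm_map]
    rw [h3, h4] at h2
    have h5 := hp.ρ_grad x hx
    have h6 : 0 < ‖fderiv ℝ ρ x‖ := norm_pos_iff.2 (hp.fderiv_ne_zero hx)
    rw [inv_mul_eq_div, le_div_iff₀ h6] at h2
    have h7 : 1 ≤ P / β₀ * fderiv ℝ ρ x (A x) := by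
      rw [div_mul_eq_mul_div, le_div_iff₀ hβ₀, one_mul]
      nlinarith
    have h8 : 0 ≤ fderiv ℝ ρ x (A x) := le_trans (by positivity) h2
    exact h7.trans (mul_le_mul_of_nonneg_right hKβ h8)

end BoundaryData

/-! ### Assembly of the final estimate. -/

theorem norm_iteratedFDerivWithin_two_eq {E : Type*} [NormedAddCommGroup E] [NormedSpace ℝ E]
    {S : Set E} (hS : UniqueDiffOn ℝ S) (u : E → ℝ) {x : E} (hx : x ∈ S) :
    ‖iteratedFDerivWithin ℝ 2 u S x‖ = ‖d2 S u x‖ := by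
  rw [← norm_iteratedFDerivWithin_fderivWithin hS hx,
    ← norm_iteratedFDerivWithin_fderivWithin hS hx, norm_iteratedFDerivWithin_zero]
  rfl

theorem norm_gradientWithin_eq {n : ℕ} (S : Set (EuclideanSpace ℝ (Fin n)))
    (u : EuclideanSpace ℝ (Fin n) → ℝ) (x : EuclideanSpace ℝ (Fin n)) :
    ‖gradientWithin u S x‖ = ‖d1 S u x‖ := by
  rw [gradientWithin, LinearIsometryEquiv.norm_map]
  rfl

/-- The second derivative estimate. -/
theorem exists_hessian_bound (n k l : ℕ) (hlk : l < k) (hkn : k ≤ n)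
    (γ : ℝ) (hγ : 1 ≤ γ) (hkγ : k < n ∨ 1 < γ)
    (Ω : Set (EuclideanSpace ℝ (Fin n))) (hΩ : IsBoundedCmDomain 4 Ω)
    (β₀ : ℝ) (hβ₀ : 0 < β₀) (M Kf KG : ℝ) :
    ∃ C : ℝ, 0 < C ∧
      ∀ (f : EuclideanSpace ℝ (Fin n) × ℝ → ℝ)
        (G : EuclideanSpace ℝ (Fin n) × ℝ × EuclideanSpace ℝ (Fin n) → ℝ)
        (u : EuclideanSpace ℝ (Fin n) → ℝ),
        (∀ x ∈ closure Ω, ∀ z : ℝ, 0 ≤ f (x, z)) →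
        IsC11 Ω (fun y => f y ^ (1 / ((k : ℝ) - (l : ℝ)))) →
        C11NormLE Ω M (fun y => f y ^ (1 / ((k : ℝ) - (l : ℝ)))) Kf →
        IsC2BoundaryWithNormLE Ω M G KG →
        IsStrictlyOblique Ω G β₀ →
        GppEqZero Ω G →
        ContDiffOn ℝ 4 u (closure Ω) →
        IsAdmissible Ω γ k u →
        IsSolution Ω γ k l f G u →
        C1NormLE Ω u M →
        ∀ x ∈ closure Ω, ‖iteratedFDerivWithin ℝ 2 u (closure Ω) x‖ ≤ C := by
  have hS := uniqueDiffOn_closure hΩ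
  by_cases hM : 0 < M
  · obtain ⟨r, P, hr, hr1, hP, hpatch⟩ := exists_uniform_patch hΩ
    obtain ⟨lam, K₁, hlam, hell⟩ := exists_isElliptic n k l hlk hkn γ hγ hkγ M Kf hM.le
    obtain ⟨K₂, hobl⟩ := exists_obliqueData n (KG := KG) hM hβ₀ hP
    set K : ℝ := max (max 1 M) (max K₁ K₂) with hK
    have hK1 : 1 ≤ K := (le_max_left _ _).trans (le_max_left _ _)
    have hKM : M ≤ K := (le_max_right _ _).trans (le_max_left _ _)
    have hKK₁ : K₁ ≤ K := (le_max_left _ _).trans (le_max_right _ _)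
    have hKK₂ : K₂ ≤ K := (le_max_right _ _).trans (le_max_right _ _)
    obtain ⟨C, hC, hbound⟩ := exists_second_derivative_bound (EuclideanSpace ℝ (Fin n)) (Fin n)
      hr hr1 hlam hK1
    refine ⟨C + 1, by linarith, ?_⟩
    intro f G u _ hφ hφK hG hGβ hGp hu hadm hsol hu1 x hx
    have h : IsRegular Ω u := ⟨hΩ.isOpen, hS, hu⟩
    have hu0 : ∀ x ∈ closure Ω, |u x| ≤ M := fun x hx => (hu1 x hx).1
    have hd1 : ∀ x ∈ closure Ω, ‖d1 (closure Ω) u x‖ ≤ M := fun x hx => by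
      rw [← norm_gradientWithin_eq]; exact (hu1 x hx).2
    -- All constants were fixed before u; m is now taken to be the actual maximum of |D²u|, as the
    -- absorption requires.
    obtain ⟨x₁, hx₁, hmax⟩ := hΩ.isBounded.isCompact_closure.exists_isMaxOn ⟨x, hx⟩
      h.c2.continuousOn.norm
    set m := ‖d2 (closure Ω) u x₁‖ with hm
    have hd2 : ∀ x ∈ closure Ω, ‖d2 (closure Ω) u x‖ ≤ m := fun x hx => hmax hx
    have hprob : Problem Ω u (EuclideanSpace.basisFun (Fin n) ℝ) r lam K m :=
      { regular := h
        bounded := hΩ.isBounded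
        m_nonneg := norm_nonneg _
        d1_le := fun x hx => (hd1 x hx).trans hKM
        d2_le := hd2
        elliptic := hell K hKK₁ Ω f u m h hφ hφK hadm hsol.equation hu0 hd1 hd2
        laplace_nonneg := fun x hx => by
          rw [← h.trace_hessian (subset_closure hx)]
          exact (laplace_pos (by omega) hkn hγ hkγ h hadm hx).le
        boundary := fun x₀ hx₀ => by
          obtain ⟨ρ, π, hp⟩ := hpatch x₀ hx₀
          exact ⟨ρ, π, hobl K hKK₂ Ω G u m r hr h hG hGβ hGp hsol.boundary hu0 hd1 hd2 x₀ hx₀ ρ π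
            hp⟩ }
    rw [norm_iteratedFDerivWithin_two_eq hS u hx]
    exact ((hd2 x hx).trans (hbound Ω u _ m hprob ⟨x₁, hx₁, hm.symm⟩)).trans (by linarith)
  -- For M ≤ 0 the gradient vanishes identically, and so does the Hessian.
  · refine ⟨1, one_pos, ?_⟩
    intro f G u _ _ _ _ _ _ _ _ _ hu1 x hx
    have hd1 : ∀ x ∈ closure Ω, d1 (closure Ω) u x = 0 := fun x hx => by
      rw [← norm_le_zero_iff, ← norm_gradientWithin_eq]
      exact (hu1 x hx).2.trans (not_lt.1 hM)
    have hd2 : d2 (closure Ω) u x = 0 := by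
      rw [d2, fderivWithin_congr hd1 (hd1 x hx), fderivWithin_const_apply]
    rw [norm_iteratedFDerivWithin_two_eq hS u hx, hd2, norm_zero]
    exact zero_le_one

end HessianQuotient
end

theorem lemma4p5 (n k l : ℕ) (hlk : l < k) (hkn : k ≤ n)
    (γ : ℝ) (hγ : 1 ≤ γ) (hkγ : k < n ∨ 1 < γ)
    (Ω : Set (EuclideanSpace ℝ (Fin n))) (hΩ : HessianQuotient.IsBoundedCmDomain 4 Ω)
    (β₀ : ℝ) (hβ₀ : 0 < β₀) (M Kf KG : ℝ) :
    ∃ C : ℝ, 0 < C ∧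
      ∀ (f : EuclideanSpace ℝ (Fin n) × ℝ → ℝ)
        (G : EuclideanSpace ℝ (Fin n) × ℝ × EuclideanSpace ℝ (Fin n) → ℝ)
        (u : EuclideanSpace ℝ (Fin n) → ℝ),
        (∀ x ∈ closure Ω, ∀ z : ℝ, 0 ≤ f (x, z)) →
        HessianQuotient.IsC11 Ω (fun y => f y ^ (1 / ((k : ℝ) - (l : ℝ)))) →
        HessianQuotient.C11NormLE Ω M (fun y => f y ^ (1 / ((k : ℝ) - (l : ℝ)))) Kf →
        HessianQuotient.IsC2BoundaryWithNormLE Ω M G KG →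
        HessianQuotient.IsStrictlyOblique Ω G β₀ →
        HessianQuotient.GppEqZero Ω G →
        ContDiffOn ℝ 4 u (closure Ω) →
        HessianQuotient.IsAdmissible Ω γ k u →
        HessianQuotient.IsSolution Ω γ k l f G u →
        HessianQuotient.C1NormLE Ω u M →
        ∀ x ∈ closure Ω, ‖iteratedFDerivWithin ℝ 2 u (closure Ω) x‖ ≤ C := by
  exact HessianQuotient.exists_hessian_bound n k l hlk hkn γ hγ hkγ Ω hΩ β₀ hβ₀ M Kf KG
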